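/- **Setting.** Let $K$ be an algebraically closed field of characteristic $p\ge 0$, let $r,n\ge 1$ be integers with $p\nmid r$, and let $q\in K^\times$ (the value to which the parameter is specialized). Number the $r$-th roots of unity of $K$ as $\zeta_1,\dots,\zeta_r$. For $m\ge 0$ let $\widehat W_m=\mathbb Z^m\rtimes\mathfrak S_m$, with translations $X_1,\dots,X_m$ satisfying $\sigma X_j\sigma^{-1}=X_{\sigma(j)}$. It is generated by $s_i=(i,i+1)$ $(1\le i\le m-1)$ and $s_0=s_{m-1}\cdots s_2s_1s_2\cdots s_{m-1}X_1X_m^{-1}$ (for $m\ge 2$; there are no $s_i$ if $m\le 1$) and $\rho=s_{m-1}\cdots s_1X_1$ ($\rho=1$ if $m=0$). A reduced expression of $w\in\widehat W_m$ is $w=\rho^k s_{i_1}\cdots s_{i_l}$ with $l$ minimal. * $\widehat{\mathcal H}_m$ is the extended affine Hecke algebra of type $A$: the $K$-algebra generated by $S_{s_i}$ $(0\le i\le m-1)$ and $S_\rho^{\pm1}$, with $S_\rho S_{s_i}=S_{s_{i-1}}S_\rho$, the braid relations ($S_{s_i}S_{s_j}=S_{s_j}S_{s_i}$ if $i-j\not\equiv\pm1$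 mod $m$, and $S_{s_i}S_{s_{i+1}}S_{s_i}=S_{s_{i+1}}S_{s_i}S_{s_{i+1}}$ if $m\ge 3$), and $S_{s_i}^2=1+(q-q^{-1})S_{s_i}$, indices modulo $m$; there are no $S_{s_i}$ if $m\le1$, so $\widehat{\mathcal H}_1=K[S_\rho^{\pm1}]$, and $\widehat{\mathcal H}_0=K$. Its standard basis is $S_w=S_\rho^kS_{s_{i_1}}\cdots S_{s_{i_l}}$ for a reduced expression of $w\in\widehat W_m$. * $\widehat H^{\mathrm{aff}}_{r,n}$ is the $K$-algebra generated by $t_1,\dots,t_n$, $T_{s_0},\dots,T_{s_{n-1}}$ (no $T_{s_i}$ if $n=1$), $T_\rho^{\pm1}$ with $t_j^r=1$, $t_it_j=t_jt_i$, $T_{s_i}t_j=t_{s_i(j)}T_{s_i}$ $(1\le i\le n-1)$, $T_\rho t_j=t_{j-1}T_\rho$, $T_\rho T_{s_i}=T_{s_{i-1}}T_\rho$, the same braid relations, and $T_{s_i}^2=1+(q-q^{-1})e_iT_{s_i}$, $e_i=\frac1r\sum_{s=0}^{r-1}t_i^st_{i+1}^{-s}$ (indices modulo $n$). Put $T_w=T_\rho^kT_{s_{i_1}}\cdots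 T_{s_{i_l}}$ for a reduced expression of $w\in\widehat W_n$. * $\widehat Y_{r,n}$ is the affine Yokonuma–Hecke algebra: the $K$-algebra generated by $\bar t_1,\dots,\bar t_n$, $g_1,\dots,g_{n-1}$, $X_1^{\pm1}$ with $g_ig_j=g_jg_i$ for $|i-j|\ge2$, $g_ig_{i+1}g_i=g_{i+1}g_ig_{i+1}$, $\bar t_i\bar t_j=\bar t_j\bar t_i$, $g_i\bar t_j=\bar t_{s_i(j)}g_i$, $\bar t_j^r=1$, $g_i^2=1+(q-q^{-1})\bar e_ig_i$ with $\bar e_i=\frac1r\sum_{s=0}^{r-1}\bar t_i^s\bar t_{i+1}^{-s}$, $g_1X_1g_1X_1=X_1g_1X_1g_1$, $g_iX_1=X_1g_i$ $(i\ge 2)$, $\bar t_jX_1=X_1\bar t_j$. Put $X_n=g_{n-1}\cdots g_1X_1g_1\cdots g_{n-1}$. A character $\chi$ of $(\mathbb Z/r)^n$ is given by the values $\chi(t_j)\in\{\zeta_1,\dots,\zeta_r\}$; $\mathfrak S_n$ acts by $(w\chi)(t_j)=\chi(t_{w^{-1}(j)})$ and $\widehat W_n$ acts through $\mathfrak S_n$.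 Let $E_\chi=\prod_{i=1}^n\bigl(\frac1r\sum_{s=0}^{r-1}\chi(t_i)^st_i^{-s}\bigr)\in\widehat H^{\mathrm{aff}}_{r,n}$. For an $r$-composition $\mu\models n$ (parts $0$ allowed) let $E_\mu$ be the sum of the $E_\chi$ for which, for every $a$, exactly $\mu_a$ of the values $\chi(t_j)$ equal $\zeta_a$. Let $\chi_1^\mu$ take the value $\zeta_1$ on the first $\mu_1$ of the $t_j$, $\zeta_2$ on the next $\mu_2$, and so on. Its stabilizers in $\mathfrak S_n$ and $\widehat W_n$ are $\mathfrak S^\mu=\mathfrak S_{\mu_1}\times\cdots\times\mathfrak S_{\mu_r}$ and $\widehat{\mathfrak S^\mu}=\mathbb Z^n\rtimes\mathfrak S^\mu=\widehat W_{\mu_1}\times\cdots\times\widehat W_{\mu_r}$. Let $\pi_{1,\mu},\dots,\pi_{m_\mu,\mu}$ be the minimal length representatives of the left cosets in $\mathfrak S_n/\mathfrak S^\mu$, in any order, and $\chi_k^\mu=\pi_{k,\mu}(\chi_1^\mu)$. Finally let $\widehat H^\mu=\widehat{\mathcal H}_{\mu_1}\otimes_K\cdots\otimes_K\widehat{\mathcal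 H}_{\mu_r}$, with the elements $S_w=S_{w_1}\otimes\cdots\otimes S_{w_r}$ for $w=(w_1,\dots,w_r)\in\widehat{\mathfrak S^\mu}$. **Theorem.** 1. There is an isomorphism of $K$-algebras $$\Phi_{r,n}:\ \widehat H^{\mathrm{aff}}_{r,n}\ \xrightarrow{\ \sim\ }\ \bigoplus_{\mu\models n}\mathrm{Mat}_{m_\mu}(\widehat H^\mu)$$ which maps $E_\mu$ to the identity of the summand with index $\mu$ and satisfies $$\Phi_{r,n}(E_{\chi_k^\mu}T_w)=S_{\pi_{k,\mu}^{-1}w\pi_{j,\mu}}M_{k,j}\in \mathrm{Mat}_{m_\mu}(\widehat H^\mu)$$ for all $\mu\models n$, $w\in\widehat W_n$ and $k,j$ with $w(\chi_j^\mu)=\chi_k^\mu$, where $M_{k,j}$ is the elementary matrix. Its inverse $\Psi_{r,n}$ satisfies, for all $\mu\models n$ and $w_{i,j}\in\widehat{\mathfrak S^\mu}$, $$\Psi_{r,n}\bigl((S_{w_{i,j}})_{1\le i,j\le m_\mu}\bigr)=\sum_{1\le i,j\le m_\mu}E_{\chi_i^\mu}T_{\pi_{i,\mu}w_{i,j}\pi_{j,\mu}^{-1}}E_{\chi_j^\mu}.$$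 2. There is an isomorphism of $K$-algebras $\Phi:\widehat H^{\mathrm{aff}}_{r,n}\to\widehat Y_{r,n}$ with $\Phi(t_j)=\bar t_j$, $\Phi(T_{s_i})=g_i$ for $1\le i\le n-1$, $\Phi(T_{s_0})=X_1^{-1}X_n(g_{n-1}\cdots g_2g_1g_2\cdots g_{n-1})^{-1}$ (if $n\ge2$) and $\Phi(T_\rho)=g_{n-1}\cdots g_1X_1$. Hence $\Phi_{r,n}\circ\Phi^{-1}$ is an isomorphism of $K$-algebras $\widehat Y_{r,n}\cong\bigoplus_{\mu\models n}\mathrm{Mat}_{m_\mu}(\widehat H^\mu)$. -/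

import Mathlib

namespace AYH

noncomputable section

/-! ### The extended affine Weyl group of type `A`

Everything is indexed from `0`: the position `j` of the literature (`1 ≤ j ≤ n`) is the element
`j - 1` of `Fin n`, and the simple reflection `s_i` (`0 ≤ i ≤ n - 1`, indices modulo `n`) is
labelled by the element of `Fin n` congruent to `i - 1`. Thus the label `i` stands for the
reflection in the positions `i` and `i + 1` (cyclically), and the affine reflection `s_0` has the
last label. -/

/-- `j ↦ j + 1`, cyclically. -/
abbrev nxt {n : ℕ} : Equiv.Perm (Fin n) := finRotate n

/-- `j ↦ j - 1`, cyclically. -/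
abbrev prv {n : ℕ} : Equiv.Perm (Fin n) := (finRotate n)⁻¹

/-- Labels of the simple reflections of the affine Weyl group: `n` of them if `n ≥ 2`, and none
if `n ≤ 1`. -/
abbrev Node (n : ℕ) := {_i : Fin n // 2 ≤ n}

/-- Labels of the simple reflections `s_1, …, s_{n-1}` of the symmetric group. -/
abbrev FNode (n : ℕ) := {i : Fin n // (i : ℕ) + 1 < n}

/-- A finite simple reflection is one of the affine simple reflections. -/
def FNode.toNode {n : ℕ} (i : FNode n) : Node n := ⟨i.1, by have := i.2; omega⟩

def Node.next {n : ℕ} (i : Node n) : Node n := ⟨nxt i.1, i.2⟩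

def Node.prev {n : ℕ} (i : Node n) : Node n := ⟨prv i.1, i.2⟩

/-- The affine reflection `s_0`. -/
def Node.zero {n : ℕ} (h : 2 ≤ n) : Node n := ⟨⟨n - 1, by omega⟩, h⟩

/-- The permutation action on `ℤ ^ n`, `σ X_j σ⁻¹ = X_{σ j}`. -/
def permAct (n : ℕ) : Equiv.Perm (Fin n) →* MulAut (Multiplicative (Fin n → ℤ)) where
  toFun σ :=
    { toFun := fun l => Multiplicative.ofAdd fun i => l.toAdd (σ⁻¹ i)
      invFun := fun l => Multiplicative.ofAdd fun i => l.toAdd (σ i)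
      left_inv := fun l => by ext i; simp
      right_inv := fun l => by ext i; simp
      map_mul' := fun l m => by ext i; simp }
  map_one' := by ext l i; simp
  map_mul' σ τ := by ext l i; simp

lemma toAdd_permAct {n : ℕ} (σ : Equiv.Perm (Fin n)) (l : Multiplicative (Fin n → ℤ))
    (i : Fin n) : (permAct n σ l).toAdd i = l.toAdd (σ⁻¹ i) := rfl

/-- The extended affine Weyl group `ℤ ^ n ⋊ 𝔖_n`. -/
abbrev EW (n : ℕ) := Multiplicative (Fin n → ℤ) ⋊[permAct n] Equiv.Perm (Fin n)

/-- The translation `X_j`. -/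
def transl {n : ℕ} (j : Fin n) : Multiplicative (Fin n → ℤ) :=
  Multiplicative.ofAdd (Pi.single j 1)

/-- The transposition of the positions `i` and `i + 1`. -/
abbrev adjSwap {n : ℕ} (i : Fin n) : Equiv.Perm (Fin n) := Equiv.swap i (nxt i)

/-- `s_i = (i, i + 1)` for a finite label, `s_0 = (1, n) X_1 X_n⁻¹` for the last one. -/
def EW.s {n : ℕ} (i : Node n) : EW n :=
  SemidirectProduct.inr (adjSwap i.1) *
    SemidirectProduct.inl
      (if (i.1 : ℕ) + 1 < n then 1 else transl (nxt i.1) * (transl i.1)⁻¹)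

/-- `ρ = s_{n-1} ⋯ s_1 X_1`; here `s_{n-1} ⋯ s_1` is the cycle `j ↦ j - 1`. It is trivial
if `n = 0`. -/
def EW.rho (n : ℕ) : EW n :=
  SemidirectProduct.inr prv *
    SemidirectProduct.inl (if h : 0 < n then transl ⟨0, h⟩ else 1)

/-- `w = ρ ^ k s_{i_1} ⋯ s_{i_l}`, for `e = (k, [i_1, …, i_l])`. -/
def IsExpr {n : ℕ} (w : EW n) (e : ℤ × List (Node n)) : Prop :=
  w = EW.rho n ^ e.1 * (e.2.map EW.s).prod

lemma nxt_val {n : ℕ} (i : Fin n) :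
    ((nxt i : Fin n) : ℕ) = if (i : ℕ) + 1 < n then (i : ℕ) + 1 else 0 := by
  obtain _ | n := n
  · exact i.elim0
  · obtain ⟨i, hi⟩ := i
    by_cases h : i < n
    · rw [nxt, finRotate_of_lt h]; simp [h]
    · obtain rfl : i = n := by omega
      rw [nxt, finRotate_last']; simp

lemma inl_transl_mul_inr {n : ℕ} (j : Fin n) (σ : Equiv.Perm (Fin n)) :
    (SemidirectProduct.inl (transl j) * SemidirectProduct.inr σ : EW n) =
      SemidirectProduct.inr σ * SemidirectProduct.inl (transl (σ⁻¹ j)) := by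
  refine SemidirectProduct.ext ?_ (by simp)
  apply Multiplicative.toAdd.injective
  funext k
  simp only [SemidirectProduct.mul_left, SemidirectProduct.left_inl, SemidirectProduct.left_inr,
    SemidirectProduct.right_inl, SemidirectProduct.right_inr, map_one, mul_one, one_mul,
    toAdd_permAct, transl, toAdd_ofAdd, Pi.single_apply, EmbeddingLike.apply_eq_iff_eq]

lemma rho_mul_s {n : ℕ} (i : Node n) : EW.rho n * EW.s i.next = EW.s i * EW.rho n := by
  obtain ⟨i, hn⟩ := i
  have hn0 : 0 < n := by omega
  have hv := nxt_val i
  have hvv := nxt_val (nxt i)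
  have hi := i.2
  have hs : (prv * adjSwap (nxt i) : Equiv.Perm (Fin n)) = adjSwap i * prv := by
    rw [adjSwap, adjSwap, Equiv.swap_apply_apply nxt i (nxt i)]
    simp [mul_assoc]
  have hs' : (SemidirectProduct.inr prv * SemidirectProduct.inr (adjSwap (nxt i)) : EW n) =
      SemidirectProduct.inr (adjSwap i) * SemidirectProduct.inr prv := by
    rw [← map_mul, hs, map_mul]
  simp only [EW.rho, EW.s, Node.next, hn0, dif_pos]
  by_cases h1 : (i : ℕ) + 1 < n
  · rw [if_pos h1] at hv
    rw [hv] at hvv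
    by_cases h2 : (i : ℕ) + 1 + 1 < n
    · rw [if_pos h2] at hvv
      have e : adjSwap (nxt i) (⟨0, hn0⟩ : Fin n) = ⟨0, hn0⟩ := by
        apply Equiv.swap_apply_of_ne_of_ne <;> simp only [ne_eq, Fin.ext_iff] <;> omega
      have := inl_transl_mul_inr ⟨0, hn0⟩ (adjSwap (nxt i))
      rw [Equiv.swap_inv, e] at this
      simp only [hv, h1, h2, if_true, map_one, mul_one]
      rw [mul_assoc, this, ← mul_assoc, hs', mul_assoc]
    · rw [if_neg h2] at hvv
      have e0 : nxt (nxt i) = (⟨0, hn0⟩ : Fin n) := Fin.ext hvv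
      have e : adjSwap (nxt i) (⟨0, hn0⟩ : Fin n) = nxt i := by
        rw [← e0, adjSwap, Equiv.swap_apply_right]
      have := inl_transl_mul_inr ⟨0, hn0⟩ (adjSwap (nxt i))
      rw [Equiv.swap_inv, e] at this
      simp only [hv, h1, h2, if_true, if_false, map_one, mul_one, e0]
      rw [mul_assoc, ← mul_assoc (SemidirectProduct.inl _), this, mul_assoc, ← map_mul,
        mul_comm (transl (⟨0, hn0⟩ : Fin n)), mul_inv_cancel_left, ← mul_assoc, hs', mul_assoc]
  · rw [if_neg h1] at hv
    have e0 : nxt i = (⟨0, hn0⟩ : Fin n) := Fin.ext hv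
    have h2 : ((nxt i : Fin n) : ℕ) + 1 < n := by omega
    have e : adjSwap (nxt i) (⟨0, hn0⟩ : Fin n) = nxt (nxt i) := by
      rw [← e0, adjSwap, Equiv.swap_apply_left]
    have := inl_transl_mul_inr ⟨0, hn0⟩ (adjSwap (nxt i))
    rw [Equiv.swap_inv, e] at this
    have t1 := inl_transl_mul_inr (nxt i) prv
    have t2 := inl_transl_mul_inr i prv
    have t2' : ((SemidirectProduct.inl (transl i))⁻¹ * SemidirectProduct.inr prv : EW n) =
        SemidirectProduct.inr prv * (SemidirectProduct.inl (transl (prv⁻¹ i)))⁻¹ := by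
      rw [inv_mul_eq_iff_eq_mul, ← mul_assoc, t2, mul_inv_cancel_right]
    rw [inv_inv] at t1 t2'
    simp only [h1, h2, if_true, if_false, map_one, mul_one]
    rw [map_mul, map_inv (SemidirectProduct.inl : Multiplicative (Fin n → ℤ) →* EW n)]
    rw [mul_assoc, this, ← mul_assoc, hs']
    simp only [mul_assoc]
    rw [← mul_assoc (SemidirectProduct.inl (transl i))⁻¹, t2',
      mul_assoc (SemidirectProduct.inr prv), ← mul_assoc (SemidirectProduct.inl (transl (nxt i))),
      t1, show finRotate n i = ⟨0, hn0⟩ from e0, inv_mul_cancel, mul_one]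

lemma isExpr_mul_s {n : ℕ} {w : EW n} (h : ∃ e, IsExpr w e) (i : Node n) :
    ∃ e, IsExpr (w * EW.s i) e := by
  obtain ⟨⟨k, l⟩, rfl⟩ := h
  exact ⟨(k, l ++ [i]), by simp [IsExpr, mul_assoc]⟩

lemma isExpr_mul_rho {n : ℕ} {w : EW n} (h : ∃ e, IsExpr w e) :
    ∃ e, IsExpr (w * EW.rho n) e := by
  obtain ⟨⟨k, l⟩, rfl⟩ := h
  refine ⟨(k + 1, l.map Node.next), ?_⟩
  have : ∀ l : List (Node n),
      (l.map EW.s).prod * EW.rho n = EW.rho n * ((l.map Node.next).map EW.s).prod := by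
    intro l
    induction l with
    | nil => simp
    | cons i l ih =>
      simp only [List.map_cons, List.prod_cons]
      rw [mul_assoc, ih, ← mul_assoc, ← rho_mul_s, mul_assoc]
  simp only [IsExpr]
  rw [mul_assoc, this, zpow_add_one, mul_assoc]

lemma Node.next_prev {n : ℕ} (i : Node n) : i.prev.next = i := by
  apply Subtype.ext
  exact Equiv.apply_symm_apply nxt i.1

lemma isExpr_mul_rho_inv {n : ℕ} {w : EW n} (h : ∃ e, IsExpr w e) :
    ∃ e, IsExpr (w * (EW.rho n)⁻¹) e := by
  obtain ⟨⟨k, l⟩, rfl⟩ := h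
  refine ⟨(k - 1, l.map Node.prev), ?_⟩
  have : ∀ l : List (Node n),
      (l.map EW.s).prod * (EW.rho n)⁻¹ = (EW.rho n)⁻¹ * ((l.map Node.prev).map EW.s).prod := by
    intro l
    induction l with
    | nil => simp
    | cons i l ih =>
      have h := rho_mul_s i.prev
      rw [Node.next_prev] at h
      simp only [List.map_cons, List.prod_cons]
      rw [mul_assoc, ih, ← mul_assoc, ← mul_assoc, eq_inv_mul_iff_mul_eq.mpr
        (show EW.rho n * (EW.s i * (EW.rho n)⁻¹) = EW.s i.prev by
          rw [← mul_assoc, h, mul_inv_cancel_right])]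
  simp only [IsExpr]
  rw [mul_assoc, this, zpow_sub_one, mul_assoc]

lemma inl_mem_of_rho_mem {n : ℕ} (D : Subgroup (EW n)) (h : EW.rho n ∈ D)
    (hpD : ∀ σ : Equiv.Perm (Fin n), (SemidirectProduct.inr σ : EW n) ∈ D)
    (l : Multiplicative (Fin n → ℤ)) : (SemidirectProduct.inl l : EW n) ∈ D := by
  have hX : ∀ j : Fin n, (SemidirectProduct.inl (transl j) : EW n) ∈ D := by
    intro j
    have hn : 0 < n := by have := j.2; omega
    have h0 : (SemidirectProduct.inl (transl ⟨0, hn⟩) : EW n) ∈ D := by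
      simp only [EW.rho, hn, dif_pos] at h
      exact (D.mul_mem_cancel_left (hpD _)).mp h
    have h := inl_transl_mul_inr j (Equiv.swap ⟨0, hn⟩ j)
    rw [Equiv.swap_inv, Equiv.swap_apply_right] at h
    have h' := D.mul_mem (hpD (Equiv.swap ⟨0, hn⟩ j)) h0
    rw [← h] at h'
    exact (D.mul_mem_cancel_right (hpD _)).mp h'
  have e : l = ∏ j, transl j ^ (l.toAdd j) := by
    apply Multiplicative.toAdd.injective
    rw [toAdd_prod]
    funext k
    simp only [transl, toAdd_zpow, toAdd_ofAdd, Finset.sum_apply, Pi.smul_apply]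
    simp [Pi.single_apply]
  have : l ∈ D.comap (SemidirectProduct.inl : Multiplicative (Fin n → ℤ) →* EW n) := by
    rw [e]
    exact Subgroup.prod_mem _ fun j _ => Subgroup.zpow_mem _
      (show transl j ∈ D.comap SemidirectProduct.inl from hX j) _
  exact this

/-- The extended affine Weyl group is generated by `ρ` and the simple reflections. -/
theorem exists_isExpr {n : ℕ} (w : EW n) : ∃ e, IsExpr w e := by
  let C : Submonoid (EW n) :=
    { carrier := {g | ∀ w, (∃ e, IsExpr w e) → ∃ e, IsExpr (w * g) e}
      one_mem' := fun w h => by simpa using h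
      mul_mem' := fun {a b} ha hb w h => by rw [← mul_assoc]; exact hb _ (ha _ h) }
  suffices H : w ∈ C by simpa using H 1 ⟨(0, []), by simp [IsExpr]⟩
  have hrho : EW.rho n ∈ C := fun w h => isExpr_mul_rho h
  have hrho' : (EW.rho n)⁻¹ ∈ C := fun w h => isExpr_mul_rho_inv h
  have hs : ∀ i : Node n, EW.s i ∈ C := fun i w h => isExpr_mul_s h i
  have hperm : ∀ σ : Equiv.Perm (Fin n), (SemidirectProduct.inr σ : EW n) ∈ C := by
    obtain _ | n := n
    · intro σ
      rw [Subsingleton.elim σ 1, map_one]; exact C.one_mem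
    · have : C.comap (SemidirectProduct.inr : Equiv.Perm (Fin (n + 1)) →* EW (n + 1)) = ⊤ := by
        rw [eq_top_iff, ← Equiv.Perm.mclosure_swap_castSucc_succ, Submonoid.closure_le]
        rintro _ ⟨i, rfl⟩
        have hi := i.2
        have hlt : ((i.castSucc : Fin (n + 1)) : ℕ) + 1 < n + 1 := by simp
        have e : EW.s (⟨i.castSucc, by omega⟩ : Node (n + 1)) =
            SemidirectProduct.inr (Equiv.swap i.castSucc i.succ) := by
          have e' : nxt i.castSucc = i.succ := by
            apply Fin.ext; rw [nxt_val, if_pos hlt]; simp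
          simp only [EW.s, hlt, if_true, map_one, mul_one, adjSwap, e']
        change SemidirectProduct.inr _ ∈ C
        rw [← e]; exact hs _
      intro σ
      have h : σ ∈ C.comap (SemidirectProduct.inr : Equiv.Perm (Fin (n + 1)) →* EW (n + 1)) := by
        rw [this]; trivial
      exact h
  let D : Subgroup (EW n) :=
    { carrier := {g | g ∈ C ∧ g⁻¹ ∈ C}
      one_mem' := ⟨C.one_mem, by simp [C.one_mem]⟩
      mul_mem' := fun {a b} ha hb => ⟨C.mul_mem ha.1 hb.1, by
        rw [mul_inv_rev]; exact C.mul_mem hb.2 ha.2⟩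
      inv_mem' := fun {a} ha => ⟨ha.2, by rw [inv_inv]; exact ha.1⟩ }
  have hpD : ∀ σ : Equiv.Perm (Fin n), (SemidirectProduct.inr σ : EW n) ∈ D :=
    fun σ => ⟨hperm σ, by rw [← map_inv]; exact hperm _⟩
  have hL : (SemidirectProduct.inl w.left : EW n) ∈ D :=
    inl_mem_of_rho_mem D ⟨hrho, hrho'⟩ hpD w.left
  rw [← SemidirectProduct.inl_left_mul_inr_right w]
  exact C.mul_mem hL.1 (hperm _)

/-- `e` is a reduced expression of `w`: the number of simple reflections in it is the length
`ℓ(w)`, the least number possible. -/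
def IsReducedExpr {n : ℕ} (w : EW n) (e : ℤ × List (Node n)) : Prop :=
  IsExpr w e ∧ ∀ e', IsExpr w e' → e.2.length ≤ e'.2.length

theorem exists_isReducedExpr {n : ℕ} (w : EW n) : ∃ e, IsReducedExpr w e := by
  obtain ⟨e, he, hmin⟩ := WellFounded.has_min
    (measure fun e : ℤ × List (Node n) => e.2.length).wf {e | IsExpr w e} (exists_isExpr w)
  exact ⟨e, he, fun e' he' => not_lt.mp (hmin e' he')⟩

/-- A reduced expression of `w`. -/
def reducedExpr {n : ℕ} (w : EW n) : ℤ × List (Node n) := (exists_isReducedExpr w).choose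

/-- The standard element `T_w = T_ρ ^ k T_{s_{i_1}} ⋯ T_{s_{i_l}}` of an algebra with elements
`T_{s_i}`, `T_ρ`, `T_ρ⁻¹`, where `w = ρ ^ k s_{i_1} ⋯ s_{i_l}` is a reduced expression. -/
def stdElt {n : ℕ} {A : Type*} [Monoid A] (S : Node n → A) (R : Aˣ) (w : EW n) : A :=
  ((R ^ (reducedExpr w).1 : Aˣ) : A) * ((reducedExpr w).2.map S).prod

/-! ### The extended affine Hecke algebra of type `A` -/

inductive HGen (n : ℕ)
  | s (i : Node n)
  | rho
  | rhoInv

/-- The defining relations of the extended affine Hecke algebra of type `A`. The nodes `i`, `j`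
are adjacent if `i - j ≡ ± 1` modulo `n`; the last relation says that this algebra is `K`
for `n = 0`. -/
inductive HRel (K : Type*) [Field K] (q : K) (n : ℕ) :
    FreeAlgebra K (HGen n) → FreeAlgebra K (HGen n) → Prop
  | rho_s (i : Node n) :
      HRel K q n (FreeAlgebra.ι K HGen.rho * FreeAlgebra.ι K (HGen.s i))
        (FreeAlgebra.ι K (HGen.s i.prev) * FreeAlgebra.ι K HGen.rho)
  | comm (i j : Node n) (h : i ≠ j.next) (h' : j ≠ i.next) :
      HRel K q n (FreeAlgebra.ι K (HGen.s i) * FreeAlgebra.ι K (HGen.s j))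
        (FreeAlgebra.ι K (HGen.s j) * FreeAlgebra.ι K (HGen.s i))
  | braid (i : Node n) (h : 3 ≤ n) :
      HRel K q n
        (FreeAlgebra.ι K (HGen.s i) * FreeAlgebra.ι K (HGen.s i.next) * FreeAlgebra.ι K (HGen.s i))
        (FreeAlgebra.ι K (HGen.s i.next) * FreeAlgebra.ι K (HGen.s i) *
          FreeAlgebra.ι K (HGen.s i.next))
  | quad (i : Node n) :
      HRel K q n (FreeAlgebra.ι K (HGen.s i) ^ 2)
        (1 + (q - q⁻¹) • FreeAlgebra.ι K (HGen.s i))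
  | rho_inv : HRel K q n (FreeAlgebra.ι K HGen.rho * FreeAlgebra.ι K HGen.rhoInv) 1
  | inv_rho : HRel K q n (FreeAlgebra.ι K HGen.rhoInv * FreeAlgebra.ι K HGen.rho) 1
  | rho_zero (h : n = 0) : HRel K q n (FreeAlgebra.ι K HGen.rho) 1

/-- The extended affine Hecke algebra of type `A` (of `GL_n`) with parameter `q`. It is `K`
for `n = 0` and the Laurent polynomial algebra in `S_ρ = X_1` for `n = 1`. -/
abbrev AffHecke (K : Type*) [Field K] (q : K) (n : ℕ) := RingQuot (HRel K q n)

namespace AffHecke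

variable {K : Type*} [Field K] (q : K) {n : ℕ}

def S (i : Node n) : AffHecke K q n :=
  RingQuot.mkAlgHom K (HRel K q n) (FreeAlgebra.ι K (HGen.s i))

variable (n) in
def R : (AffHecke K q n)ˣ where
  val := RingQuot.mkAlgHom K (HRel K q n) (FreeAlgebra.ι K HGen.rho)
  inv := RingQuot.mkAlgHom K (HRel K q n) (FreeAlgebra.ι K HGen.rhoInv)
  val_inv := by rw [← map_mul, RingQuot.mkAlgHom_rel K (HRel.rho_inv), map_one]
  inv_val := by rw [← map_mul, RingQuot.mkAlgHom_rel K (HRel.inv_rho), map_one]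

/-- The standard basis element `S_w`. -/
def std (w : EW n) : AffHecke K q n := stdElt (S q) (R q n) w

end AffHecke

/-! ### The affine Yokonuma–Hecke algebra and its Iwahori–Matsumoto form -/

/-- `r⁻¹ ∑_{0 ≤ a < r} x ^ a y ^ (-a)`, for elements `x`, `y` with `x ^ r = y ^ r = 1`; the
inverse power `y ^ (-a)` is written as `y ^ (r - a)`. -/
def tIdem (K : Type*) [Field K] {A : Type*} [Ring A] [Algebra K A] (r : ℕ) (x y : A) : A :=
  (r : K)⁻¹ • ∑ a ∈ Finset.range r, x ^ a * y ^ (r - a)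

inductive IMGen (n : ℕ)
  | t (j : Fin n)
  | s (i : Node n)
  | rho
  | rhoInv

/-- The defining relations of the algebra generated by `t_j`, `T_{s_i}`, `T_ρ`, `T_ρ⁻¹`. -/
inductive IMRel (K : Type*) [Field K] (q : K) (r n : ℕ) :
    FreeAlgebra K (IMGen n) → FreeAlgebra K (IMGen n) → Prop
  | t_pow (j : Fin n) : IMRel K q r n (FreeAlgebra.ι K (IMGen.t j) ^ r) 1
  | t_comm (i j : Fin n) :
      IMRel K q r n (FreeAlgebra.ι K (IMGen.t i) * FreeAlgebra.ι K (IMGen.t j))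
        (FreeAlgebra.ι K (IMGen.t j) * FreeAlgebra.ι K (IMGen.t i))
  | s_t (i : FNode n) (j : Fin n) :
      IMRel K q r n (FreeAlgebra.ι K (IMGen.s i.toNode) * FreeAlgebra.ι K (IMGen.t j))
        (FreeAlgebra.ι K (IMGen.t (adjSwap i.1 j)) * FreeAlgebra.ι K (IMGen.s i.toNode))
  | rho_t (j : Fin n) :
      IMRel K q r n (FreeAlgebra.ι K IMGen.rho * FreeAlgebra.ι K (IMGen.t j))
        (FreeAlgebra.ι K (IMGen.t (prv j)) * FreeAlgebra.ι K IMGen.rho)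
  | rho_s (i : Node n) :
      IMRel K q r n (FreeAlgebra.ι K IMGen.rho * FreeAlgebra.ι K (IMGen.s i))
        (FreeAlgebra.ι K (IMGen.s i.prev) * FreeAlgebra.ι K IMGen.rho)
  | comm (i j : Node n) (h : i ≠ j.next) (h' : j ≠ i.next) :
      IMRel K q r n (FreeAlgebra.ι K (IMGen.s i) * FreeAlgebra.ι K (IMGen.s j))
        (FreeAlgebra.ι K (IMGen.s j) * FreeAlgebra.ι K (IMGen.s i))
  | braid (i : Node n) (h : 3 ≤ n) :
      IMRel K q r n
        (FreeAlgebra.ι K (IMGen.s i) * FreeAlgebra.ι K (IMGen.s i.next) *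
          FreeAlgebra.ι K (IMGen.s i))
        (FreeAlgebra.ι K (IMGen.s i.next) * FreeAlgebra.ι K (IMGen.s i) *
          FreeAlgebra.ι K (IMGen.s i.next))
  | quad (i : Node n) :
      IMRel K q r n (FreeAlgebra.ι K (IMGen.s i) ^ 2)
        (1 + (q - q⁻¹) • (tIdem K r (FreeAlgebra.ι K (IMGen.t i.1))
          (FreeAlgebra.ι K (IMGen.t (nxt i.1))) * FreeAlgebra.ι K (IMGen.s i)))
  | rho_inv : IMRel K q r n (FreeAlgebra.ι K IMGen.rho * FreeAlgebra.ι K IMGen.rhoInv) 1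
  | inv_rho : IMRel K q r n (FreeAlgebra.ι K IMGen.rhoInv * FreeAlgebra.ι K IMGen.rho) 1

/-- The algebra `Ĥ_{r,n}^aff` over `K`, with parameter `q`. -/
abbrev IM (K : Type*) [Field K] (q : K) (r n : ℕ) := RingQuot (IMRel K q r n)

namespace IM

variable {K : Type*} [Field K] (q : K) (r : ℕ) {n : ℕ}

def t (j : Fin n) : IM K q r n :=
  RingQuot.mkAlgHom K (IMRel K q r n) (FreeAlgebra.ι K (IMGen.t j))

def S (i : Node n) : IM K q r n :=
  RingQuot.mkAlgHom K (IMRel K q r n) (FreeAlgebra.ι K (IMGen.s i))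

variable (n) in
def R : (IM K q r n)ˣ where
  val := RingQuot.mkAlgHom K (IMRel K q r n) (FreeAlgebra.ι K IMGen.rho)
  inv := RingQuot.mkAlgHom K (IMRel K q r n) (FreeAlgebra.ι K IMGen.rhoInv)
  val_inv := by rw [← map_mul, RingQuot.mkAlgHom_rel K (IMRel.rho_inv), map_one]
  inv_val := by rw [← map_mul, RingQuot.mkAlgHom_rel K (IMRel.inv_rho), map_one]

/-- The element `T_w`, for `w` in the extended affine Weyl group. -/
def std (w : EW n) : IM K q r n := stdElt (S q r) (R q r n) w

end IM

inductive YGen (n : ℕ)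
  | t (j : Fin n)
  | g (i : FNode n)
  | X
  | Xinv

/-- The defining relations of the affine Yokonuma–Hecke algebra. -/
inductive YRel (K : Type*) [Field K] (q : K) (r n : ℕ) :
    FreeAlgebra K (YGen n) → FreeAlgebra K (YGen n) → Prop
  | g_comm (i j : FNode n) (h : (i.1 : ℕ) + 2 ≤ j.1 ∨ (j.1 : ℕ) + 2 ≤ i.1) :
      YRel K q r n (FreeAlgebra.ι K (YGen.g i) * FreeAlgebra.ι K (YGen.g j))
        (FreeAlgebra.ι K (YGen.g j) * FreeAlgebra.ι K (YGen.g i))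
  | g_braid (i j : FNode n) (h : (j.1 : ℕ) = i.1 + 1) :
      YRel K q r n
        (FreeAlgebra.ι K (YGen.g i) * FreeAlgebra.ι K (YGen.g j) * FreeAlgebra.ι K (YGen.g i))
        (FreeAlgebra.ι K (YGen.g j) * FreeAlgebra.ι K (YGen.g i) * FreeAlgebra.ι K (YGen.g j))
  | t_comm (i j : Fin n) :
      YRel K q r n (FreeAlgebra.ι K (YGen.t i) * FreeAlgebra.ι K (YGen.t j))
        (FreeAlgebra.ι K (YGen.t j) * FreeAlgebra.ι K (YGen.t i))
  | g_t (i : FNode n) (j : Fin n) :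
      YRel K q r n (FreeAlgebra.ι K (YGen.g i) * FreeAlgebra.ι K (YGen.t j))
        (FreeAlgebra.ι K (YGen.t (adjSwap i.1 j)) * FreeAlgebra.ι K (YGen.g i))
  | t_pow (j : Fin n) : YRel K q r n (FreeAlgebra.ι K (YGen.t j) ^ r) 1
  | quad (i : FNode n) :
      YRel K q r n (FreeAlgebra.ι K (YGen.g i) ^ 2)
        (1 + (q - q⁻¹) • (tIdem K r (FreeAlgebra.ι K (YGen.t i.1))
          (FreeAlgebra.ι K (YGen.t (nxt i.1))) * FreeAlgebra.ι K (YGen.g i)))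
  | X_inv : YRel K q r n (FreeAlgebra.ι K YGen.X * FreeAlgebra.ι K YGen.Xinv) 1
  | inv_X : YRel K q r n (FreeAlgebra.ι K YGen.Xinv * FreeAlgebra.ι K YGen.X) 1
  | g_X_first (i : FNode n) (h : (i.1 : ℕ) = 0) :
      YRel K q r n
        (FreeAlgebra.ι K (YGen.g i) * FreeAlgebra.ι K YGen.X * FreeAlgebra.ι K (YGen.g i) *
          FreeAlgebra.ι K YGen.X)
        (FreeAlgebra.ι K YGen.X * FreeAlgebra.ι K (YGen.g i) * FreeAlgebra.ι K YGen.X *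
          FreeAlgebra.ι K (YGen.g i))
  | g_X (i : FNode n) (h : (i.1 : ℕ) ≠ 0) :
      YRel K q r n (FreeAlgebra.ι K (YGen.g i) * FreeAlgebra.ι K YGen.X)
        (FreeAlgebra.ι K YGen.X * FreeAlgebra.ι K (YGen.g i))
  | t_X (j : Fin n) :
      YRel K q r n (FreeAlgebra.ι K (YGen.t j) * FreeAlgebra.ι K YGen.X)
        (FreeAlgebra.ι K YGen.X * FreeAlgebra.ι K (YGen.t j))

/-- The affine Yokonuma–Hecke algebra `Ŷ_{r,n}` over `K`, with parameter `q`. -/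
abbrev YH (K : Type*) [Field K] (q : K) (r n : ℕ) := RingQuot (YRel K q r n)

/-- The list `1, …, n - 1` of the finite simple reflections. -/
def fnodes (n : ℕ) : List (FNode n) :=
  List.ofFn fun k : Fin (n - 1) => ⟨⟨k, by omega⟩, by simp only []; omega⟩

namespace YH

variable {K : Type*} [Field K] (q : K) (r : ℕ) {n : ℕ}

def t (j : Fin n) : YH K q r n :=
  RingQuot.mkAlgHom K (YRel K q r n) (FreeAlgebra.ι K (YGen.t j))

def g (i : FNode n) : YH K q r n :=
  RingQuot.mkAlgHom K (YRel K q r n) (FreeAlgebra.ι K (YGen.g i))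

/-- `g_i⁻¹ = g_i - (q - q⁻¹) e_i`. -/
def gInv (i : FNode n) : YH K q r n :=
  g q r i - (q - q⁻¹) • tIdem K r (t q r i.1) (t q r (nxt i.1))

variable (n)

/-- `X_1`. -/
def X : YH K q r n := RingQuot.mkAlgHom K (YRel K q r n) (FreeAlgebra.ι K YGen.X)

/-- `X_1⁻¹`. -/
def Xinv : YH K q r n := RingQuot.mkAlgHom K (YRel K q r n) (FreeAlgebra.ι K YGen.Xinv)

/-- `g_{n-1} ⋯ g_1`. -/
def gDown : YH K q r n := ((fnodes n).reverse.map (g q r)).prod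

/-- `X_n = g_{n-1} ⋯ g_1 X_1 g_1 ⋯ g_{n-1}`. -/
def Xn : YH K q r n := gDown q r n * X q r n * ((fnodes n).map (g q r)).prod

/-- `(g_{n-1} ⋯ g_2 g_1 g_2 ⋯ g_{n-1})⁻¹ = g_{n-1}⁻¹ ⋯ g_2⁻¹ g_1⁻¹ g_2⁻¹ ⋯ g_{n-1}⁻¹`. -/
def palInv : YH K q r n := (((fnodes n).reverse ++ (fnodes n).tail).map (gInv q r)).prod

end YH

/-! ### Compositions, characters of `(ℤ / r) ^ n`, Young subgroups -/

/-- The `r`-compositions of `n`. -/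
abbrev RComp (r n : ℕ) := {μ : Fin r → ℕ // ∑ a, μ a = n}

/-- Characters of `(ℤ / r) ^ n`, given by their values on the generators: once the `r`-th roots of
unity are numbered `ζ_1, …, ζ_r`, the function `c` is the character with `χ(t_j) = ζ_{c j}`. -/
abbrev Chi (r n : ℕ) := Fin n → Fin r

/-- `(σ χ)(t_j) = χ(t_{σ⁻¹ j})`; the extended affine Weyl group acts through its quotient `𝔖_n`. -/
def Chi.act {r n : ℕ} (σ : Equiv.Perm (Fin n)) (c : Chi r n) : Chi r n := fun j => c (σ⁻¹ j)

lemma Chi.act_one {r n : ℕ} (c : Chi r n) : Chi.act 1 c = c := rfl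

lemma Chi.act_mul {r n : ℕ} (σ τ : Equiv.Perm (Fin n)) (c : Chi r n) :
    Chi.act (σ * τ) c = Chi.act σ (Chi.act τ c) := by
  funext j; simp [Chi.act]

lemma Chi.act_inv {r n : ℕ} {σ : Equiv.Perm (Fin n)} {c d : Chi r n} (h : Chi.act σ c = d) :
    Chi.act σ⁻¹ d = c := by
  rw [← h, ← Chi.act_mul, inv_mul_cancel, Chi.act_one]

/-- `χ` has composition `μ`: exactly `μ_a` of the values `χ(t_j)` are equal to `ζ_a`. -/
def Chi.comp {r n : ℕ} (c : Chi r n) : Fin r → ℕ := fun a => (Finset.univ.filter (c · = a)).card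

/-- The bijection of the disjoint union of the blocks of sizes `μ_1, …, μ_r` with the set of
positions, the blocks being placed one after the other. -/
def blk {r n : ℕ} (μ : RComp r n) : (Σ a, Fin (μ.1 a)) ≃ Fin n :=
  finSigmaFinEquiv.trans (finCongr μ.2)

/-- The character `χ_1^μ`: its first `μ_1` values are `ζ_1`, the next `μ_2` are `ζ_2`, etc. -/
def chi1 {r n : ℕ} (μ : RComp r n) : Chi r n := fun j => ((blk μ).symm j).1

/-- The Young subgroup `𝔖_{μ_1} × ⋯ × 𝔖_{μ_r}` of `𝔖_n`, the stabilizer of `χ_1^μ`. -/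
def young {r n : ℕ} (μ : RComp r n) : Subgroup (Equiv.Perm (Fin n)) where
  carrier := {σ | Chi.act σ (chi1 μ) = chi1 μ}
  one_mem' := rfl
  mul_mem' := fun {a b} ha hb => by
    rw [Set.mem_ofPred_eq] at *; rw [Chi.act_mul, hb, ha]
  inv_mem' := fun {a} ha => Chi.act_inv ha

/-- `ℤ ^ n ⋊ 𝔖^μ`, the stabilizer of `χ_1^μ` in the extended affine Weyl group. -/
def affYoung {r n : ℕ} (μ : RComp r n) : Subgroup (EW n) :=
  (young μ).comap SemidirectProduct.rightHom

/-- The length of a permutation with respect to the adjacent transpositions. -/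
def permLength {n : ℕ} (σ : Equiv.Perm (Fin n)) : ℕ :=
  sInf {d | ∃ l : List (FNode n), (l.map fun i => adjSwap i.1).prod = σ ∧ l.length = d}

/-- The representatives of minimal length of the left cosets of the Young subgroup. -/
abbrev MinRep {r n : ℕ} (μ : RComp r n) :=
  {π : Equiv.Perm (Fin n) // ∀ τ ∈ young μ, permLength π ≤ permLength (π * τ)}

/-- The number `m_μ` of minimal coset representatives. -/
def numMinRep {r n : ℕ} (μ : RComp r n) : ℕ := Nat.card (MinRep μ)

/-- The `a`-th block as a set of positions. -/
def blockEquiv {r n : ℕ} (μ : RComp r n) (a : Fin r) : Fin (μ.1 a) ≃ {j // chi1 μ j = a} :=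
  (Equiv.sigmaSubtype a).symm.trans ((blk μ).subtypeEquiv fun s => by simp [chi1])

/-- The component in the `a`-th factor of an element of
`ℤ ^ n ⋊ 𝔖^μ = ∏_a (ℤ ^ μ_a ⋊ 𝔖_{μ_a})`: its restriction to the `a`-th block. -/
def affYoungPart {r n : ℕ} {μ : RComp r n} (w : affYoung μ) (a : Fin r) : EW (μ.1 a) where
  left := Multiplicative.ofAdd fun i => w.1.left.toAdd (blockEquiv μ a i)
  right := (blockEquiv μ a).permCongr.symm
    (w.1.right.subtypePerm (p := fun j => chi1 μ j = a) fun j => by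
      have h : Chi.act w.1.right (chi1 μ) = chi1 μ := w.2
      have h' := congrFun h (w.1.right j)
      simp only [Chi.act, Equiv.Perm.inv_def, Equiv.symm_apply_apply] at h'
      rw [h'])

/-- The algebra `Ĥ^μ = Ĥ_{μ_1} ⊗ ⋯ ⊗ Ĥ_{μ_r}`. -/
abbrev HMu (K : Type*) [Field K] (q : K) {r n : ℕ} (μ : RComp r n) :=
  PiTensorProduct K fun a => AffHecke K q (μ.1 a)

/-- The standard basis element `S_w = S_{w_1} ⊗ ⋯ ⊗ S_{w_r}` of `Ĥ^μ`, for
`w = (w_1, …, w_r)` in `ℤ ^ n ⋊ 𝔖^μ`. -/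
def HMu.std {K : Type*} [Field K] (q : K) {r n : ℕ} {μ : RComp r n} (w : affYoung μ) :
    HMu K q μ :=
  PiTensorProduct.tprod K fun a => AffHecke.std q (affYoungPart w a)

/-- The idempotent `E_χ = ∏_i (r⁻¹ ∑_{0 ≤ s < r} χ(t_i) ^ s t_i ^ (-s))`, where `t_i ^ (-s)` is
written as `t_i ^ (r - s)`. -/
def idemE {K : Type*} [Field K] (q : K) {r n : ℕ} (ζ : Fin r ≃ rootsOfUnity r K) (c : Chi r n) :
    IM K q r n :=
  (List.ofFn fun i : Fin n =>
    (r : K)⁻¹ • ∑ s ∈ Finset.range r,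
      (((ζ (c i) : Kˣ) : K) ^ s) • IM.t q r i ^ (r - s)).prod

/-- The central idempotent `E_μ`, the sum of the `E_χ` with `χ` of composition `μ`. -/
def idemMu {K : Type*} [Field K] (q : K) {r n : ℕ} (ζ : Fin r ≃ rootsOfUnity r K)
    (μ : RComp r n) : IM K q r n :=
  ∑ c : Chi r n with c.comp = μ.1, idemE q ζ c

/-- If `w χ_j^μ = χ_k^μ`, where `χ_k^μ = π_k χ_1^μ`, then `π_k⁻¹ w π_j` lies in `ℤ ^ n ⋊ 𝔖^μ`. -/
lemma conj_mem {r n : ℕ} {μ : RComp r n} {πj πk : Equiv.Perm (Fin n)} {w : EW n}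
    (h : Chi.act w.right (Chi.act πj (chi1 μ)) = Chi.act πk (chi1 μ)) :
    (SemidirectProduct.inr πk)⁻¹ * w * SemidirectProduct.inr πj ∈ affYoung μ := by
  change Chi.act _ _ = _
  simp only [SemidirectProduct.rightHom_eq_right, SemidirectProduct.mul_right,
    SemidirectProduct.inv_right, SemidirectProduct.right_inr, Chi.act_mul]
  rw [h]
  exact Chi.act_inv rfl

end

end AYH

/-! Both algebras are compared through explicit bases. Once $\widehat H^{\mathrm{aff}}_{r,n}$ is
known to have the basis $E_\chi T_w$ and each $\widehat{\mathcal H}_m$ the basis $S_w$, the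
prescription $E_{\chi_k}T_w\mapsto S_{\pi_k^{-1}w\pi_j}M_{k,j}$ is a bijection of bases
(`idxMap_bijective`), and the content of part 1 is that the resulting linear map `linIso` is
multiplicative.

Everything combinatorial is read off from the action of $\widehat W_n$ on $\mathbb
Z\times\{1,\dots,n\}$ with the lexicographic order, a copy of $\mathbb Z$: there $\rho^{-1}$ is the
successor map, and $s_i$ exchanges every point in position $i$ with its successor. Right descents
are inversions of neighbouring points, and the exchange property `s_mul_eq_of_desc` yields the
length function and a Matsumoto theorem (`IsBraid.indepUpTo`), so $T_w$ does not depend on the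
chosen reduced expression. Linear independence comes from a regular representation in which the
points are coloured by a character: the quadratic correction appears only for inversions between
points of the same colour. One colour gives $\widehat{\mathcal H}_m$, the colouring $\chi$ gives
$E_\chi\widehat H^{\mathrm{aff}}_{r,n}$.

A minimal coset representative $\pi_j$ is increasing on each block, so it identifies the points of
block $a$, in order, with the points to which $\chi_j$ gives colour $a$. Hence the component of
$\pi_k^{-1}w\pi_j$ in block $a$ is just $w$ seen on the points of colour $a$. For $w=\rho^m$, or for
$w=s_i$ exchanging two different colours, nothing is inverted and all components have length $0$. If
$s_i$ exchanges two points of one colour, that component is a simple reflection, the others are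
trivial, and descents agree (`conj_s_of_eq`). So right multiplication by the generators follows the
same rules on both sides, and `RingQuot.mul_mem_of_gen` extends this to all products.

For part 2 the two presentations are translated into each other by $\rho=g_{n-1}\cdots g_1X_1$. The
relations $\rho g_i=g_{i-1}\rho$ for $i\ge2$ follow from the braid relations and the commutation of
$X_1$ with $g_2,\dots,g_{n-1}$; $\rho g_1=T_{s_0}\rho$ defines $T_{s_0}$; and the remaining one,
$\rho^2g_1=g_{n-1}\rho^2$, is equivalent to $g_1X_1g_1X_1=X_1g_1X_1g_1$ (`IsBraidSeq.sq_mul_iff`).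
-/

namespace AYH

/-! ### The action of the extended affine Weyl group on `ℤ × {1, …, n}` -/

/-- Pairs of an integer and a position, ordered lexicographically: a copy of `ℤ` on which the
extended affine Weyl group acts by permutations commuting with the translation of period `n`. -/
abbrev Pt (n : ℕ) := ℤ ×ₗ Fin n

namespace Pt

variable {n : ℕ}

abbrev mk (k : ℤ) (i : Fin n) : Pt n := toLex (k, i)

def lev (x : Pt n) : ℤ := (ofLex x).1

def pos (x : Pt n) : Fin n := (ofLex x).2

@[simp] lemma lev_mk (k : ℤ) (i : Fin n) : (mk k i).lev = k := rfl

@[simp] lemma pos_mk (k : ℤ) (i : Fin n) : (mk k i).pos = i := rfl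

lemma mk_lev_pos (x : Pt n) : mk x.lev x.pos = x := rfl

@[ext] lemma ext {x y : Pt n} (h : x.lev = y.lev) (h' : x.pos = y.pos) : x = y := by
  rw [← mk_lev_pos x, ← mk_lev_pos y, h, h']

lemma lt_iff {x y : Pt n} : x < y ↔ x.lev < y.lev ∨ x.lev = y.lev ∧ x.pos < y.pos :=
  Prod.Lex.lt_iff

/-- The minus sign lets $X_j$ lower the level. With this choice $\rho$ acts as the predecessor map
for the lexicographic order. -/
instance : MulAction (EW n) (Pt n) where
  smul w x := mk (x.lev - w.left.toAdd (w.right x.pos)) (w.right x.pos)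
  one_smul x := by
    apply ext
    · change x.lev - (0 : ℤ) = x.lev
      simp
    · rfl
  mul_smul v w x := by
    apply ext
    · change x.lev - (v * w).left.toAdd ((v * w).right x.pos) =
        x.lev - w.left.toAdd (w.right x.pos) - v.left.toAdd (v.right (w.right x.pos))
      simp only [SemidirectProduct.mul_left, SemidirectProduct.mul_right, toAdd_mul, Pi.add_apply,
        toAdd_permAct, Equiv.Perm.mul_apply, Equiv.Perm.inv_def, Equiv.symm_apply_apply]
      ring
    · rfl

lemma lev_smul (w : EW n) (x : Pt n) :
    (w • x).lev = x.lev - w.left.toAdd (w.right x.pos) := rfl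

@[simp] lemma pos_smul (w : EW n) (x : Pt n) : (w • x).pos = w.right x.pos := rfl

/-- Translation by a multiple of the period. -/
def shift (k : ℤ) (x : Pt n) : Pt n := mk (x.lev + k) x.pos

@[simp] lemma lev_shift (k : ℤ) (x : Pt n) : (shift k x).lev = x.lev + k := rfl

@[simp] lemma pos_shift (k : ℤ) (x : Pt n) : (shift k x).pos = x.pos := rfl

lemma smul_shift (w : EW n) (k : ℤ) (x : Pt n) : w • shift k x = shift k (w • x) := by
  ext
  · simp only [lev_smul, lev_shift, pos_shift]; ring
  · simp

lemma shift_lt_shift {k : ℤ} {x y : Pt n} : shift k x < shift k y ↔ x < y := by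
  simp [lt_iff]

lemma eq_shift (x : Pt n) : x = shift x.lev (mk 0 x.pos) := by
  ext <;> simp

/-- Points of level $0$ already recover the permutation and then the translation part. Identities in
the group can thus be checked point by point. -/
lemma smul_eq_iff {v w : EW n} : v = w ↔ ∀ x : Pt n, v • x = w • x := by
  refine ⟨fun h x => by rw [h], fun h => ?_⟩
  have h2 : v.right = w.right := by
    ext i
    have := congrArg pos (h (mk 0 i))
    simp only [pos_smul, pos_mk] at this
    rw [this]
  refine SemidirectProduct.ext ?_ h2
  apply Multiplicative.toAdd.injective
  funext i
  have := congrArg lev (h (mk 0 (v.right⁻¹ i)))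
  rw [lev_smul, lev_smul, ← h2] at this
  simpa using this

/-- The successor of a point. -/
def next (x : Pt n) : Pt n := (EW.rho n)⁻¹ • x

lemma rho_smul_next (x : Pt n) : EW.rho n • next x = x := smul_inv_smul _ _

lemma next_rho_smul (x : Pt n) : next (EW.rho n • x) = x := inv_smul_smul _ _

@[simp] lemma pos_next (x : Pt n) : (next x).pos = nxt x.pos := by
  have : (EW.rho n).right = prv := by simp [EW.rho]
  simp [next, this]

lemma lev_next (x : Pt n) :
    (next x).lev = if (x.pos : ℕ) + 1 < n then x.lev else x.lev + 1 := by
  have hr : (EW.rho n).right = prv := by simp [EW.rho]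
  have hn : 0 < n := by have := x.pos.2; omega
  have h := congrArg lev (rho_smul_next x)
  rw [lev_smul, pos_next, hr] at h
  have hl : (EW.rho n).left.toAdd x.pos = if (x.pos : ℕ) + 1 < n then 0 else 1 := by
    have hv := nxt_val x.pos
    simp only [EW.rho, hn, dif_pos, SemidirectProduct.mul_left, SemidirectProduct.left_inr,
      SemidirectProduct.left_inl, SemidirectProduct.right_inr, one_mul, toAdd_permAct, transl,
      toAdd_ofAdd, Pi.single_apply, inv_inv, Fin.ext_iff, hv]
    split_ifs <;> first | rfl | (exfalso; omega)
  have e : (prv (nxt x.pos) : Fin n) = x.pos := Equiv.symm_apply_apply _ _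
  rw [e, hl] at h
  split_ifs at h ⊢ <;> omega

lemma lt_next (x : Pt n) : x < next x := by
  rw [lt_iff, lev_next, Fin.lt_def, pos_next, nxt_val]
  split_ifs <;> omega

lemma next_le {x y : Pt n} (h : x < y) : next x ≤ y := by
  rw [← not_lt]
  rw [lt_iff, Fin.lt_def] at h ⊢
  rw [lev_next, pos_next, nxt_val]
  have := y.pos.2
  split_ifs <;> omega

lemma next_strictMono : StrictMono (next : Pt n → Pt n) :=
  fun _ y h => (next_le h).trans_lt (lt_next y)

lemma rho_strictMono : StrictMono (fun x : Pt n => EW.rho n • x) := by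
  intro x y h
  rw [← next_strictMono.lt_iff_lt]
  simpa [next_rho_smul] using h

lemma rho_zpow_strictMono (k : ℤ) : StrictMono (fun x : Pt n => EW.rho n ^ k • x) := by
  induction k using Int.induction_on with
  | zero => intro x y h; simpa using h
  | succ k ih =>
    intro x y h
    have := rho_strictMono (ih h)
    simpa only [add_comm (k : ℤ), zpow_one_add, mul_smul] using this
  | pred k ih =>
    intro x y h
    have := next_strictMono (ih h)
    simpa only [next, sub_eq_add_neg, add_comm _ (-1 : ℤ), zpow_add, zpow_neg_one, mul_smul]
      using this

lemma next_shift (k : ℤ) (x : Pt n) : next (shift k x) = shift k (next x) := smul_shift _ _ _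

lemma nxt_ne {i : Fin n} (hn : 2 ≤ n) : nxt i ≠ i := by
  rw [ne_eq, Fin.ext_iff, nxt_val]
  split_ifs <;> omega

lemma s_right (i : Node n) : (EW.s i).right = adjSwap i.1 := by simp [EW.s]

lemma s_left_toAdd (i : Node n) (j : Fin n) : (EW.s i).left.toAdd j =
    if (i.1 : ℕ) + 1 < n then 0 else
      (if j = i.1 then 1 else 0) - (if j = nxt i.1 then 1 else 0) := by
  simp only [EW.s, SemidirectProduct.mul_left, SemidirectProduct.left_inr, one_mul,
    SemidirectProduct.right_inr, SemidirectProduct.left_inl, toAdd_permAct]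
  split_ifs with h h1 h2 h2 <;>
    simp_all [transl, Equiv.swap_apply_of_ne_of_ne]

/-- The translation $X_1X_n^{-1}$ in $s_0$ accounts exactly for the change of level when the
successor wraps around, so the affine label needs no separate treatment from here on. -/
lemma s_smul_of_pos_eq (i : Node n) {x : Pt n} (h : x.pos = i.1) : EW.s i • x = next x := by
  ext
  · rw [lev_smul, s_right, s_left_toAdd, lev_next, h, adjSwap, Equiv.swap_apply_left]
    simp only [nxt_ne i.2, if_false, if_true]
    split_ifs <;> ring
  · rw [pos_smul, s_right, pos_next, h, adjSwap, Equiv.swap_apply_left]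

lemma s_mul_self (i : Node n) : EW.s i * EW.s i = 1 := by
  apply SemidirectProduct.ext
  · apply Multiplicative.toAdd.injective
    funext j
    have h := nxt_ne (i := i.1) i.2
    rw [SemidirectProduct.mul_left, toAdd_mul, Pi.add_apply, toAdd_permAct, s_right,
      s_left_toAdd, s_left_toAdd, adjSwap, Equiv.swap_inv]
    simp only [Equiv.swap_apply_eq_iff, Equiv.swap_apply_left, Equiv.swap_apply_right]
    split_ifs <;> simp
  · rw [SemidirectProduct.mul_right, s_right]; simp

lemma s_smul_s_smul (i : Node n) (x : Pt n) : EW.s i • EW.s i • x = x := by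
  rw [← mul_smul, s_mul_self, one_smul]

lemma s_smul_next (i : Node n) {x : Pt n} (h : x.pos = i.1) : EW.s i • next x = x := by
  rw [← s_smul_of_pos_eq i h, s_smul_s_smul]

lemma s_smul_of_ne (i : Node n) {x : Pt n} (h : x.pos ≠ i.1) (h' : x.pos ≠ nxt i.1) :
    EW.s i • x = x := by
  have e : adjSwap i.1 x.pos = x.pos := Equiv.swap_apply_of_ne_of_ne h h'
  ext
  · rw [lev_smul, s_right, s_left_toAdd, e, if_neg h, if_neg h']; simp
  · rw [pos_smul, s_right, e]

lemma exists_next_eq {i : Fin n} {x : Pt n} (h : x.pos = nxt i) : ∃ y, y.pos = i ∧ next y = x := by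
  refine ⟨EW.rho n • x, ?_, next_rho_smul x⟩
  apply nxt.injective
  rw [← pos_next, next_rho_smul, h]

/-- Since $s_i$ only exchanges disjoint pairs of neighbours, it can reverse the order of two points
only if they form such a pair. -/
lemma s_smul_lt (i : Node n) {x y : Pt n} (h : x < y) (hn : ¬ (x.pos = i.1 ∧ y = next x)) :
    EW.s i • x < EW.s i • y := by
  have hne := nxt_ne (i := i.1) i.2
  by_cases hx : x.pos = i.1
  · have h2 : y ≠ next x := fun e => hn ⟨hx, e⟩
    have h3 : next x < y := lt_of_le_of_ne (next_le h) h2.symm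
    rw [s_smul_of_pos_eq i hx]
    by_cases hy : y.pos = i.1
    · rw [s_smul_of_pos_eq i hy]; exact h3.trans (lt_next y)
    by_cases hy' : y.pos = nxt i.1
    · obtain ⟨y', h1, rfl⟩ := exists_next_eq hy'
      rw [s_smul_next i h1]
      refine lt_of_le_of_ne (next_le (next_strictMono.lt_iff_lt.mp h3)) fun e => ?_
      have := congrArg pos e
      rw [pos_next, hx, h1] at this
      exact hne this
    · rwa [s_smul_of_ne i hy hy']
  by_cases hx' : x.pos = nxt i.1
  · obtain ⟨x', h1, rfl⟩ := exists_next_eq hx'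
    rw [s_smul_next i h1]
    by_cases hy : y.pos = i.1
    · rw [s_smul_of_pos_eq i hy]; exact ((lt_next _).trans h).trans (lt_next y)
    by_cases hy' : y.pos = nxt i.1
    · obtain ⟨y', h2, rfl⟩ := exists_next_eq hy'
      rw [s_smul_next i h2]; exact next_strictMono.lt_iff_lt.mp h
    · rw [s_smul_of_ne i hy hy']; exact (lt_next _).trans h
  · rw [s_smul_of_ne i hx hx']
    by_cases hy : y.pos = i.1
    · rw [s_smul_of_pos_eq i hy]; exact h.trans (lt_next y)
    by_cases hy' : y.pos = nxt i.1
    · obtain ⟨y', h2, rfl⟩ := exists_next_eq hy'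
      rw [s_smul_next i h2]
      refine lt_of_le_of_ne (not_lt.mp fun h' => (next_le h').not_gt h) ?_
      rintro rfl
      exact hx h2
    · rwa [s_smul_of_ne i hy hy']

end Pt

/-! ### Descents and lengths -/

/-- If each letter that turns an ascent into a descent can be moved to the end, a word with a
descent at `i` has a shorter word for its product with `s i`. -/
lemma exists_word_shorter {G ι κ : Type*} [Group G] (s : ι → G) (t : κ → G)
    (ht : ∀ i, t i * t i = 1)
    (Neg : G → κ → Prop) (h1 : ∀ i, ¬ Neg 1 i)
    (h : ∀ u i j, ¬ Neg u i → Neg (s j * u) i → s j * u = u * t i) (l : List ι) (i : κ)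
    (hl : Neg (l.map s).prod i) :
    ∃ l' : List ι, l'.length + 1 = l.length ∧ (l'.map s).prod = (l.map s).prod * t i := by
  induction l with
  | nil => exact absurd hl (h1 i)
  | cons j l ih =>
    rw [List.map_cons, List.prod_cons] at hl ⊢
    by_cases hN : Neg (l.map s).prod i
    · obtain ⟨l', h2, h3⟩ := ih hN
      exact ⟨j :: l', by simp [h2], by simp [h3, mul_assoc]⟩
    · refine ⟨l, rfl, ?_⟩
      rw [h _ _ _ hN hl, mul_assoc, ht, mul_one]

namespace EW

open Pt

variable {n : ℕ}

/-- `s_i` is a right descent of `w`. -/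
def Desc (w : EW n) (i : Node n) : Prop := w • next (mk 0 i.1) < w • mk 0 i.1

lemma desc_iff {w : EW n} {i : Node n} {x : Pt n} (hx : x.pos = i.1) :
    Desc w i ↔ w • next x < w • x := by
  rw [eq_shift x, next_shift, smul_shift, smul_shift, shift_lt_shift, Desc, hx]

lemma not_desc_iff {w : EW n} {i : Node n} {x : Pt n} (hx : x.pos = i.1) :
    ¬ Desc w i ↔ w • x < w • next x := by
  rw [desc_iff hx, not_lt]
  refine ⟨fun h => lt_of_le_of_ne h fun e => ?_, le_of_lt⟩
  exact (lt_next x).ne ((MulAction.injective w) e)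

/-- The exchange property. By `s_smul_lt`, left multiplication by $s_j$ can create a descent at $i$
only if $u$ carries the pair at $i$ to a pair of neighbours exchanged by $s_j$; then $s_ju$ and
$us_i$ agree on all points. -/
lemma s_mul_eq_of_desc {u : EW n} {i j : Node n} (h : ¬ Desc u i) (h' : Desc (s j * u) i) :
    s j * u = u * s i := by
  rw [not_desc_iff (x := mk 0 i.1) rfl] at h
  rw [desc_iff (x := mk 0 i.1) rfl, mul_smul, mul_smul] at h'
  have key : (u • mk 0 i.1).pos = j.1 ∧ u • next (mk 0 i.1) = next (u • mk 0 i.1) := by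
    by_contra hc
    exact lt_asymm h' (s_smul_lt j h hc)
  -- The action commutes with translation by the period, so what holds at level $0$ holds at every
  -- level.
  have key' : ∀ x : Pt n, x.pos = i.1 → (u • x).pos = j.1 ∧ u • next x = next (u • x) := by
    intro x hx
    rw [eq_shift x, hx, next_shift, smul_shift, smul_shift, next_shift]
    exact ⟨key.1, congrArg _ key.2⟩
  rw [smul_eq_iff]
  intro x
  rw [mul_smul, mul_smul]
  by_cases hx : x.pos = i.1
  · rw [s_smul_of_pos_eq i hx, (key' x hx).2, s_smul_of_pos_eq j (key' x hx).1]
  by_cases hx' : x.pos = nxt i.1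
  · obtain ⟨y, hy, rfl⟩ := exists_next_eq hx'
    rw [s_smul_next i hy, (key' y hy).2, s_smul_next j (key' y hy).1]
  · rw [s_smul_of_ne i hx hx', s_smul_of_ne j]
    · intro e
      rw [← key.1] at e
      exact hx (u.right.injective e)
    · intro e
      rw [← key.1, ← pos_next, ← key.2] at e
      exact hx' (by simpa using u.right.injective e)

/-- The length of an element of the extended affine Weyl group. -/
noncomputable def len (w : EW n) : ℕ := (reducedExpr w).2.length

lemma reducedExpr_spec (w : EW n) : IsReducedExpr w (reducedExpr w) :=
  (exists_isReducedExpr w).choose_spec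

lemma isReducedExpr_iff {w : EW n} {e : ℤ × List (Node n)} :
    IsReducedExpr w e ↔ IsExpr w e ∧ e.2.length = len w :=
  ⟨fun h => ⟨h.1, le_antisymm (h.2 _ (reducedExpr_spec w).1) ((reducedExpr_spec w).2 _ h.1)⟩,
    fun h => ⟨h.1, fun e' he' => h.2.trans_le ((reducedExpr_spec w).2 e' he')⟩⟩

lemma len_le {w : EW n} {e : ℤ × List (Node n)} (h : IsExpr w e) : len w ≤ e.2.length :=
  (reducedExpr_spec w).2 e h

lemma len_mul_s_le (w : EW n) (i : Node n) : len (w * s i) ≤ len w + 1 := by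
  have h := (reducedExpr_spec w).1
  have : IsExpr (w * s i) ((reducedExpr w).1, (reducedExpr w).2 ++ [i]) := by
    unfold IsExpr at h ⊢
    conv_lhs => rw [h]
    simp [mul_assoc]
  simpa [len] using len_le this

lemma mul_s_mul_s (w : EW n) (i : Node n) : w * s i * s i = w := by
  rw [mul_assoc, s_mul_self, mul_one]

/-- Powers of $\rho$ preserve the order, so the descent already belongs to the word in the simple
reflections, and `exists_word_shorter` removes one letter from it. -/
lemma len_mul_s_of_desc {w : EW n} {i : Node n} (h : Desc w i) : len (w * s i) + 1 = len w := by
  have he := (reducedExpr_spec w).1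
  unfold IsExpr at he
  have hN : Desc ((reducedExpr w).2.map s).prod i := by
    rw [he] at h
    rw [Desc, mul_smul, mul_smul, (rho_zpow_strictMono _).lt_iff_lt] at h
    exact h
  obtain ⟨l', h1, h2⟩ := exists_word_shorter s s s_mul_self Desc
    (fun i => by rw [not_desc_iff (x := mk 0 i.1) rfl]; simpa using lt_next _)
    (fun u i j => s_mul_eq_of_desc) _ i hN
  have h3 : len (w * s i) ≤ l'.length := by
    refine len_le (e := ((reducedExpr w).1, l')) ?_
    unfold IsExpr
    conv_lhs => rw [he]
    rw [h2, mul_assoc]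
  have h4 := len_mul_s_le (w * s i) i
  rw [mul_s_mul_s] at h4
  have h5 : (reducedExpr w).2.length = len w := rfl
  omega

lemma desc_mul_s {w : EW n} {i : Node n} : Desc (w * s i) i ↔ ¬ Desc w i := by
  rw [not_desc_iff (x := mk 0 i.1) rfl, Desc, mul_smul, mul_smul, s_smul_next i (pos_mk _ _),
    s_smul_of_pos_eq i (pos_mk _ _)]

lemma len_mul_s_of_not_desc {w : EW n} {i : Node n} (h : ¬ Desc w i) :
    len (w * s i) = len w + 1 := by
  have := len_mul_s_of_desc (desc_mul_s.mpr h)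
  rw [mul_s_mul_s] at this
  exact this.symm

lemma len_one : len (1 : EW n) = 0 :=
  Nat.le_zero.mp (len_le (e := (0, [])) (by simp [IsExpr]))

lemma len_rho_zpow_mul_le (k : ℤ) (w : EW n) : len (rho n ^ k * w) ≤ len w := by
  have h := (reducedExpr_spec w).1
  refine len_le (e := (k + (reducedExpr w).1, (reducedExpr w).2)) ?_
  unfold IsExpr at h ⊢
  conv_lhs => rw [h]
  rw [zpow_add, mul_assoc]

lemma len_rho_zpow_mul (k : ℤ) (w : EW n) : len (rho n ^ k * w) = len w := by
  refine le_antisymm (len_rho_zpow_mul_le k w) ?_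
  have := len_rho_zpow_mul_le (-k) (rho n ^ k * w)
  rwa [← mul_assoc, ← zpow_add, neg_add_cancel, zpow_zero, one_mul] at this

lemma exists_desc_of_len_ne_zero {w : EW n} (h : len w ≠ 0) : ∃ i, Desc w i := by
  have he := (reducedExpr_spec w).1
  unfold IsExpr at he
  obtain ⟨l, i, hl⟩ : ∃ l i, (reducedExpr w).2 = l ++ [i] := by
    rcases List.eq_nil_or_concat (reducedExpr w).2 with h0 | ⟨l, i, h0⟩
    · exact absurd (by simp [len, h0]) h
    · exact ⟨l, i, by simp [h0]⟩
  refine ⟨i, by_contra fun hd => ?_⟩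
  have h1 := len_mul_s_of_not_desc hd
  have h2 : len (w * s i) ≤ l.length := by
    refine len_le (e := ((reducedExpr w).1, l)) ?_
    unfold IsExpr
    conv_lhs => rw [he, hl]
    simp [mul_assoc, s_mul_self]
  have h3 : (reducedExpr w).2.length = len w := rfl
  rw [hl, List.length_append] at h3
  omega

/-- Positive length forces a descent, that is, a reversed pair of neighbours. This is how the block
components of length $0$ are recognized later. -/
lemma len_eq_zero_of_strictMono {w : EW n} (h : StrictMono fun x : Pt n => w • x) : len w = 0 := by
  by_contra h0
  obtain ⟨i, hi⟩ := exists_desc_of_len_ne_zero h0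
  exact (not_desc_iff (x := mk 0 i.1) rfl).mpr (h (lt_next _)) hi

lemma eq_rho_zpow {w : EW n} (h : len w = 0) : w = rho n ^ (reducedExpr w).1 := by
  have he := (reducedExpr_spec w).1
  unfold IsExpr at he
  rwa [List.length_eq_zero_iff.mp h, List.map_nil, List.prod_nil, mul_one] at he

end EW

open Pt

/-! ### Independence of the standard elements of the reduced expression -/

namespace EW

variable {n : ℕ}

lemma isReducedExpr_append {w : EW n} {k : ℤ} {l : List (Node n)} {i : Node n}
    (h : IsReducedExpr w (k, l ++ [i])) : Desc w i ∧ IsReducedExpr (w * s i) (k, l) := by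
  rw [isReducedExpr_iff] at h
  have h0 : IsExpr (w * s i) (k, l) := by
    have h1 := h.1
    unfold IsExpr at h1 ⊢
    rw [h1]
    simp [mul_assoc, s_mul_self]
  have h2 := len_le h0
  have h3 : l.length + 1 = len w := by simpa using h.2
  have hd : Desc w i := by
    by_contra hd
    have := len_mul_s_of_not_desc hd
    simp only at h2
    omega
  have h4 := len_mul_s_of_desc hd
  exact ⟨hd, isReducedExpr_iff.mpr ⟨h0, by simp only; omega⟩⟩

lemma isReducedExpr_mul_s {w : EW n} {k : ℤ} {l : List (Node n)} {i : Node n}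
    (h : IsReducedExpr w (k, l)) (hi : ¬ Desc w i) : IsReducedExpr (w * s i) (k, l ++ [i]) := by
  rw [isReducedExpr_iff] at h ⊢
  refine ⟨?_, by simpa [len_mul_s_of_not_desc hi] using h.2⟩
  have h1 := h.1
  unfold IsExpr at h1 ⊢
  rw [h1]
  simp [mul_assoc]

/-- The total degree of the translation part. -/
def deg (w : EW n) : ℤ := ∑ j, w.left.toAdd j

lemma deg_mul (v w : EW n) : deg (v * w) = deg v + deg w := by
  simp only [deg, SemidirectProduct.mul_left, toAdd_mul, Pi.add_apply, Finset.sum_add_distrib,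
    toAdd_permAct, add_right_inj]
  exact Equiv.sum_comp (v.right⁻¹) fun j => w.left.toAdd j

lemma deg_rho (hn : n ≠ 0) : deg (rho n) = 1 := by
  have h0 : 0 < n := Nat.pos_of_ne_zero hn
  simp only [deg, EW.rho, h0, dif_pos, SemidirectProduct.mul_left, SemidirectProduct.left_inr,
    SemidirectProduct.left_inl, SemidirectProduct.right_inr, one_mul, toAdd_permAct, transl,
    toAdd_ofAdd]
  rw [Equiv.sum_comp ((prv : Equiv.Perm (Fin n))⁻¹) (Pi.single (⟨0, h0⟩ : Fin n) (1 : ℤ))]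
  simp

/-- Additivity of the degree makes the exponent of $\rho$ recoverable from the group element, so an
element of length $0$ has only one expression without reflections. -/
lemma deg_rho_zpow (hn : n ≠ 0) (k : ℤ) : deg (rho n ^ k) = k := by
  have h1 : deg (1 : EW n) = 0 := by simp [deg]
  induction k using Int.induction_on with
  | zero => simpa using h1
  | succ k ih => rw [zpow_add_one, deg_mul, ih, deg_rho hn]
  | pred k ih =>
    have := deg_mul (rho n ^ (-(k : ℤ) - 1)) (rho n)
    rw [← zpow_add_one, sub_add_cancel, ih, deg_rho hn] at this
    omega

lemma mul_s_smul_self (w : EW n) {i : Node n} {x : Pt n} (h : x.pos = i.1) :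
    (w * s i) • x = w • next x := by rw [mul_smul, s_smul_of_pos_eq i h]

lemma mul_s_smul_next (w : EW n) {i : Node n} {x : Pt n} (h : x.pos = i.1) :
    (w * s i) • next x = w • x := by rw [mul_smul, s_smul_next i h]

lemma nxt_nxt_ne (hn : 3 ≤ n) (i : Fin n) : nxt (nxt i) ≠ i := by
  rw [ne_eq, Fin.ext_iff, nxt_val, nxt_val]
  split_ifs <;> omega

lemma mul_s_smul_next_next (hn : 3 ≤ n) (w : EW n) {i : Node n} {x : Pt n} (h : x.pos = i.1) :
    (w * s i) • next (next x) = w • next (next x) := by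
  rw [mul_smul, s_smul_of_ne]
  · rw [pos_next, pos_next, h]; exact nxt_nxt_ne hn _
  · rw [pos_next, pos_next, h]; exact nxt_ne i.2

lemma mul_s_next_smul (hn : 3 ≤ n) (w : EW n) {i : Node n} {x : Pt n} (h : x.pos = i.1) :
    (w * s i.next) • x = w • x := by
  rw [mul_smul, s_smul_of_ne]
  · rw [h]; exact (nxt_ne i.2).symm
  · rw [h]; exact (nxt_nxt_ne hn _).symm

lemma mul_s_smul_of_comm (w : EW n) {i j : Node n} (h : i ≠ j) (h' : j ≠ i.next) {x : Pt n}
    (hx : x.pos = j.1) : (w * s i) • x = w • x := by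
  rw [mul_smul, s_smul_of_ne]
  · rw [hx]; exact fun e => h (Subtype.ext e.symm)
  · rw [hx]; exact fun e => h' (Subtype.ext e)

lemma mul_s_smul_next_of_comm (w : EW n) {i j : Node n} (h : i ≠ j) (h' : i ≠ j.next) {x : Pt n}
    (hx : x.pos = j.1) : (w * s i) • next x = w • next x := by
  rw [mul_smul, s_smul_of_ne]
  · rw [pos_next, hx]; exact fun e => h' (Subtype.ext e.symm)
  · rw [pos_next, hx]; exact fun e => h (Subtype.ext (nxt.injective e).symm)

lemma pos_next_eq {i : Node n} {x : Pt n} (h : x.pos = i.1) : (next x).pos = i.next.1 := by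
  rw [pos_next, h]; rfl

/-- The exchange property for $u=s_i$: it has no descent at $j$, whereas $s_js_i$ has one. -/
lemma s_mul_s_comm {i j : Node n} (h : i ≠ j.next) (h' : j ≠ i.next) : s i * s j = s j * s i := by
  by_cases hij : i = j
  · rw [hij]
  have hx : (mk 0 j.1).pos = j.1 := rfl
  refine (s_mul_eq_of_desc ?_ ?_).symm
  · rw [not_desc_iff hx, ← one_mul (s i), mul_s_smul_of_comm _ hij h' hx,
      mul_s_smul_next_of_comm _ hij h hx]
    simpa using lt_next _
  · rw [desc_iff hx, mul_s_smul_of_comm _ hij h' hx, mul_s_smul_next_of_comm _ hij h hx,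
      ← one_mul (s j), mul_s_smul_self _ hx, mul_s_smul_next _ hx]
    simpa using lt_next _

/-- The exchange property for $u=s_is_{i+1}$: it has no descent at $i$, whereas $s_{i+1}u$ has one.
-/
lemma s_braid (hn : 3 ≤ n) (i : Node n) :
    s i * s i.next * s i = s i.next * s i * s i.next := by
  have hx : (mk 0 i.1).pos = i.1 := rfl
  have h : s i.next * (s i * s i.next) = s i * s i.next * s i := by
    apply s_mul_eq_of_desc
    · rw [not_desc_iff hx, mul_s_next_smul hn _ hx, mul_s_smul_self _ (pos_next_eq hx),
        ← one_mul (s i), mul_s_smul_self _ hx, mul_s_smul_next_next hn _ hx]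
      simpa using lt_next _
    · rw [desc_iff hx, ← mul_assoc, mul_s_next_smul hn _ hx,
        mul_s_smul_self _ (pos_next_eq hx), mul_s_smul_self _ hx, mul_s_smul_next_next hn _ hx,
        ← one_mul (s i.next), mul_s_smul_self _ (pos_next_eq hx),
        mul_s_smul_next _ (pos_next_eq hx)]
      simpa using lt_next _
  rw [← h, mul_assoc]

lemma next_next_of_two (x : Pt 2) : next (next x) = shift 1 x := by
  have h := x.pos.2
  ext
  · rw [lev_next, lev_next, lev_shift, pos_next, nxt_val]
    split_ifs <;> omega
  · rw [pos_next, pos_next, pos_shift, nxt_val, nxt_val]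
    split_ifs <;> omega

/-- If $n=2$, two successor steps make a full period, and two consecutive descents would put the
image of $x$ shifted up by one level below the image of $x$. So the missing braid relation for $n=2$
is never needed. -/
lemma three_le_of_desc {w : EW n} {i : Node n} (h : Desc w i) (h' : Desc w i.next) : 3 ≤ n := by
  have hn := i.2
  by_contra h3
  obtain rfl : n = 2 := by omega
  have hx : (mk 0 i.1).pos = i.1 := rfl
  rw [desc_iff hx] at h
  rw [desc_iff (pos_next_eq hx), next_next_of_two, smul_shift] at h'
  have := h'.trans h
  rw [lt_iff] at this
  simp only [lev_shift, pos_shift] at this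
  rcases this with h | h <;> omega

lemma isExpr_mul_rho_map {w : EW n} {k : ℤ} {l : List (Node n)} (h : IsExpr w (k, l)) :
    IsExpr (w * rho n) (k + 1, l.map Node.next) := by
  have : ∀ l : List (Node n),
      (l.map EW.s).prod * EW.rho n = EW.rho n * ((l.map Node.next).map EW.s).prod := by
    intro l
    induction l with
    | nil => simp
    | cons i l ih =>
      simp only [List.map_cons, List.prod_cons]
      rw [mul_assoc, ih, ← mul_assoc, ← rho_mul_s, mul_assoc]
  unfold IsExpr at h ⊢
  simp only at h ⊢
  rw [h, mul_assoc, this, zpow_add_one, mul_assoc]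

lemma desc_mul_rho {w : EW n} {i : Node n} : Desc (w * rho n) i.next ↔ Desc w i := by
  have hx : (mk 0 i.1).pos = i.1 := rfl
  rw [desc_iff hx, desc_iff (pos_next_eq hx), mul_smul, mul_smul, rho_smul_next, rho_smul_next]

/-- Moving $\rho$ to the left relabels the letters of a word, which gives one inequality. For the
other, $\rho$ also relabels descents, so a counterexample could be shortened at a descent down to
length $0$. -/
lemma len_mul_rho (w : EW n) : len (w * rho n) = len w := by
  have key : ∀ w : EW n, len (w * rho n) ≤ len w := by
    intro w
    have := len_le (isExpr_mul_rho_map (k := (reducedExpr w).1) (l := (reducedExpr w).2)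
      (reducedExpr_spec w).1)
    simpa [len] using this
  refine le_antisymm (key w) ?_
  by_contra h
  push Not at h
  induction hd : len w generalizing w with
  | zero => omega
  | succ d ih =>
    obtain ⟨i, hi⟩ := exists_desc_of_len_ne_zero (w := w) (by omega)
    have h1 := len_mul_s_of_desc hi
    have h2 := len_mul_s_of_desc (desc_mul_rho.mpr hi)
    rw [mul_assoc, rho_mul_s, ← mul_assoc] at h2
    exact ih (w * s i) (by omega) (by omega)

end EW

/-- The braid relations of the extended affine Weyl group, for elements `S_i` and a unit `R`. -/
structure IsBraid {n : ℕ} {A : Type*} [Monoid A] (S : Node n → A) (R : Aˣ) : Prop where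
  rho_s (i : Node n) : R * S i = S i.prev * R
  comm (i j : Node n) : i ≠ j.next → j ≠ i.next → S i * S j = S j * S i
  braid (i : Node n) : 3 ≤ n → S i * S i.next * S i = S i.next * S i * S i.next
  rho_zero : n = 0 → R = 1

namespace IsBraid

open EW

variable {n : ℕ} {A : Type*} [Monoid A] {S : Node n → A} {R : Aˣ}

/-- The product along an expression. -/
def val (S : Node n → A) (R : Aˣ) (e : ℤ × List (Node n)) : A :=
  ((R ^ e.1 : Aˣ) : A) * (e.2.map S).prod

lemma val_append (k : ℤ) (l : List (Node n)) (i : Node n) :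
    val S R (k, l ++ [i]) = val S R (k, l) * S i := by
  simp [val, mul_assoc]

lemma stdElt_eq_val (w : EW n) : stdElt S R w = val S R (reducedExpr w) := rfl

/-- The products along the reduced expressions of elements of length at most `N` only depend on
the elements. -/
def IndepUpTo (S : Node n → A) (R : Aˣ) (N : ℕ) : Prop :=
  ∀ w : EW n, len w ≤ N → ∀ e, IsReducedExpr w e → val S R e = stdElt S R w

lemma stdElt_mul_s_of_indep {N : ℕ} (H : IndepUpTo S R N) {w : EW n} {i : Node n}
    (hi : ¬ Desc w i) (hN : len (w * s i) ≤ N) : stdElt S R (w * s i) = stdElt S R w * S i := by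
  rw [← H _ hN ((reducedExpr w).1, (reducedExpr w).2 ++ [i])
    (isReducedExpr_mul_s (reducedExpr_spec w) hi), val_append]
  rfl

/-- Each of $ws_i$, $ws_j$ still has the other label as a descent, and both lead down to the same
element $ws_is_j$; from there the commutation of $S_i$ and $S_j$ finishes. -/
lemma stdElt_comm_of_indep {N : ℕ} (h : IsBraid S R) (H : IndepUpTo S R N) {w : EW n}
    {i j : Node n} (hij : i ≠ j.next) (hji : j ≠ i.next) (hi : Desc w i) (hj : Desc w j)
    (hN : len w ≤ N + 1) : stdElt S R (w * s i) * S i = stdElt S R (w * s j) * S j := by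
  by_cases hne : i = j
  · rw [hne]
  have hx : (Pt.mk 0 j.1).pos = j.1 := rfl
  have hy : (Pt.mk 0 i.1).pos = i.1 := rfl
  have dj : Desc (w * s i) j := by
    rw [desc_iff hx] at hj
    rwa [desc_iff hx, mul_s_smul_of_comm _ hne hji hx, mul_s_smul_next_of_comm _ hne hij hx]
  have di : Desc (w * s j) i := by
    rw [desc_iff hy] at hi
    rwa [desc_iff hy, mul_s_smul_of_comm _ (Ne.symm hne) hij hy,
      mul_s_smul_next_of_comm _ (Ne.symm hne) hji hy]
  have e : w * s j * s i = w * s i * s j := by rw [mul_assoc, mul_assoc, s_mul_s_comm hij hji]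
  have h1 := len_mul_s_of_desc hi
  have h2 := len_mul_s_of_desc hj
  have a1 := stdElt_mul_s_of_indep H (desc_mul_s.not.mpr (not_not.mpr dj))
    (by rw [mul_s_mul_s]; omega)
  have a2 := stdElt_mul_s_of_indep H (desc_mul_s.not.mpr (not_not.mpr di))
    (by rw [mul_s_mul_s]; omega)
  rw [mul_s_mul_s] at a1 a2
  rw [a1, a2, e, mul_assoc _ (S j), mul_assoc _ (S i), h.comm i j hij hji]

/-- Two adjacent descents mean that $w$ completely reverses three consecutive points. So $w$ can be
shortened three times along either side of the braid relation, and both chains end in the same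
element. -/
lemma stdElt_braid_of_indep {N : ℕ} (h : IsBraid S R) (H : IndepUpTo S R N) {w : EW n}
    {i : Node n} (hi : Desc w i) (hj : Desc w i.next) (hN : len w ≤ N + 1) :
    stdElt S R (w * s i) * S i = stdElt S R (w * s i.next) * S i.next := by
  have hn := three_le_of_desc hi hj
  have hx : (Pt.mk 0 i.1).pos = i.1 := rfl
  have hx' := pos_next_eq hx
  have d1 : Desc (w * s i) i.next := by
    rw [desc_iff hx] at hi
    rw [desc_iff hx'] at hj
    rw [desc_iff hx', mul_s_smul_next _ hx, mul_s_smul_next_next hn _ hx]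
    exact hj.trans hi
  have d2 : Desc (w * s i * s i.next) i := by
    rw [desc_iff hx'] at hj
    rwa [desc_iff hx, mul_s_next_smul hn _ hx, mul_s_smul_self _ hx', mul_s_smul_self _ hx,
      mul_s_smul_next_next hn _ hx]
  have d1' : Desc (w * s i.next) i := by
    rw [desc_iff hx] at hi
    rw [desc_iff hx'] at hj
    rw [desc_iff hx, mul_s_next_smul hn _ hx, mul_s_smul_self _ hx']
    exact hj.trans hi
  have d2' : Desc (w * s i.next * s i) i.next := by
    rw [desc_iff hx] at hi
    rwa [desc_iff hx', mul_s_smul_next _ hx, mul_s_smul_next_next hn _ hx, mul_s_next_smul hn _ hx,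
      mul_s_smul_next _ hx']
  have step : ∀ {v : EW n} {j : Node n}, Desc v j → len v ≤ N →
      stdElt S R v = stdElt S R (v * s j) * S j := by
    intro v j hv hl
    have := stdElt_mul_s_of_indep H (desc_mul_s.not.mpr (not_not.mpr hv))
      (by rwa [mul_s_mul_s])
    rwa [mul_s_mul_s] at this
  have h1 := len_mul_s_of_desc hi
  have h2 := len_mul_s_of_desc d1
  have h1' := len_mul_s_of_desc hj
  have h2' := len_mul_s_of_desc d1'
  have e : w * s i * s i.next * s i = w * s i.next * s i * s i.next := by
    have := s_braid hn i
    simp only [mul_assoc] at this ⊢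
    rw [this]
  rw [step d1 (by omega), step d2 (by omega), step d1' (by omega), step d2' (by omega), e]
  have := h.braid i hn
  simp only [mul_assoc] at this ⊢
  rw [this]

/-- Matsumoto's theorem by induction on the length. The last letters of two reduced expressions are
both descents of $w$, and the commuting and the adjacent case are settled by the two preceding
lemmas. -/
lemma indepUpTo (h : IsBraid S R) (N : ℕ) : IndepUpTo S R N := by
  have base : ∀ w : EW n, len w = 0 → ∀ e, IsReducedExpr w e → val S R e = stdElt S R w := by
    rintro w hw ⟨k, l⟩ he
    have hl : l = [] := List.length_eq_zero_iff.mp ((isReducedExpr_iff.mp he).2.trans hw)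
    subst hl
    have hl' : (reducedExpr w).2 = [] := List.length_eq_zero_iff.mp hw
    have e1 : w = rho n ^ k := by simpa [IsExpr] using he.1
    have e2 := eq_rho_zpow hw
    simp only [stdElt, val, hl', List.map_nil, List.prod_nil, mul_one]
    -- For $n=0$ the element $\rho$ is trivial and does not determine the exponent; the condition
    -- `rho_zero` makes the exponent irrelevant.
    by_cases hn : n = 0
    · rw [h.rho_zero hn, one_zpow, one_zpow]
    · rw [e1] at e2
      rw [← deg_rho_zpow hn k, e2, deg_rho_zpow hn, e1]
  induction N with
  | zero => exact fun w hw => base w (Nat.le_zero.mp hw)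
  | succ N ih =>
    rintro w hw ⟨k, l⟩ he
    by_cases h0 : len w = 0
    · exact base w h0 _ he
    rcases List.eq_nil_or_concat l with rfl | ⟨l, i, rfl⟩
    · exact absurd (isReducedExpr_iff.mp he).2.symm h0
    have hr := reducedExpr_spec w
    rw [stdElt_eq_val]
    generalize reducedExpr w = e' at hr
    obtain ⟨k', l'⟩ := e'
    rcases List.eq_nil_or_concat l' with rfl | ⟨l', j, rfl⟩
    · exact absurd (isReducedExpr_iff.mp hr).2.symm h0
    rw [List.concat_eq_append] at he hr
    obtain ⟨di, ri⟩ := isReducedExpr_append he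
    obtain ⟨dj, rj⟩ := isReducedExpr_append hr
    have h1 := len_mul_s_of_desc di
    have h2 := len_mul_s_of_desc dj
    rw [List.concat_eq_append, List.concat_eq_append, val_append, val_append, ih _ (by omega) _ ri,
      ih _ (by omega) _ rj]
    by_cases hij : i = j.next
    · subst hij
      exact (stdElt_braid_of_indep h ih dj di hw).symm
    by_cases hji : j = i.next
    · subst hji
      exact stdElt_braid_of_indep h ih di dj hw
    exact stdElt_comm_of_indep h ih hij hji di dj hw

/-- The product along a reduced expression of `w` is `T_w`. -/
theorem val_eq_stdElt (h : IsBraid S R) {w : EW n} {e : ℤ × List (Node n)}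
    (he : IsReducedExpr w e) : val S R e = stdElt S R w :=
  h.indepUpTo (len w) w le_rfl e he

lemma stdElt_mul_s (h : IsBraid S R) {w : EW n} {i : Node n} (hi : ¬ Desc w i) :
    stdElt S R (w * s i) = stdElt S R w * S i :=
  stdElt_mul_s_of_indep (h.indepUpTo _) hi le_rfl

lemma stdElt_of_desc (h : IsBraid S R) {w : EW n} {i : Node n} (hi : Desc w i) :
    stdElt S R w = stdElt S R (w * s i) * S i := by
  rw [← h.stdElt_mul_s (desc_mul_s.not.mpr (not_not.mpr hi)), mul_s_mul_s]

/-- Moving $\rho$ through a reduced word shifts its labels cyclically, and the result is again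
reduced because the length is unchanged. -/
lemma stdElt_mul_rho (h : IsBraid S R) (w : EW n) :
    stdElt S R (w * rho n) = stdElt S R w * R := by
  have hl : ∀ l : List (Node n),
      (l.map S).prod * R = R * ((l.map Node.next).map S).prod := by
    intro l
    induction l with
    | nil => simp
    | cons i l ih =>
      have : (R : A) * S i.next = S i * R := by
        rw [h.rho_s]
        congr
        exact Subtype.ext (Equiv.symm_apply_apply nxt i.1)
      simp only [List.map_cons, List.prod_cons]
      rw [mul_assoc, ih, ← mul_assoc, ← this, mul_assoc]
  have hr : IsReducedExpr (w * rho n) ((reducedExpr w).1 + 1, (reducedExpr w).2.map Node.next) :=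
    isReducedExpr_iff.mpr ⟨isExpr_mul_rho_map (reducedExpr_spec w).1, by
      rw [len_mul_rho, List.length_map]; rfl⟩
  rw [← h.val_eq_stdElt hr, val, stdElt, mul_assoc, hl, zpow_add_one, Units.val_mul, mul_assoc]

lemma stdElt_mul_rho_zpow (h : IsBraid S R) (w : EW n) (k : ℤ) :
    stdElt S R (w * rho n ^ k) = stdElt S R w * (R ^ k : Aˣ) := by
  induction k using Int.induction_on with
  | zero => simp
  | succ k ih =>
    rw [zpow_add_one, ← mul_assoc, h.stdElt_mul_rho, ih, zpow_add_one, Units.val_mul, mul_assoc]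
  | pred k ih =>
    have := h.stdElt_mul_rho (w * rho n ^ (-(k : ℤ) - 1))
    rw [mul_assoc, ← zpow_add_one, sub_add_cancel, ih] at this
    rw [zpow_sub_one R, Units.val_mul, ← mul_assoc, this, Units.mul_inv_cancel_right]

lemma stdElt_one (h : IsBraid S R) : stdElt S R (1 : EW n) = 1 := by
  rw [← h.val_eq_stdElt (e := (0, []))
    (isReducedExpr_iff.mpr ⟨by simp [IsExpr], by simp [len_one]⟩)]
  simp [val]

lemma stdElt_rho_zpow (h : IsBraid S R) (k : ℤ) :
    stdElt S R (rho n ^ k) = (R ^ k : Aˣ) := by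
  rw [← one_mul (rho n ^ k), h.stdElt_mul_rho_zpow, h.stdElt_one, one_mul]

lemma stdElt_mul_of_len_eq_zero (h : IsBraid S R) (w : EW n) {x : EW n} (hx : len x = 0) :
    stdElt S R (w * x) = stdElt S R w * stdElt S R x := by
  rw [eq_rho_zpow hx, h.stdElt_mul_rho_zpow, h.stdElt_rho_zpow]

lemma stdElt_s (h : IsBraid S R) (i : Node n) : stdElt S R (s i) = S i := by
  have := h.stdElt_mul_s (w := 1) (i := i) (by
    rw [not_desc_iff (x := Pt.mk 0 i.1) rfl]; simpa using lt_next _)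
  rwa [one_mul, h.stdElt_one, one_mul] at this

end IsBraid

open Pt EW

/-! ### The coloured regular representation -/

section RegularRep

variable {K : Type*} [Field K] {n : ℕ} {C : Type*}

open Classical in
/-- The contribution `z` of an inversion of two points of the same colour. -/
noncomputable def invCoef (c : Fin n → C) (z : K) (x y : Pt n) : K :=
  if y < x ∧ c x.pos = c y.pos then z else 0

/-- Right multiplication by `S_i`. -/
noncomputable def opS (c : Fin n → C) (z : K) (i : Node n) : Module.End K (EW n →₀ K) :=
  Finsupp.linearCombination K fun w => Finsupp.single (w * s i) 1 +
    invCoef c z (w • Pt.mk 0 i.1) (w • next (Pt.mk 0 i.1)) • Finsupp.single w 1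

/-- Right multiplication by a group element. -/
noncomputable def opR (K : Type*) [Field K] (g : EW n) : Module.End K (EW n →₀ K) :=
  Finsupp.linearCombination K fun w => Finsupp.single (w * g) 1

/-- Right multiplication by `t_j`, which acts on the points of colour `d` by the scalar `a d`. -/
noncomputable def opT (c : Fin n → C) (a : C → K) (j : Fin n) : Module.End K (EW n →₀ K) :=
  Finsupp.linearCombination K fun w => a (c (w.right j)) • Finsupp.single w 1

variable (c : Fin n → C) (z : K)

lemma invCoef_shift (k : ℤ) (x y : Pt n) :
    invCoef c z (shift k x) (shift k y) = invCoef c z x y := by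
  classical exact if_congr (and_congr_left' shift_lt_shift) rfl rfl

lemma opS_single (i : Node n) (w : EW n) {x : Pt n} (hx : x.pos = i.1) :
    opS c z i (Finsupp.single w 1) = Finsupp.single (w * s i) 1 +
      invCoef c z (w • x) (w • next x) • Finsupp.single w 1 := by
  rw [opS, Finsupp.linearCombination_single, one_smul, eq_shift x, next_shift, smul_shift,
    smul_shift, invCoef_shift, hx]

lemma opR_single (g w : EW n) :
    opR K g (Finsupp.single w 1) = Finsupp.single (w * g) 1 := by
  rw [opR, Finsupp.linearCombination_single, one_smul]

lemma opT_single (a : C → K) (j : Fin n) (w : EW n) :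
    opT c a j (Finsupp.single w 1) = a (c (w.right j)) • Finsupp.single w 1 := by
  rw [opT, Finsupp.linearCombination_single, one_smul]

lemma finsupp_hom_ext {V W : Type*} [AddCommMonoid V] [Module K V] {f g : (W →₀ K) →ₗ[K] V}
    (h : ∀ w, f (Finsupp.single w 1) = g (Finsupp.single w 1)) : f = g :=
  Finsupp.lhom_ext' fun w => LinearMap.ext_ring (h w)

lemma opR_mul (g h : EW n) : opR K g * opR K h = opR K (h * g) :=
  finsupp_hom_ext fun w => by
    simp only [Module.End.mul_apply, opR_single, mul_assoc]

lemma opR_one : opR K (1 : EW n) = 1 :=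
  finsupp_hom_ext fun w => by simp [opR_single]

lemma opS_mul_opR_rho (i : Node n) :
    opS c z i * opR K (rho n) = opR K (rho n) * opS c z i.prev :=
  finsupp_hom_ext fun w => by
    have hx : (Pt.mk 0 i.prev.1).pos = i.prev.1 := rfl
    have hx' := pos_next_eq hx
    rw [Node.next_prev] at hx'
    have e := rho_mul_s i.prev
    rw [Node.next_prev] at e
    simp only [Module.End.mul_apply, opR_single, opS_single c z i _ hx', opS_single c z _ _ hx,
      map_add, map_smul, mul_smul, rho_smul_next, mul_assoc, e]

lemma opT_mul_opR_rho (a : C → K) (j : Fin n) :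
    opT c a j * opR K (rho n) = opR K (rho n) * opT c a (prv j) :=
  finsupp_hom_ext fun w => by
    have hr : (EW.rho n).right = prv := by simp [EW.rho]
    simp only [Module.End.mul_apply, opR_single, opT_single, map_smul,
      SemidirectProduct.mul_right, hr, Equiv.Perm.mul_apply]

lemma opT_mul_opT (a : C → K) (i j : Fin n) :
    opT c a i * opT c a j = opT c a j * opT c a i :=
  finsupp_hom_ext fun w => by
    simp only [Module.End.mul_apply, opT_single, map_smul]
    rw [smul_comm]

/-- The diagonal term of the operator of $S_i$ is present only when the two exchanged points share a
colour, and then the transposition does not change the scalar by which $t_j$ acts. -/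
lemma opT_mul_opS (a : C → K) (i : Node n) (j : Fin n) :
    opT c a j * opS c z i = opS c z i * opT c a (adjSwap i.1 j) :=
  finsupp_hom_ext fun w => by
    have hx : (Pt.mk 0 i.1).pos = i.1 := rfl
    simp only [Module.End.mul_apply, opT_single, opS_single c z i _ hx, map_smul, map_add,
      smul_add, SemidirectProduct.mul_right, s_right, Equiv.Perm.mul_apply]
    congr 1
    rw [invCoef]
    split_ifs with h
    · have h2 := h.2
      rw [pos_smul, pos_smul, pos_next, hx] at h2
      have : c (w.right (adjSwap i.1 j)) = c (w.right j) := by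
        by_cases h3 : j = i.1
        · rw [h3, adjSwap, Equiv.swap_apply_left, h2]
        by_cases h4 : j = nxt i.1
        · rw [h4, adjSwap, Equiv.swap_apply_right, h2]
        rw [adjSwap, Equiv.swap_apply_of_ne_of_ne h3 h4]
      rw [this, smul_comm]
    · simp

lemma opS_comm {i j : Node n} (hij : i ≠ j.next) (hji : j ≠ i.next) :
    opS c z j * opS c z i = opS c z i * opS c z j := by
  by_cases hne : i = j
  · rw [hne]
  refine finsupp_hom_ext fun w => ?_
  have hx : (Pt.mk 0 i.1).pos = i.1 := rfl
  have hy : (Pt.mk 0 j.1).pos = j.1 := rfl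
  simp only [Module.End.mul_apply, opS_single c z i _ hx, opS_single c z j _ hy, map_smul, map_add,
    mul_s_smul_of_comm _ hne hji hy, mul_s_smul_next_of_comm _ hne hij hy,
    mul_s_smul_of_comm _ (Ne.symm hne) hij hx, mul_s_smul_next_of_comm _ (Ne.symm hne) hji hx,
    mul_assoc, s_mul_s_comm hij hji]
  module

/-- On the basis vector of $w$ only the order and the colours of the images of three consecutive
points matter, so the relation becomes a finite check on three points. -/
lemma opS_braid (hn : 3 ≤ n) (i : Node n) :
    opS c z i * (opS c z i.next * opS c z i) =
      opS c z i.next * (opS c z i * opS c z i.next) := by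
  refine finsupp_hom_ext fun w => ?_
  have hx : (Pt.mk 0 i.1).pos = i.1 := rfl
  have hy := pos_next_eq hx
  have e1 : w * s i * s i.next * s i = w * s i.next * s i * s i.next := by
    have := s_braid hn i
    simp only [mul_assoc] at this ⊢
    rw [this]
  simp only [Module.End.mul_apply, opS_single c z i _ hx, opS_single c z i.next _ hy, map_smul,
    map_add, mul_s_smul_self _ hx, mul_s_smul_next _ hx, mul_s_smul_next_next hn _ hx,
    mul_s_next_smul hn _ hx, mul_s_smul_self _ hy, mul_s_smul_next _ hy, mul_s_mul_s, e1]
  have h1 : w • Pt.mk 0 i.1 ≠ w • next (Pt.mk 0 i.1) :=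
    fun e => (lt_next _).ne (MulAction.injective w e)
  have h2 : w • next (Pt.mk 0 i.1) ≠ w • next (next (Pt.mk 0 i.1)) :=
    fun e => (lt_next _).ne (MulAction.injective w e)
  generalize w • Pt.mk 0 i.1 = x at *
  generalize w • next (Pt.mk 0 i.1) = y at *
  generalize w • next (next (Pt.mk 0 i.1)) = u at *
  -- The identities `k0`, `k1`, `k2` compare the coefficients of $w$, $ws_i$ and $ws_{i+1}$; the
  -- terms at longer products agree on both sides.
  have k0 : invCoef c z x u + invCoef c z x y * invCoef c z y u * invCoef c z x y =
      invCoef c z x u + invCoef c z y u * invCoef c z x y * invCoef c z y u := by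
    simp only [invCoef]
    split_ifs <;> ring
  have k1 : invCoef c z x u * invCoef c z y x + invCoef c z x y * invCoef c z y u =
      invCoef c z y u * invCoef c z x u := by
    simp only [invCoef]
    split_ifs <;> first | ring1 | (exfalso; grind)
  have k2 : invCoef c z x y * invCoef c z x u =
      invCoef c z x u * invCoef c z u y + invCoef c z y u * invCoef c z x y := by
    simp only [invCoef]
    split_ifs <;> first | ring1 | (exfalso; grind)
  linear_combination (norm := module) k0 • Finsupp.single w (1 : K) +
    k1 • Finsupp.single (w * s i) (1 : K) +
    k2 • Finsupp.single (w * s i.next) (1 : K)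

/-- Exactly one of $w$, $ws_i$ has a descent at $i$, so the correction $z$ occurs once, and only for
equal colours. The operator $E$ plays the role of $e_i$. -/
lemma opS_mul_self [DecidableEq C] (i : Node n) {E : Module.End K (EW n →₀ K)}
    (hE : ∀ w, E (Finsupp.single w 1) =
      (if c (w.right i.1) = c (w.right (nxt i.1)) then (1 : K) else 0) • Finsupp.single w 1) :
    opS c z i * opS c z i = 1 + z • (opS c z i * E) := by
  refine finsupp_hom_ext fun w => ?_
  have hx : (Pt.mk 0 i.1).pos = i.1 := rfl
  simp only [Module.End.mul_apply, opS_single c z i _ hx, map_smul, LinearMap.add_apply,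
    LinearMap.smul_apply, Module.End.one_apply, hE,
    map_add, mul_s_smul_self _ hx, mul_s_smul_next _ hx, mul_s_mul_s]
  have h1 : w • Pt.mk 0 i.1 ≠ w • next (Pt.mk 0 i.1) :=
    fun e => (lt_next _).ne (MulAction.injective w e)
  have e1 : w.right i.1 = (w • Pt.mk 0 i.1).pos := rfl
  have e2 : w.right (nxt i.1) = (w • next (Pt.mk 0 i.1)).pos := by simp
  rw [e1, e2]
  generalize w • Pt.mk 0 i.1 = x at *
  generalize w • next (Pt.mk 0 i.1) = y at *
  by_cases hc : c x.pos = c y.pos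
  · rcases lt_or_gt_of_ne h1 with h | h <;> simp [invCoef, hc, h, h.not_gt, add_comm]
  · simp [invCoef, hc, Ne.symm hc]

/-- Stripping a right descent lowers the length, and length $0$ leaves only powers of $\rho$. -/
lemma EW.ind {P : EW n → Prop} (h0 : ∀ k : ℤ, P (rho n ^ k))
    (hs : ∀ w i, ¬ Desc w i → P w → P (w * s i)) (w : EW n) : P w := by
  induction hd : len w generalizing w with
  | zero => rw [eq_rho_zpow hd]; exact h0 _
  | succ d ih =>
    obtain ⟨i, hi⟩ := exists_desc_of_len_ne_zero (w := w) (by omega)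
    have h1 := len_mul_s_of_desc hi
    rw [← mul_s_mul_s w i]
    exact hs _ _ (desc_mul_s.not.mpr (not_not.mpr hi)) (ih _ (by omega))

lemma rep_units_zpow {A : Type*} [Monoid A] {R : Aˣ}
    (f : A →* (Module.End K (EW n →₀ K))ᵐᵒᵖ) (hR : f R = .op (opR K (rho n))) (k : ℤ) :
    f (R ^ k : Aˣ) = .op (opR K (rho n ^ k)) := by
  have hmul : ∀ g h : EW n, MulOpposite.op (opR K g) * MulOpposite.op (opR K h) =
      MulOpposite.op (opR K (g * h)) := fun g h => by
    rw [← MulOpposite.op_mul, opR_mul]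
  induction k using Int.induction_on with
  | zero =>
    rw [zpow_zero, zpow_zero, opR_one, Units.val_one, map_one]; rfl
  | succ k ih => rw [zpow_add_one, Units.val_mul, map_mul, ih, hR, hmul, ← zpow_add_one]
  | pred k ih =>
    have h1 : f ((R ^ (-(k : ℤ) - 1) : Aˣ) : A) * f R = .op (opR K (rho n ^ (-(k : ℤ)))) := by
      rw [← ih, ← map_mul, ← Units.val_mul, ← zpow_add_one, sub_add_cancel]
    have h2 : f (R : A) * .op (opR K (rho n)⁻¹) = 1 := by
      rw [hR, hmul, mul_inv_cancel, opR_one]; rfl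
    rw [← mul_one (f ((R ^ (-(k : ℤ) - 1) : Aˣ) : A)), ← h2, ← mul_assoc, h1, hmul,
      ← zpow_sub_one]

/-- In the regular representation, the first basis vector is mapped by `T_w` to the one with
index `w`. -/
lemma rep_stdElt {A : Type*} [Monoid A] {S : Node n → A} {R : Aˣ} (hb : IsBraid S R)
    (f : A →* (Module.End K (EW n →₀ K))ᵐᵒᵖ) (hS : ∀ i, f (S i) = .op (opS c z i))
    (hR : f R = .op (opR K (rho n))) (w : EW n) :
    (f (stdElt S R w)).unop (Finsupp.single 1 1) = Finsupp.single w 1 := by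
  induction w using EW.ind with
  | h0 k =>
    rw [hb.stdElt_rho_zpow, rep_units_zpow f hR, MulOpposite.unop_op, opR_single, one_mul]
  | hs w i hi ih =>
    have hx : (Pt.mk 0 i.1).pos = i.1 := rfl
    rw [hb.stdElt_mul_s hi, map_mul, MulOpposite.unop_mul, Module.End.mul_apply, ih, hS,
      MulOpposite.unop_op, opS_single c z i w hx, invCoef, if_neg fun h => hi h.1, zero_smul,
      add_zero]

end RegularRep

/-- Generators suffice to show that a subspace is a right ideal. This serves twice: for the spanning
property of the standard bases and for the multiplicativity of the isomorphism. -/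
lemma RingQuot.mul_mem_of_gen {K X : Type*} [Field K]
    {rel : FreeAlgebra K X → FreeAlgebra K X → Prop}
    (N : Submodule K (RingQuot rel))
    (h : ∀ x ∈ N, ∀ g, x * RingQuot.mkAlgHom K rel (FreeAlgebra.ι K g) ∈ N) (x : RingQuot rel)
    (hx : x ∈ N) (y : RingQuot rel) : x * y ∈ N := by
  obtain ⟨y, rfl⟩ := RingQuot.mkAlgHom_surjective K rel y
  induction y using FreeAlgebra.induction generalizing x with
  | grade0 a =>
    rw [AlgHom.commutes, ← Algebra.commutes, ← Algebra.smul_def]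
    exact N.smul_mem _ hx
  | grade1 g => exact h x hx g
  | mul a b ha hb => rw [map_mul, ← mul_assoc]; exact hb _ (ha _ hx)
  | add a b ha hb => rw [map_add, mul_add]; exact add_mem (ha _ hx) (hb _ hx)

/-! ### The standard basis of the affine Hecke algebra -/

namespace AffHecke

variable {K : Type*} [Field K] (q : K) {n : ℕ}

lemma coe_R : ((R q n : (AffHecke K q n)ˣ) : AffHecke K q n) =
    RingQuot.mkAlgHom K (HRel K q n) (FreeAlgebra.ι K HGen.rho) := rfl

lemma isBraid : IsBraid (S q) (R q n) where
  rho_s i := by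
    have h := RingQuot.mkAlgHom_rel K (HRel.rho_s (K := K) (q := q) i)
    simp only [map_mul] at h
    exact h
  comm i j h h' := by
    have h := RingQuot.mkAlgHom_rel K (HRel.comm (K := K) (q := q) i j h h')
    simp only [map_mul] at h
    exact h
  braid i h := by
    have h := RingQuot.mkAlgHom_rel K (HRel.braid (K := K) (q := q) i h)
    simp only [map_mul] at h
    exact h
  rho_zero h := by
    apply Units.ext
    have h := RingQuot.mkAlgHom_rel K (HRel.rho_zero (K := K) (q := q) h)
    simp only [map_one] at h
    exact h

lemma S_mul_S (i : Node n) : S q i * S q i = 1 + (q - q⁻¹) • S q i := by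
  have h := RingQuot.mkAlgHom_rel K (HRel.quad (K := K) (q := q) i)
  simp only [pow_two, map_mul, map_add, map_one, map_smul] at h
  exact h

/-- The regular representation, as a right module. -/
noncomputable def rep : AffHecke K q n →ₐ[K] (Module.End K (EW n →₀ K))ᵐᵒᵖ :=
  RingQuot.liftAlgHom K ⟨FreeAlgebra.lift K fun
    | .s i => .op (opS (fun _ => ()) (q - q⁻¹) i)
    | .rho => .op (opR K (rho n))
    | .rhoInv => .op (opR K (rho n)⁻¹), by
    intro x y h
    apply MulOpposite.unop_injective
    cases h with
    | rho_s i =>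
      simpa using opS_mul_opR_rho _ _ i
    | comm i j h h' =>
      simpa using opS_comm _ _ h h'
    | braid i h =>
      simpa using opS_braid _ _ h i
    | quad i =>
      simpa [pow_two] using opS_mul_self (fun _ => ()) (q - q⁻¹) i (E := 1) (by simp)
    | rho_inv =>
      simpa using (opR_mul _ _).trans (by simp [opR_one])
    | inv_rho =>
      simpa using (opR_mul _ _).trans (by simp [opR_one])
    | rho_zero h =>
      subst h
      have h : rho 0 = 1 := SemidirectProduct.ext (Subsingleton.elim _ _) (Subsingleton.elim _ _)
      simp [h, opR_one]⟩

lemma rep_S (i : Node n) : rep q (S q i) = .op (opS (fun _ => ()) (q - q⁻¹) i) := by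
  simp [rep, S, RingQuot.liftAlgHom_mkAlgHom_apply]

lemma rep_R : rep q (R q n : (AffHecke K q n)ˣ) = .op (opR K (rho n)) := by
  simp [rep, coe_R, RingQuot.liftAlgHom_mkAlgHom_apply]

lemma rep_std (w : EW n) :
    (rep q (std q w)).unop (Finsupp.single 1 1) = Finsupp.single w 1 :=
  rep_stdElt _ _ (isBraid q) (rep q).toMonoidHom (rep_S q) (rep_R q) w

/-- Applying $S_w$ to the first basis vector of the regular representation gives the basis vector of
$w$. -/
lemma linearIndependent_std : LinearIndependent K (std q : EW n → AffHecke K q n) := by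
  let L : AffHecke K q n →ₗ[K] (EW n →₀ K) :=
    { toFun := fun x => (rep q x).unop (Finsupp.single 1 1)
      map_add' := fun x y => by simp
      map_smul' := fun a x => by simp }
  apply LinearIndependent.of_comp L
  convert (Finsupp.basisSingleOne (R := K) (ι := EW n)).linearIndependent
  funext w
  rw [Finsupp.coe_basisSingleOne]
  exact rep_std q w

lemma std_mul_S_of_not_desc {w : EW n} {i : Node n} (h : ¬ Desc w i) :
    std q w * S q i = std q (w * s i) :=
  ((isBraid q).stdElt_mul_s h).symm

lemma std_mul_S_of_desc {w : EW n} {i : Node n} (h : Desc w i) :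
    std q w * S q i = std q (w * s i) + (q - q⁻¹) • std q w := by
  have e : std q w = std q (w * s i) * S q i := (isBraid q).stdElt_of_desc h
  conv_lhs => rw [e]
  rw [mul_assoc, S_mul_S, mul_add, mul_one, mul_smul_comm, ← e]

lemma std_mul_of_len_eq_zero (w : EW n) {x : EW n} (hx : len x = 0) :
    std q w * std q x = std q (w * x) :=
  ((isBraid q).stdElt_mul_of_len_eq_zero w hx).symm

lemma std_one : std q (1 : EW n) = 1 := (isBraid q).stdElt_one

lemma std_s (i : Node n) : std q (s i) = S q i := (isBraid q).stdElt_s i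

lemma span_std : Submodule.span K (Set.range (std q : EW n → AffHecke K q n)) = ⊤ := by
  set N := Submodule.span K (Set.range (std q : EW n → AffHecke K q n)) with hN
  have hmem : ∀ w, std q w ∈ N := fun w => Submodule.subset_span ⟨w, rfl⟩
  rw [eq_top_iff]
  intro y _
  rw [← one_mul y]
  refine RingQuot.mul_mem_of_gen N (fun x hx g => ?_) 1 (by rw [← std_one]; exact hmem 1) y
  induction hx using Submodule.span_induction with
  | zero => simp
  | add x y _ _ hx hy => rw [add_mul]; exact add_mem hx hy
  | smul a x _ hx => rw [smul_mul_assoc]; exact N.smul_mem _ hx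
  | mem x hx =>
    obtain ⟨w, rfl⟩ := hx
    match g with
    | .s i =>
      change std q w * S q i ∈ N
      by_cases h : Desc w i
      · rw [std_mul_S_of_desc q h]; exact add_mem (hmem _) (N.smul_mem _ (hmem _))
      · rw [std_mul_S_of_not_desc q h]; exact hmem _
    | .rho =>
      have := (isBraid q).stdElt_mul_rho_zpow w 1
      rw [zpow_one, zpow_one] at this
      exact this ▸ hmem _
    | .rhoInv =>
      have := (isBraid q).stdElt_mul_rho_zpow w (-1)
      rw [zpow_neg_one, zpow_neg_one] at this
      exact this ▸ hmem _

/-- The standard basis. -/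
noncomputable def basis : Module.Basis (EW n) K (AffHecke K q n) :=
  Module.Basis.mk (linearIndependent_std q) (span_std q).ge

lemma basis_apply (w : EW n) : basis q w = std q w := Module.Basis.mk_apply _ _ _

end AffHecke

/-! ### Roots of unity -/

section Roots

variable {K : Type*} [Field K] {r : ℕ} (ζ : Fin r ≃ rootsOfUnity r K)

/-- The root of unity with number `a`, as an element of the field. -/
def root (a : Fin r) : K := ((ζ a : Kˣ) : K)

lemma root_pow (a : Fin r) : root ζ a ^ r = 1 := by
  have := (ζ a).2
  rw [mem_rootsOfUnity] at this
  rw [root, ← Units.val_pow_eq_pow_val, this, Units.val_one]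

lemma root_ne_zero (a : Fin r) : root ζ a ≠ 0 := Units.ne_zero _

lemma root_injective : Function.Injective (root ζ) := fun _ _ h =>
  ζ.injective (Subtype.ext (Units.ext h))

/-- The sum is geometric with ratio $\zeta_a\zeta_b^{-1}$, an $r$-th root of unity which is $1$ only
for $a=b$. -/
lemma sum_root_pow_mul (hr : (r : K) ≠ 0) (a b : Fin r) :
    (r : K)⁻¹ * ∑ s ∈ Finset.range r, root ζ a ^ s * root ζ b ^ (r - s) =
      if a = b then 1 else 0 := by
  have hb := root_ne_zero ζ b
  have e : ∀ s ∈ Finset.range r, root ζ a ^ s * root ζ b ^ (r - s) =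
      (root ζ a * (root ζ b)⁻¹) ^ s := by
    intro s hs
    have h : root ζ b ^ (r - s) * root ζ b ^ s = 1 := by
      rw [← pow_add, Nat.sub_add_cancel (Finset.mem_range.mp hs).le, root_pow]
    rw [mul_pow, inv_pow, eq_inv_of_mul_eq_one_left h]
  rw [Finset.sum_congr rfl e]
  split_ifs with hab
  · rw [hab, mul_inv_cancel₀ hb]
    simp [hr]
  · have h1 : root ζ a * (root ζ b)⁻¹ ≠ 1 := fun h => hab <| root_injective ζ <| by
      rw [← div_eq_mul_inv, div_eq_one_iff_eq hb] at h; exact h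
    have h2 := geom_sum_mul (root ζ a * (root ζ b)⁻¹) r
    rw [mul_pow, inv_pow, root_pow, root_pow, inv_one, mul_one, sub_self] at h2
    rw [(mul_eq_zero.mp h2).resolve_right (sub_ne_zero.mpr h1), mul_zero]

/-- For $0<s<r$ not all of the $r$ roots can be zeros of $x^s-1$. Multiplication by one that is not
permutes the roots and scales the sum by a factor different from $1$. -/
lemma sum_root_pow {s : ℕ} (hs : s < r) :
    ∑ a, root ζ a ^ s = if s = 0 then (r : K) else 0 := by
  split_ifs with h0
  · simp [h0]
  obtain ⟨b, hb⟩ : ∃ b, root ζ b ^ s ≠ 1 := by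
    classical
    by_contra! h
    have h1 : Finset.univ.image (root ζ) ⊆ (Polynomial.nthRoots s (1 : K)).toFinset := by
      intro x hx
      obtain ⟨a, -, rfl⟩ := Finset.mem_image.mp hx
      rw [Multiset.mem_toFinset, Polynomial.mem_nthRoots (Nat.pos_of_ne_zero h0)]
      exact h a
    have h2 := Finset.card_le_card h1
    rw [Finset.card_image_of_injective _ (root_injective ζ), Finset.card_univ, Fintype.card_fin]
      at h2
    have h3 := (Multiset.toFinset_card_le _).trans (Polynomial.card_nthRoots s (1 : K))
    omega
  have h1 : ∑ a, root ζ a ^ s = root ζ b ^ s * ∑ a, root ζ a ^ s := by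
    rw [Finset.mul_sum]
    refine (Fintype.sum_equiv ((ζ.trans (Equiv.mulLeft (ζ b))).trans ζ.symm) _ _ fun a => ?_).symm
    simp [root, mul_pow]
  have h2 : (1 - root ζ b ^ s) * ∑ a, root ζ a ^ s = 0 := by
    rw [sub_mul, one_mul, ← h1, sub_self]
  exact (mul_eq_zero.mp h2).resolve_left (sub_ne_zero.mpr hb.symm)

end Roots

/-! ### The basis of the algebra generated by the `t_j` and `T_w` -/

/-- The affine label precedes the first finite one, so relations known for finite labels pass to
$s_0$ by conjugation with $\rho$. -/
lemma Node.exists_finite_prev {n : ℕ} (i : Node n) (h : ¬ (i.1 : ℕ) + 1 < n) :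
    ∃ j : FNode n, i = j.toNode.prev := by
  have hn := i.2
  refine ⟨⟨⟨0, by omega⟩, by simp only; omega⟩, Subtype.ext ?_⟩
  apply nxt.injective
  apply Fin.ext
  rw [nxt_val, if_neg h]
  have : (nxt (prv (⟨0, by omega⟩ : Fin n)) : Fin n) = ⟨0, by omega⟩ :=
    Equiv.apply_symm_apply nxt _
  exact (congrArg Fin.val this).symm

namespace IM

variable {K : Type*} [Field K] (q : K) {r n : ℕ}

lemma coe_R : ((R q r n : (IM K q r n)ˣ) : IM K q r n) =
    RingQuot.mkAlgHom K (IMRel K q r n) (FreeAlgebra.ι K IMGen.rho) := rfl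

lemma isBraid (hn : n ≠ 0) : IsBraid (S q r) (R q r n) where
  rho_s i := by
    have h := RingQuot.mkAlgHom_rel K (IMRel.rho_s (K := K) (q := q) (r := r) i)
    simp only [map_mul] at h
    exact h
  comm i j h h' := by
    have h := RingQuot.mkAlgHom_rel K (IMRel.comm (K := K) (q := q) (r := r) i j h h')
    simp only [map_mul] at h
    exact h
  braid i h := by
    have h := RingQuot.mkAlgHom_rel K (IMRel.braid (K := K) (q := q) (r := r) i h)
    simp only [map_mul] at h
    exact h
  rho_zero h := absurd h hn

lemma t_pow (j : Fin n) : t q r j ^ r = 1 := by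
  have h := RingQuot.mkAlgHom_rel K (IMRel.t_pow (K := K) (q := q) (r := r) j)
  simp only [map_pow, map_one] at h
  exact h

lemma t_comm (i j : Fin n) : t q r i * t q r j = t q r j * t q r i := by
  have h := RingQuot.mkAlgHom_rel K (IMRel.t_comm (K := K) (q := q) (r := r) i j)
  simp only [map_mul] at h
  exact h

lemma R_mul_t (j : Fin n) : R q r n * t q r j = t q r (prv j) * R q r n := by
  have h := RingQuot.mkAlgHom_rel K (IMRel.rho_t (K := K) (q := q) (r := r) j)
  simp only [map_mul] at h
  exact h

lemma R_mul_S (i : Node n) : R q r n * S q r i = S q r i.prev * R q r n := by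
  have h := RingQuot.mkAlgHom_rel K (IMRel.rho_s (K := K) (q := q) (r := r) i)
  simp only [map_mul] at h
  exact h

lemma S_mul_S (i : Node n) : S q r i * S q r i =
    1 + (q - q⁻¹) • (tIdem K r (t q r i.1) (t q r (nxt i.1)) * S q r i) := by
  have h := RingQuot.mkAlgHom_rel K (IMRel.quad (K := K) (q := q) (r := r) i)
  simp only [pow_two, map_mul, map_add, map_one, map_smul, tIdem, map_sum, map_pow] at h
  exact h

lemma S_mul_t_of_finite (i : FNode n) (j : Fin n) :
    S q r i.toNode * t q r j = t q r (adjSwap i.1 j) * S q r i.toNode := by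
  have h := RingQuot.mkAlgHom_rel K (IMRel.s_t (K := K) (q := q) (r := r) i j)
  simp only [map_mul] at h
  exact h

/-- The presentation contains this only for finite labels; for the affine one it is conjugated by
$\rho$ from the first finite label. -/
lemma S_mul_t (i : Node n) (j : Fin n) :
    S q r i * t q r j = t q r (adjSwap i.1 j) * S q r i := by
  by_cases h : (i.1 : ℕ) + 1 < n
  · exact S_mul_t_of_finite q ⟨i.1, h⟩ j
  obtain ⟨i, rfl⟩ := i.exists_finite_prev h
  have e1 : (prv (nxt j) : Fin n) = j := Equiv.symm_apply_apply nxt j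
  have e2 : prv (adjSwap i.1 (nxt j)) = adjSwap (prv i.1) j := by
    rw [adjSwap, adjSwap, ← (prv : Equiv.Perm (Fin n)).injective.swap_apply, e1,
      show (prv (nxt i.1) : Fin n) = i.1 from Equiv.symm_apply_apply nxt _,
      show (nxt (prv i.1) : Fin n) = i.1 from Equiv.apply_symm_apply nxt _]
  rw [← Units.mul_left_inj (R q r n), mul_assoc, mul_assoc, ← R_mul_S]
  conv_lhs => rw [← e1, ← R_mul_t, ← mul_assoc, ← R_mul_S, mul_assoc, S_mul_t_of_finite,
    ← mul_assoc, R_mul_t, e2, mul_assoc]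
  rfl

lemma std_mul_t (hn : n ≠ 0) (w : EW n) (j : Fin n) :
    std q r w * t q r j = t q r (w.right j) * std q r w := by
  have hb := isBraid q (r := r) hn
  have hr : (EW.rho n).right = prv := by simp [EW.rho]
  induction w using EW.ind generalizing j with
  | h0 k =>
    rw [std, hb.stdElt_rho_zpow]
    induction k using Int.induction_on generalizing j with
    | zero => simp
    | succ k ih =>
      rw [zpow_add_one, Units.val_mul, mul_assoc, R_mul_t, ← mul_assoc, ih, mul_assoc,
        zpow_add_one, SemidirectProduct.mul_right, hr]
      rfl
    | pred k ih =>
      have h1 : (↑(R q r n)⁻¹ : IM K q r n) * t q r j = t q r (nxt j) * ↑(R q r n)⁻¹ := by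
        rw [Units.inv_mul_eq_iff_eq_mul, ← mul_assoc, R_mul_t, Units.mul_inv_cancel_right]
        rw [show (prv (nxt j) : Fin n) = j from Equiv.symm_apply_apply nxt j]
      rw [zpow_sub_one, Units.val_mul, mul_assoc, h1, ← mul_assoc, ih, mul_assoc,
        zpow_sub_one, SemidirectProduct.mul_right, SemidirectProduct.inv_right, hr]
      rfl
  | hs w i hi ih =>
    rw [std, hb.stdElt_mul_s hi, mul_assoc, S_mul_t, ← mul_assoc]
    change std q r w * _ * _ = _
    rw [ih, SemidirectProduct.mul_right, s_right, mul_assoc]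
    rfl

/-! #### Weight vectors for the `t_j` in right modules -/

section Act

variable (ζ : Fin r ≃ rootsOfUnity r K) {V : Type*} [AddCommGroup V] [Module K V]
  {act : IM K q r n →ₗ[K] V →ₗ[K] V}

/-- The right action is kept abstract because it is used both for right multiplication in the
algebra itself and for the coloured regular representation. -/
lemma act_t_pow (h1 : ∀ v, act 1 v = v) (hmul : ∀ x y v, act (x * y) v = act y (act x v)) {v : V}
    {d : Chi r n} (hv : ∀ j, act (t q r j) v = root ζ (d j) • v) (j : Fin n) (k : ℕ) :
    act (t q r j ^ k) v = root ζ (d j) ^ k • v := by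
  induction k with
  | zero => simp [h1]
  | succ k ih => rw [pow_succ, hmul, ih, map_smul, hv, smul_smul, pow_succ]

lemma act_tIdem (h1 : ∀ v, act 1 v = v) (hmul : ∀ x y v, act (x * y) v = act y (act x v)) {v : V}
    {d : Chi r n} (hv : ∀ j, act (t q r j) v = root ζ (d j) • v) (hr : (r : K) ≠ 0) (i j : Fin n) :
    act (tIdem K r (t q r i) (t q r j)) v = if d i = d j then v else 0 := by
  have := sum_root_pow_mul ζ hr (d i) (d j)
  rw [tIdem, map_smul, map_sum, LinearMap.smul_apply, LinearMap.sum_apply]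
  simp only [hmul, act_t_pow q ζ h1 hmul hv, map_smul, smul_smul]
  rw [← Finset.sum_smul, smul_smul]
  rw [this, ite_smul, one_smul, zero_smul]

lemma act_idemE (h1 : ∀ v, act 1 v = v) (hmul : ∀ x y v, act (x * y) v = act y (act x v)) {v : V}
    {d : Chi r n} (hv : ∀ j, act (t q r j) v = root ζ (d j) • v) (hr : (r : K) ≠ 0) (c : Chi r n) :
    act (idemE q ζ c) v = if c = d then v else 0 := by
  have key : ∀ l : List (Fin n), act ((l.map fun i : Fin n => (r : K)⁻¹ • ∑ s ∈ Finset.range r,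
      (((ζ (c i) : Kˣ) : K) ^ s) • IM.t q r i ^ (r - s)).prod) v =
      if ∀ i ∈ l, c i = d i then v else 0 := by
    intro l
    induction l with
    | nil => simp [h1]
    | cons i l ih =>
      have := sum_root_pow_mul ζ hr (c i) (d i)
      rw [List.map_cons, List.prod_cons, hmul, map_smul, map_sum, LinearMap.smul_apply,
        LinearMap.sum_apply]
      simp only [map_smul, LinearMap.smul_apply, act_t_pow q ζ h1 hmul hv, smul_smul]
      rw [← Finset.sum_smul, map_smul, smul_smul, ih]
      change ((r : K)⁻¹ * ∑ s ∈ Finset.range r, root ζ (c i) ^ s * root ζ (d i) ^ (r - s)) • _ = _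
      rw [this]
      by_cases h : c i = d i <;> simp [h]
  rw [idemE, List.ofFn_eq_map, key]
  simp [funext_iff]

end Act

end IM

/-! ### Weight idempotents in a commutative algebra -/

section CommIdem

variable {K : Type*} [Field K] {r n : ℕ} (ζ : Fin r ≃ rootsOfUnity r K) {D : Type*} [CommRing D]
  [Algebra K D]

/-- The idempotent `r⁻¹ ∑_s ζ_a ^ s x ^ (-s)` on which `x` acts by `ζ_a`. -/
def weightIdem (x : D) (a : Fin r) : D :=
  (r : K)⁻¹ • ∑ s ∈ Finset.range r, root ζ a ^ s • x ^ (r - s)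

/-- The difference of the two sides is, up to $r^{-1}$, the telescoping sum of $\zeta_a^sx^{r+1-s}$,
whose end terms are both $x$. -/
lemma weightIdem_mul {x : D} (hx : x ^ r = 1) (a : Fin r) :
    weightIdem ζ x a * x = root ζ a • weightIdem ζ x a := by
  have h := Finset.sum_range_sub' (fun s => root ζ a ^ s • x ^ (r + 1 - s)) r
  have e : ∀ s ∈ Finset.range r, root ζ a ^ s • x ^ (r + 1 - s) -
      root ζ a ^ (s + 1) • x ^ (r + 1 - (s + 1)) =
      (root ζ a ^ s • x ^ (r - s)) * x - root ζ a • (root ζ a ^ s • x ^ (r - s)) := by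
    intro s hs
    rw [Nat.succ_sub (Finset.mem_range.mp hs).le, Nat.succ_sub_succ, pow_succ x, smul_mul_assoc,
      smul_smul, ← pow_succ']
  rw [Finset.sum_congr rfl e, Finset.sum_sub_distrib, ← Finset.sum_mul, ← Finset.smul_sum,
    root_pow] at h
  simp only [pow_zero, tsub_zero, pow_succ, hx, add_tsub_cancel_left, one_smul, one_mul,
    sub_self] at h
  rw [weightIdem, smul_mul_assoc, sub_eq_zero.mp h, smul_comm]

lemma sum_weightIdem (hr : (r : K) ≠ 0) {x : D} (hx : x ^ r = 1) :
    ∑ a, weightIdem ζ x a = 1 := by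
  have h0 : 0 < r := Nat.pos_of_ne_zero fun h => hr (by simp [h])
  simp only [weightIdem]
  rw [← Finset.smul_sum, Finset.sum_comm]
  have e : ∀ s ∈ Finset.range r, ∑ a, root ζ a ^ s • x ^ (r - s) =
      if s = 0 then (r : K) • 1 else 0 := by
    intro s hs
    rw [← Finset.sum_smul, sum_root_pow ζ (Finset.mem_range.mp hs)]
    split_ifs with h
    · rw [h, Nat.sub_zero, hx]
    · rw [zero_smul]
  rw [Finset.sum_congr rfl e, Finset.sum_ite_eq', if_pos (Finset.mem_range.mpr h0), smul_smul,
    inv_mul_cancel₀ hr, one_smul]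

lemma sum_prod_weightIdem (hr : (r : K) ≠ 0) {x : Fin n → D} (hx : ∀ j, x j ^ r = 1) :
    ∑ c : Chi r n, ∏ i, weightIdem ζ (x i) (c i) = 1 := by
  have := Finset.prod_univ_sum (fun _ : Fin n => (Finset.univ : Finset (Fin r)))
    (fun i a => weightIdem ζ (x i) a)
  rw [Fintype.piFinset_univ] at this
  rw [← this]
  exact Finset.prod_eq_one fun i _ => sum_weightIdem ζ hr (hx i)

lemma prod_weightIdem_mul {x : Fin n → D} (hx : ∀ j, x j ^ r = 1) (c : Chi r n) (j : Fin n) :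
    (∏ i, weightIdem ζ (x i) (c i)) * x j = root ζ (c j) • ∏ i, weightIdem ζ (x i) (c i) := by
  rw [← Finset.mul_prod_erase _ _ (Finset.mem_univ j), mul_right_comm, weightIdem_mul ζ (hx j),
    smul_mul_assoc]

end CommIdem

namespace IM

variable {K : Type*} [Field K] (q : K) {r n : ℕ} (ζ : Fin r ≃ rootsOfUnity r K)

-- The $t_j$ generate a commutative subalgebra, in which the ordered product defining $E_\chi$
-- becomes a product over a finite set and can be expanded over all characters.
open scoped IsMulCommutative in
lemma idemE_aux (hr : (r : K) ≠ 0) : (∑ c : Chi r n, idemE q ζ c = 1) ∧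
    ∀ (c : Chi r n) (j : Fin n), idemE q ζ c * t q r j = root ζ (c j) • idemE q ζ c := by
  have hcomm : ∀ x ∈ Set.range (t q r : Fin n → IM K q r n), ∀ y ∈ Set.range (t q r),
      x * y = y * x := by
    rintro _ ⟨i, rfl⟩ _ ⟨j, rfl⟩
    exact t_comm q i j
  let D := Algebra.adjoin K (Set.range (t q r : Fin n → IM K q r n))
  have hD : IsMulCommutative D := Algebra.isMulCommutative_adjoin K hcomm
  let x : Fin n → D := fun j => ⟨t q r j, Algebra.subset_adjoin ⟨j, rfl⟩⟩
  have hx : ∀ j, x j ^ r = 1 := fun j => Subtype.ext (t_pow q j)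
  have hE : ∀ c : Chi r n, idemE q ζ c = D.val (∏ i, weightIdem ζ (x i) (c i)) := by
    intro c
    rw [← List.prod_ofFn, map_list_prod, List.map_ofFn, idemE]
    congr 2
    funext i
    simp only [Function.comp_apply, weightIdem, map_smul, map_sum, map_pow]
    rfl
  constructor
  · simp only [hE]
    rw [← map_sum, sum_prod_weightIdem ζ hr hx, map_one]
  · intro c j
    rw [hE]
    change D.val _ * D.val (x j) = _
    rw [← map_mul, prod_weightIdem_mul ζ hx, map_smul]

lemma sum_idemE (hr : (r : K) ≠ 0) : ∑ c : Chi r n, idemE q ζ c = 1 := (idemE_aux q ζ hr).1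

lemma idemE_mul_t (hr : (r : K) ≠ 0) (c : Chi r n) (j : Fin n) :
    idemE q ζ c * t q r j = root ζ (c j) • idemE q ζ c := (idemE_aux q ζ hr).2 c j

lemma mul_idemE (hr : (r : K) ≠ 0) {x : IM K q r n} {d : Chi r n}
    (hx : ∀ j, x * t q r j = root ζ (d j) • x) (c : Chi r n) :
    x * idemE q ζ c = if c = d then x else 0 :=
  act_idemE q ζ (act := (LinearMap.mul K (IM K q r n)).flip) (fun v => by simp)
    (fun x y v => by simp [mul_assoc]) hx hr c

lemma mul_tIdem (hr : (r : K) ≠ 0) {x : IM K q r n} {d : Chi r n}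
    (hx : ∀ j, x * t q r j = root ζ (d j) • x) (i j : Fin n) :
    x * tIdem K r (t q r i) (t q r j) = if d i = d j then x else 0 :=
  act_tIdem q ζ (act := (LinearMap.mul K (IM K q r n)).flip) (fun v => by simp)
    (fun x y v => by simp [mul_assoc]) hx hr i j

/-- `E_χ T_w` -/
noncomputable def bas (p : Chi r n × EW n) : IM K q r n := idemE q ζ p.1 * std q r p.2

lemma bas_mul_t (hn : n ≠ 0) (hr : (r : K) ≠ 0) (c : Chi r n) (w : EW n) (j : Fin n) :
    bas q ζ (c, w) * t q r j = root ζ (Chi.act w.right⁻¹ c j) • bas q ζ (c, w) := by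
  rw [bas, mul_assoc, std_mul_t q hn, ← mul_assoc, idemE_mul_t q ζ hr, smul_mul_assoc]
  simp [Chi.act]

lemma bas_mul_idemE (hn : n ≠ 0) (hr : (r : K) ≠ 0) (c : Chi r n) (w : EW n) (d : Chi r n) :
    bas q ζ (c, w) * idemE q ζ d = if d = Chi.act w.right⁻¹ c then bas q ζ (c, w) else 0 :=
  mul_idemE q ζ hr (bas_mul_t q ζ hn hr c w) d

lemma bas_mul_S_of_not_desc (hn : n ≠ 0) {w : EW n} {i : Node n} (h : ¬ Desc w i) (c : Chi r n) :
    bas q ζ (c, w) * S q r i = bas q ζ (c, w * s i) := by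
  rw [bas, mul_assoc]
  exact congrArg _ ((isBraid q hn).stdElt_mul_s h).symm

/-- Write $T_w=T_{ws_i}T_{s_i}$ and use the quadratic relation. On the weight vector $E_\chi
T_{ws_i}$ the idempotent $e_i$ acts by $1$ or $0$ according to whether the two colours agree. -/
lemma bas_mul_S_of_desc (hn : n ≠ 0) (hr : (r : K) ≠ 0) {w : EW n} {i : Node n} (h : Desc w i)
    (c : Chi r n) :
    bas q ζ (c, w) * S q r i = bas q ζ (c, w * s i) +
      (if c (w.right i.1) = c (w.right (nxt i.1)) then q - q⁻¹ else 0) • bas q ζ (c, w) := by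
  have e : std q r w = std q r (w * s i) * S q r i := (isBraid q hn).stdElt_of_desc h
  have e' : bas q ζ (c, w) = bas q ζ (c, w * s i) * S q r i := by
    rw [bas, bas, mul_assoc, ← e]
  conv_lhs => rw [e']
  rw [mul_assoc, S_mul_S, mul_add, mul_one, mul_smul_comm, ← mul_assoc,
    mul_tIdem q ζ hr (bas_mul_t q ζ hn hr c (w * s i))]
  simp only [Chi.act, inv_inv, SemidirectProduct.mul_right, s_right, Equiv.Perm.mul_apply, adjSwap,
    Equiv.swap_apply_left, Equiv.swap_apply_right]
  congr 1
  by_cases h : c (w.right i.1) = c (w.right (nxt i.1))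
  · rw [if_pos h, if_pos h.symm, ← e']
  · rw [if_neg h, if_neg (Ne.symm h), zero_mul, smul_zero, zero_smul]

lemma bas_mul_of_len_eq_zero (hn : n ≠ 0) (c : Chi r n) (w : EW n) {x : EW n} (hx : len x = 0) :
    bas q ζ (c, w) * std q r x = bas q ζ (c, w * x) := by
  rw [bas, mul_assoc]
  exact congrArg _ ((isBraid q hn).stdElt_mul_of_len_eq_zero w hx).symm

lemma std_one (hn : n ≠ 0) : std q r (1 : EW n) = 1 := (isBraid q hn).stdElt_one

lemma std_s (hn : n ≠ 0) (i : Node n) : std q r (s i) = S q r i := (isBraid q hn).stdElt_s i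

lemma len_rho_zpow (k : ℤ) : len (rho n ^ k) = 0 := by
  rw [← mul_one (rho n ^ k), len_rho_zpow_mul, len_one]

lemma std_rho_zpow (hn : n ≠ 0) (k : ℤ) : std q r (rho n ^ k) = (R q r n ^ k : (IM K q r n)ˣ) :=
  (isBraid q hn).stdElt_rho_zpow k

lemma span_bas (hn : n ≠ 0) (hr : (r : K) ≠ 0) :
    Submodule.span K (Set.range (bas q ζ : Chi r n × EW n → IM K q r n)) = ⊤ := by
  set N := Submodule.span K (Set.range (bas q ζ : Chi r n × EW n → IM K q r n)) with hN
  have hmem : ∀ p, bas q ζ p ∈ N := fun p => Submodule.subset_span ⟨p, rfl⟩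
  have h1 : 1 ∈ N := by
    rw [← sum_idemE q ζ hr]
    refine Submodule.sum_mem _ fun c _ => ?_
    have := hmem (c, 1)
    rwa [bas, std_one q hn, mul_one] at this
  rw [eq_top_iff]
  intro y _
  rw [← one_mul y]
  refine RingQuot.mul_mem_of_gen N (fun x hx g => ?_) 1 h1 y
  induction hx using Submodule.span_induction with
  | zero => simp
  | add x y _ _ hx hy => rw [add_mul]; exact add_mem hx hy
  | smul a x _ hx => rw [smul_mul_assoc]; exact N.smul_mem _ hx
  | mem x hx =>
    obtain ⟨⟨c, w⟩, rfl⟩ := hx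
    match g with
    | .t j =>
      change bas q ζ (c, w) * t q r j ∈ N
      rw [bas_mul_t q ζ hn hr]; exact N.smul_mem _ (hmem _)
    | .s i =>
      change bas q ζ (c, w) * S q r i ∈ N
      by_cases h : Desc w i
      · rw [bas_mul_S_of_desc q ζ hn hr h]; exact add_mem (hmem _) (N.smul_mem _ (hmem _))
      · rw [bas_mul_S_of_not_desc q ζ hn h]; exact hmem _
    | .rho =>
      have := bas_mul_of_len_eq_zero q ζ hn c w (len_rho_zpow 1)
      rw [std_rho_zpow q hn, zpow_one] at this
      exact this ▸ hmem _
    | .rhoInv =>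
      have := bas_mul_of_len_eq_zero q ζ hn c w (len_rho_zpow (-1))
      rw [std_rho_zpow q hn, zpow_neg_one] at this
      exact this ▸ hmem _

lemma opT_pow_single (c : Chi r n) (j : Fin n) (k : ℕ) (w : EW n) :
    (opT c (root ζ) j ^ k) (Finsupp.single w 1) =
      root ζ (c (w.right j)) ^ k • Finsupp.single w 1 := by
  induction k with
  | zero => simp
  | succ k ih => rw [pow_succ, Module.End.mul_apply, opT_single, map_smul, ih, smul_smul, pow_succ']

/-- The regular representation on `E_χ Ĥ`, as a right module. -/
noncomputable def rep (hr : (r : K) ≠ 0) (c : Chi r n) :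
    IM K q r n →ₐ[K] (Module.End K (EW n →₀ K))ᵐᵒᵖ :=
  RingQuot.liftAlgHom K ⟨FreeAlgebra.lift K fun
    | .t j => .op (opT c (root ζ) j)
    | .s i => .op (opS c (q - q⁻¹) i)
    | .rho => .op (opR K (rho n))
    | .rhoInv => .op (opR K (rho n)⁻¹), by
    intro x y h
    apply MulOpposite.unop_injective
    cases h with
    | t_pow j =>
      refine finsupp_hom_ext fun w => ?_
      simp [opT_pow_single, root_pow]
    | t_comm i j => simpa using opT_mul_opT _ _ _ _
    | s_t i j => simpa using! opT_mul_opS c (q - q⁻¹) (root ζ) i.toNode j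
    | rho_t j => simpa using opT_mul_opR_rho _ _ _
    | rho_s i => simpa using opS_mul_opR_rho _ _ i
    | comm i j h h' => simpa using opS_comm _ _ h h'
    | braid i h => simpa using opS_braid _ _ h i
    | quad i =>
      -- The operator $E$ is the image of $e_i$; its factors appear in reverse order because the
      -- representation takes values in the opposite algebra.
      have := opS_mul_self c (q - q⁻¹) i
        (E := (r : K)⁻¹ • ∑ a ∈ Finset.range r,
          opT c (root ζ) (nxt i.1) ^ (r - a) * opT c (root ζ) i.1 ^ a) (by
          intro w
          rw [← sum_root_pow_mul ζ hr, LinearMap.smul_apply, LinearMap.sum_apply]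
          simp only [Module.End.mul_apply, opT_pow_single, map_smul, smul_smul]
          rw [← Finset.sum_smul, smul_smul])
      simpa [pow_two, tIdem] using this
    | rho_inv => simpa using (opR_mul _ _).trans (by simp [opR_one])
    | inv_rho => simpa using (opR_mul _ _).trans (by simp [opR_one])⟩

lemma rep_t (hr : (r : K) ≠ 0) (c : Chi r n) (j : Fin n) :
    rep q ζ hr c (t q r j) = .op (opT c (root ζ) j) := by
  simp [rep, t, RingQuot.liftAlgHom_mkAlgHom_apply]

lemma rep_S (hr : (r : K) ≠ 0) (c : Chi r n) (i : Node n) :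
    rep q ζ hr c (S q r i) = .op (opS c (q - q⁻¹) i) := by
  simp [rep, S, RingQuot.liftAlgHom_mkAlgHom_apply]

lemma rep_R (hr : (r : K) ≠ 0) (c : Chi r n) :
    rep q ζ hr c (R q r n : (IM K q r n)ˣ) = .op (opR K (rho n)) := by
  simp [rep, coe_R, RingQuot.liftAlgHom_mkAlgHom_apply]

/-- The right module structure on `E_χ Ĥ`. -/
noncomputable def rightAct (hr : (r : K) ≠ 0) (c : Chi r n) :
    IM K q r n →ₗ[K] (EW n →₀ K) →ₗ[K] (EW n →₀ K) :=
  (MulOpposite.opLinearEquiv K).symm.toLinearMap ∘ₗ (rep q ζ hr c).toLinearMap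

lemma rightAct_mul (hr : (r : K) ≠ 0) (c : Chi r n) (x y : IM K q r n) (v : EW n →₀ K) :
    rightAct q ζ hr c (x * y) v = rightAct q ζ hr c y (rightAct q ζ hr c x v) := by
  simp [rightAct]

lemma rightAct_bas (hn : n ≠ 0) (hr : (r : K) ≠ 0) (c d : Chi r n) (w : EW n) :
    rightAct q ζ hr d (bas q ζ (c, w)) (Finsupp.single 1 1) =
      if c = d then Finsupp.single w 1 else 0 := by
  have h1 := act_idemE q ζ (act := rightAct q ζ hr d) (v := Finsupp.single 1 1) (d := d)
    (fun v => by simp [rightAct]) (rightAct_mul q ζ hr d)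
    (fun j => by simp [rightAct, rep_t, opT_single]) hr c
  rw [bas, rightAct_mul, h1]
  split_ifs with h
  · exact rep_stdElt _ _ (isBraid q hn) (rep q ζ hr d).toMonoidHom (rep_S q ζ hr d)
      (rep_R q ζ hr d) w
  · simp

/-- The dual functional of $E_\chi T_w$ lets an element act on the first basis vector of the module
coloured by $\chi$ and takes the coefficient at $w$. -/
lemma linearIndependent_bas (hn : n ≠ 0) (hr : (r : K) ≠ 0) :
    LinearIndependent K (bas q ζ : Chi r n × EW n → IM K q r n) := by
  refine LinearIndependent.of_pairwise_dual_eq_zero_one _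
    (fun p => Finsupp.lapply p.2 ∘ₗ (rightAct q ζ hr p.1).flip (Finsupp.single 1 1)) ?_ ?_
  · rintro ⟨c, w⟩ ⟨d, v⟩ h
    simp only [LinearMap.comp_apply, LinearMap.flip_apply, rightAct_bas q ζ hn]
    split_ifs with h1
    · have : v ≠ w := fun h2 => h (by rw [h1, h2])
      simp [this]
    · simp
  · rintro ⟨c, w⟩
    simp [rightAct_bas q ζ hn]

/-- The basis of the `E_χ T_w`. -/
noncomputable def basis (hn : n ≠ 0) (hr : (r : K) ≠ 0) :
    Module.Basis (Chi r n × EW n) K (IM K q r n) :=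
  Module.Basis.mk (linearIndependent_bas q ζ hn hr) (span_bas q ζ hn hr).ge

lemma basis_apply (hn : n ≠ 0) (hr : (r : K) ≠ 0) (p : Chi r n × EW n) :
    basis q ζ hn hr p = bas q ζ p := Module.Basis.mk_apply _ _ _

end IM

/-! ### Minimal coset representatives -/

section MinReps

variable {n : ℕ}

lemma exists_adjSwap_word (σ : Equiv.Perm (Fin n)) :
    ∃ l : List (FNode n), (l.map fun i => adjSwap i.1).prod = σ := by
  obtain _ | n := n
  · exact ⟨[], Subsingleton.elim _ _⟩
  have h : σ ∈ Submonoid.closure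
      (Set.range fun i : Fin n => Equiv.swap i.castSucc i.succ) := by
    rw [Equiv.Perm.mclosure_swap_castSucc_succ]; trivial
  induction h using Submonoid.closure_induction with
  | one => exact ⟨[], rfl⟩
  | mul a b _ _ ha hb =>
    obtain ⟨l, rfl⟩ := ha
    obtain ⟨l', rfl⟩ := hb
    exact ⟨l ++ l', by simp⟩
  | mem a ha =>
    obtain ⟨i, rfl⟩ := ha
    have hlt : ((i.castSucc : Fin (n + 1)) : ℕ) + 1 < n + 1 := by simp
    refine ⟨[⟨i.castSucc, hlt⟩], ?_⟩
    have e' : nxt i.castSucc = i.succ := by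
      apply Fin.ext; rw [nxt_val, if_pos hlt]; simp
    rw [List.map_singleton, List.prod_singleton, adjSwap, e']

lemma exists_word_of_permLength (σ : Equiv.Perm (Fin n)) :
    ∃ l : List (FNode n), (l.map fun i => adjSwap i.1).prod = σ ∧ l.length = permLength σ := by
  obtain ⟨l, hl⟩ := exists_adjSwap_word σ
  exact Nat.sInf_mem (s := {d | ∃ l : List (FNode n),
    (l.map fun i => adjSwap i.1).prod = σ ∧ l.length = d}) ⟨_, l, hl, rfl⟩

lemma FNode.val_nxt (i : FNode n) : ((nxt i.1 : Fin n) : ℕ) = i.1 + 1 := by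
  rw [nxt_val, if_pos i.2]

lemma adjSwap_lt_adjSwap (j : FNode n) {a b : Fin n} (h : a < b)
    (hn : ¬ (a = j.1 ∧ b = nxt j.1)) : adjSwap j.1 a < adjSwap j.1 b := by
  have hj := j.val_nxt
  simp only [adjSwap, Equiv.swap_apply_def]
  simp only [Fin.ext_iff, Fin.lt_def] at *
  split_ifs <;> omega

/-- The same word-shortening argument as for the affine group: an adjacent transposition reverses no
pair except its own. -/
lemma permLength_mul_adjSwap_lt {σ : Equiv.Perm (Fin n)} {i : FNode n}
    (h : σ (nxt i.1) < σ i.1) : permLength (σ * adjSwap i.1) < permLength σ := by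
  obtain ⟨l, hl, hlen⟩ := exists_word_of_permLength σ
  obtain ⟨l', h1, h2⟩ := exists_word_shorter (fun i : FNode n => adjSwap i.1)
    (fun i : FNode n => adjSwap i.1) (fun i => Equiv.swap_mul_self _ _)
    (fun u i => u (nxt i.1) < u i.1)
    (fun i => by have := i.val_nxt; simp only [Equiv.Perm.one_apply, Fin.lt_def]; omega)
    (fun u i j hu hju => by
      have hne : u i.1 ≠ u (nxt i.1) := fun e => by
        have := congrArg Fin.val (u.injective e)
        rw [i.val_nxt] at this
        omega
      have hlt : u i.1 < u (nxt i.1) := lt_of_le_of_ne (not_lt.mp hu) hne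
      have key : u i.1 = j.1 ∧ u (nxt i.1) = nxt j.1 := by
        by_contra hc
        exact lt_asymm hju (adjSwap_lt_adjSwap j hlt hc)
      simp only [adjSwap]
      rw [Equiv.mul_swap_eq_swap_mul, key.1, key.2])
    l i (by rw [hl]; exact h)
  rw [hl] at h2
  have h3 : permLength (σ * adjSwap i.1) ≤ l'.length := Nat.sInf_le ⟨l', h2, rfl⟩
  omega

variable {r : ℕ} (μ : RComp r n)

lemma chi1_blk (a : Fin r) (i : Fin (μ.1 a)) : chi1 μ (blk μ ⟨a, i⟩) = a := by
  simp [chi1]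

lemma blk_val (a : Fin r) (i : Fin (μ.1 a)) : ((blk μ ⟨a, i⟩ : Fin n) : ℕ) =
    ∑ b : Fin a, μ.1 (Fin.castLE a.2.le b) + i := by
  simp [blk, finSigmaFinEquiv_apply]

lemma exists_blk {a : Fin r} {j : Fin n} (h : chi1 μ j = a) : ∃ i, blk μ ⟨a, i⟩ = j := by
  subst h
  exact ⟨((blk μ).symm j).2, (blk μ).apply_symm_apply j⟩

lemma blk_injective (a : Fin r) : Function.Injective fun i : Fin (μ.1 a) => blk μ ⟨a, i⟩ := by
  intro i j h
  simpa using (blk μ).injective h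

lemma blockEquiv_val (a : Fin r) (i : Fin (μ.1 a)) :
    ((blockEquiv μ a i : {j // chi1 μ j = a}) : Fin n) = blk μ ⟨a, i⟩ := rfl

variable {μ}

/-- Otherwise the transposition of these two positions, which lies in the Young subgroup, would give
a shorter element of the same coset. -/
lemma MinRep.lt_nxt (π : MinRep μ) {i : FNode n} (h : chi1 μ i.1 = chi1 μ (nxt i.1)) :
    π.1 i.1 < π.1 (nxt i.1) := by
  have hne : π.1 i.1 ≠ π.1 (nxt i.1) := fun e => by
    have := congrArg Fin.val (π.1.injective e)
    rw [i.val_nxt] at this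
    omega
  refine lt_of_le_of_ne (not_lt.mp fun hlt => ?_) hne
  refine (permLength_mul_adjSwap_lt hlt).not_ge (π.2 _ ?_)
  change Chi.act _ _ = _
  funext j
  rw [Chi.act, adjSwap, Equiv.swap_inv, Equiv.swap_apply_def]
  split_ifs with h1 h2
  · rw [h1, h]
  · rw [h2, h]
  · rfl

lemma MinRep.strictMono_blk (π : MinRep μ) (a : Fin r) :
    StrictMono fun i : Fin (μ.1 a) => π.1 (blk μ ⟨a, i⟩) := by
  have step : ∀ (k : ℕ) (hk : k + 1 < μ.1 a),
      π.1 (blk μ ⟨a, ⟨k, by omega⟩⟩) < π.1 (blk μ ⟨a, ⟨k + 1, hk⟩⟩) := by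
    intro k hk
    have h1 : ((blk μ ⟨a, ⟨k, by omega⟩⟩ : Fin n) : ℕ) =
      ∑ b : Fin a, μ.1 (Fin.castLE a.2.le b) + k := blk_val μ a ⟨k, by omega⟩
    have h2 : ((blk μ ⟨a, ⟨k + 1, hk⟩⟩ : Fin n) : ℕ) =
      ∑ b : Fin a, μ.1 (Fin.castLE a.2.le b) + (k + 1) := blk_val μ a ⟨k + 1, hk⟩
    have h3 := (blk μ ⟨a, ⟨k + 1, hk⟩⟩).2
    let i : FNode n := ⟨blk μ ⟨a, ⟨k, by omega⟩⟩, by omega⟩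
    have e : nxt i.1 = blk μ ⟨a, ⟨k + 1, hk⟩⟩ := by
      apply Fin.ext
      rw [i.val_nxt, h2, h1, add_assoc]
    rw [← e]
    exact π.lt_nxt (i := i) (by rw [e, chi1_blk, chi1_blk])
  have key : ∀ (d i : ℕ) (h : i + d + 1 < μ.1 a),
      π.1 (blk μ ⟨a, ⟨i, by omega⟩⟩) < π.1 (blk μ ⟨a, ⟨i + d + 1, h⟩⟩) := by
    intro d i h
    induction d with
    | zero => exact step i h
    | succ d ih => exact (ih (by omega)).trans (step (i + d + 1) h)
  rintro ⟨i, hi⟩ ⟨j, hj⟩ hij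
  obtain ⟨d, rfl⟩ := Nat.exists_eq_add_of_lt (show i < j from hij)
  exact key d i hj

lemma Chi.comp_act (σ : Equiv.Perm (Fin n)) (c : Chi r n) : (Chi.act σ c).comp = c.comp := by
  funext a
  refine Finset.card_equiv σ⁻¹ fun j => ?_
  rw [Finset.mem_filter, Finset.mem_filter]
  simp [Chi.act]

lemma comp_chi1 (μ : RComp r n) : (chi1 μ).comp = μ.1 := by
  funext a
  rw [Chi.comp, ← Fintype.card_subtype, ← Fintype.card_congr (blockEquiv μ a), Fintype.card_fin]

lemma exists_act_eq {c : Chi r n} (h : c.comp = μ.1) :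
    ∃ σ : Equiv.Perm (Fin n), Chi.act σ (chi1 μ) = c := by
  have e : ∀ a, Nonempty ({j // chi1 μ j = a} ≃ {j // c j = a}) := by
    intro a
    refine Fintype.card_eq.mp ?_
    rw [Fintype.card_subtype, Fintype.card_subtype]
    change (chi1 μ).comp a = c.comp a
    rw [h, comp_chi1]
  refine ⟨Equiv.ofFiberEquiv fun a => (e a).some, ?_⟩
  funext j
  obtain ⟨i, rfl⟩ := (Equiv.ofFiberEquiv fun a => (e a).some).surjective j
  rw [Chi.act, Equiv.Perm.inv_def, Equiv.symm_apply_apply]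
  exact (Equiv.ofFiberEquiv_map (fun a => (e a).some) i).symm

/-- The permutations carrying $\chi_1^\mu$ to $\chi$ form one left coset of its stabilizer; a
shortest one is a minimal representative. -/
lemma exists_minRep {c : Chi r n} (h : c.comp = μ.1) :
    ∃ π : MinRep μ, Chi.act π.1 (chi1 μ) = c := by
  obtain ⟨σ, hσ, hmin⟩ := WellFounded.has_min
    (measure fun σ : Equiv.Perm (Fin n) => permLength σ).wf {σ | Chi.act σ (chi1 μ) = c}
    (exists_act_eq h)
  refine ⟨⟨σ, fun τ hτ => not_lt.mp (hmin (σ * τ) ?_)⟩, hσ⟩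
  change Chi.act _ _ = _
  rw [Chi.act_mul, show Chi.act τ (chi1 μ) = chi1 μ from hτ]
  exact hσ

/-- The character determines the image of each block, and an increasing map on a block is determined
by its image. -/
lemma minRep_injective : Function.Injective fun π : MinRep μ => Chi.act π.1 (chi1 μ) := by
  intro π π' h
  have hrange : ∀ (π : MinRep μ) (a : Fin r),
      Set.range (fun i : Fin (μ.1 a) => π.1 (blk μ ⟨a, i⟩)) =
      {j | Chi.act π.1 (chi1 μ) j = a} := by
    intro π a
    ext j
    constructor
    · rintro ⟨i, rfl⟩
      change chi1 μ (π.1⁻¹ (π.1 (blk μ ⟨a, i⟩))) = a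
      rw [Equiv.Perm.inv_def, Equiv.symm_apply_apply, chi1_blk]
    · intro hj
      obtain ⟨i, hi⟩ := exists_blk μ (show chi1 μ (π.1⁻¹ j) = a from hj)
      exact ⟨i, by simp only [hi, Equiv.Perm.inv_def, Equiv.apply_symm_apply]⟩
  apply Subtype.ext
  ext j
  obtain ⟨i, hi⟩ := exists_blk μ (a := chi1 μ j) rfl
  have := ((π.strictMono_blk _).range_inj (π'.strictMono_blk (chi1 μ j))).mp (by
    rw [hrange, hrange]
    simp only at h
    rw [h])
  rw [← hi]
  exact congrArg Fin.val (congrFun this i)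

/-! ### The blocks of points -/

/-- The points of the affine Weyl group of the block `a`, among those of the whole group. -/
def emb (μ : RComp r n) (a : Fin r) (x : Pt (μ.1 a)) : Pt n := Pt.mk x.lev (blk μ ⟨a, x.pos⟩)

@[simp] lemma lev_emb (a : Fin r) (x : Pt (μ.1 a)) : (emb μ a x).lev = x.lev := rfl

@[simp] lemma pos_emb (a : Fin r) (x : Pt (μ.1 a)) : (emb μ a x).pos = blk μ ⟨a, x.pos⟩ := rfl

lemma emb_strictMono (a : Fin r) : StrictMono (emb μ a) := by
  intro x y h
  rw [lt_iff] at h ⊢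
  rw [lev_emb, lev_emb, pos_emb, pos_emb, Fin.lt_def, blk_val, blk_val]
  rw [Fin.lt_def] at h
  omega

lemma emb_shift (a : Fin r) (k : ℤ) (x : Pt (μ.1 a)) : emb μ a (shift k x) = shift k (emb μ a x) :=
  rfl

lemma exists_emb {a : Fin r} {y : Pt n} (h : chi1 μ y.pos = a) : ∃ x, emb μ a x = y := by
  obtain ⟨i, hi⟩ := exists_blk μ h
  exact ⟨Pt.mk y.lev i, Pt.ext rfl hi⟩

lemma chi1_emb (a : Fin r) (x : Pt (μ.1 a)) : chi1 μ (emb μ a x).pos = a := chi1_blk μ a _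

/-- Equivariance of the block embedding. As the action is faithful, it characterizes `affYoungPart`
and gives its multiplicativity and joint injectivity. -/
lemma smul_emb (v : affYoung μ) (a : Fin r) (x : Pt (μ.1 a)) :
    v.1 • emb μ a x = emb μ a (affYoungPart v a • x) := by
  have h : v.1.right (blk μ ⟨a, x.pos⟩) = blk μ ⟨a, (affYoungPart v a).right x.pos⟩ := by
    rw [← blockEquiv_val, ← blockEquiv_val]
    simp only [affYoungPart, Equiv.permCongr_symm, Equiv.permCongr_apply, Equiv.symm_symm,
      Equiv.apply_symm_apply]
    rfl
  apply Pt.ext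
  · rw [lev_smul, lev_emb, lev_emb, lev_smul, pos_emb, h]
    rfl
  · rw [pos_smul, pos_emb, pos_emb, pos_smul, h]

lemma affYoungPart_mul (u v : affYoung μ) (a : Fin r) :
    affYoungPart (u * v) a = affYoungPart u a * affYoungPart v a := by
  rw [smul_eq_iff]
  intro x
  apply (emb_strictMono a).injective
  rw [mul_smul, ← smul_emb, ← smul_emb, ← smul_emb, ← mul_smul]
  rfl

lemma affYoung_ext {u v : affYoung μ} (h : ∀ a, affYoungPart u a = affYoungPart v a) : u = v := by
  apply Subtype.ext
  rw [smul_eq_iff]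
  intro y
  obtain ⟨x, hx⟩ := exists_emb (μ := μ) (y := y) rfl
  rw [← hx, smul_emb, smul_emb, h]

/-- The elements of the blocks can be chosen independently. -/
lemma exists_affYoung (f : ∀ a, EW (μ.1 a)) : ∃ v : affYoung μ, ∀ a, affYoungPart v a = f a := by
  let σ : Equiv.Perm (Fin n) :=
    (blk μ).permCongr (Equiv.sigmaCongrRight fun a => (f a).right)
  have hσ : ∀ a i, σ (blk μ ⟨a, i⟩) = blk μ ⟨a, (f a).right i⟩ := fun a i => by
    simp [σ, Equiv.permCongr_apply]
  let v : EW n := ⟨Multiplicative.ofAdd fun j =>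
    (f ((blk μ).symm j).1).left.toAdd ((blk μ).symm j).2, σ⟩
  have hv : v ∈ affYoung μ := by
    change Chi.act σ (chi1 μ) = chi1 μ
    funext j
    obtain ⟨j, rfl⟩ := σ.surjective j
    obtain ⟨i, hi⟩ := exists_blk μ (a := chi1 μ j) rfl
    rw [Chi.act, Equiv.Perm.inv_def, Equiv.symm_apply_apply, ← hi, hσ, chi1_blk, chi1_blk]
  refine ⟨⟨v, hv⟩, fun a => ?_⟩
  rw [smul_eq_iff]
  intro x
  apply (emb_strictMono a).injective
  rw [← smul_emb]
  apply Pt.ext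
  · rw [lev_emb, lev_smul, lev_smul, pos_emb, lev_emb]
    change _ - (f ((blk μ).symm (σ (blk μ ⟨a, x.pos⟩))).1).left.toAdd
      ((blk μ).symm (σ (blk μ ⟨a, x.pos⟩))).2 = _
    rw [hσ, Equiv.symm_apply_apply]
  · rw [pos_emb, pos_smul, pos_smul, pos_emb]
    exact hσ a x.pos

/-! ### Conjugation by minimal coset representatives -/

/-- A permutation, as an element of the extended affine Weyl group. -/
abbrev EW.ofPerm (π : Equiv.Perm (Fin n)) : EW n := SemidirectProduct.inr π

lemma lev_ofPerm_smul (π : Equiv.Perm (Fin n)) (x : Pt n) : (ofPerm π • x).lev = x.lev := by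
  rw [lev_smul]; simp

lemma pos_ofPerm_smul (π : Equiv.Perm (Fin n)) (x : Pt n) : (ofPerm π • x).pos = π x.pos := by
  rw [pos_smul]; simp

/-- Levels are untouched and $\pi$ increases on the block, so block $a$ is identified in order with
the points of colour $a$ for $\pi\chi_1^\mu$. -/
lemma MinRep.smul_emb_strictMono (π : MinRep μ) (a : Fin r) :
    StrictMono fun x : Pt (μ.1 a) => ofPerm π.1 • emb μ a x := by
  intro x y h
  rw [lt_iff] at h
  simp only
  rw [lt_iff, lev_ofPerm_smul, lev_ofPerm_smul, pos_ofPerm_smul, pos_ofPerm_smul]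
  exact h.imp_right fun h => ⟨h.1, π.strictMono_blk a h.2⟩

/-- `π_k⁻¹ w π_j`, as an element of the stabilizer of `χ_1^μ`. -/
def conj {πj πk : MinRep μ} {w : EW n}
    (h : Chi.act w.right (Chi.act πj.1 (chi1 μ)) = Chi.act πk.1 (chi1 μ)) : affYoung μ :=
  ⟨(SemidirectProduct.inr πk.1)⁻¹ * w * SemidirectProduct.inr πj.1, conj_mem h⟩

lemma ofPerm_smul_emb_conj {πj πk : MinRep μ} {w : EW n}
    (h : Chi.act w.right (Chi.act πj.1 (chi1 μ)) = Chi.act πk.1 (chi1 μ)) (a : Fin r)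
    (x : Pt (μ.1 a)) : ofPerm πk.1 • emb μ a (affYoungPart (conj h) a • x) =
      w • ofPerm πj.1 • emb μ a x := by
  rw [← smul_emb]
  change ofPerm πk.1 • ((ofPerm πk.1)⁻¹ * w * ofPerm πj.1) • emb μ a x = _
  rw [mul_smul, mul_smul, smul_inv_smul]

lemma conj_smul_lt {πj πk : MinRep μ} {w : EW n}
    (h : Chi.act w.right (Chi.act πj.1 (chi1 μ)) = Chi.act πk.1 (chi1 μ)) {a : Fin r}
    {x y : Pt (μ.1 a)} : affYoungPart (conj h) a • x < affYoungPart (conj h) a • y ↔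
      w • ofPerm πj.1 • emb μ a x < w • ofPerm πj.1 • emb μ a y := by
  rw [← ofPerm_smul_emb_conj h, ← ofPerm_smul_emb_conj h]
  exact (πk.smul_emb_strictMono a).lt_iff_lt.symm

lemma len_conj_of_strictMono {πj πk : MinRep μ} {w : EW n}
    (h : Chi.act w.right (Chi.act πj.1 (chi1 μ)) = Chi.act πk.1 (chi1 μ))
    (hw : StrictMono fun x : Pt n => w • x) (a : Fin r) : len (affYoungPart (conj h) a) = 0 :=
  len_eq_zero_of_strictMono fun _ _ hxy => (conj_smul_lt h).mpr
    (hw (πj.smul_emb_strictMono a hxy))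

lemma act_ofPerm_smul_emb (π : MinRep μ) (a : Fin r) (x : Pt (μ.1 a)) :
    Chi.act π.1 (chi1 μ) (ofPerm π.1 • emb μ a x).pos = a := by
  rw [pos_ofPerm_smul, Chi.act, Equiv.Perm.inv_def, Equiv.symm_apply_apply, chi1_emb]

/-- The only pairs reversed by $s_i$ have two different colours, so within one colour the order is
preserved. -/
lemma len_conj_s_of_ne {πj πk : MinRep μ} {i : Node n}
    (h : Chi.act (s i).right (Chi.act πj.1 (chi1 μ)) = Chi.act πk.1 (chi1 μ))
    (hne : Chi.act πj.1 (chi1 μ) i.1 ≠ Chi.act πj.1 (chi1 μ) (nxt i.1)) (a : Fin r) :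
    len (affYoungPart (conj h) a) = 0 := by
  refine len_eq_zero_of_strictMono fun x y hxy => (conj_smul_lt h).mpr
    (s_smul_lt i (πj.smul_emb_strictMono a hxy) fun hc => hne ?_)
  rw [← hc.1, ← pos_next, ← hc.2, act_ofPerm_smul_emb, act_ofPerm_smul_emb]

/-- The embedding reaches every point of colour $a$ in order, so two neighbours of that colour come
from neighbours in the block; the position of the lower one is the label sought. -/
lemma exists_node {π : MinRep μ} {i : Node n} {a : Fin r} (h : Chi.act π.1 (chi1 μ) i.1 = a)
    (h' : Chi.act π.1 (chi1 μ) (nxt i.1) = a) :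
    ∃ i' : Node (μ.1 a), ∀ x : Pt (μ.1 a), x.pos = i'.1 →
      (ofPerm π.1 • emb μ a x).pos = i.1 ∧
      ofPerm π.1 • emb μ a (next x) = next (ofPerm π.1 • emb μ a x) := by
  have hsurj : ∀ y : Pt n, Chi.act π.1 (chi1 μ) y.pos = a →
      ∃ x, ofPerm π.1 • emb μ a x = y := by
    intro y hy
    obtain ⟨x, hx⟩ := exists_emb (μ := μ) (a := a) (y := (ofPerm π.1)⁻¹ • y) (by
      rw [pos_smul]; simpa [Chi.act] using hy)
    exact ⟨x, by rw [hx, smul_inv_smul]⟩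
  obtain ⟨x, hx⟩ := hsurj (Pt.mk 0 i.1) h
  obtain ⟨y, hy⟩ := hsurj (next (Pt.mk 0 i.1)) (by rwa [pos_next])
  have hxy : x < y := by
    rw [← (π.smul_emb_strictMono a).lt_iff_lt]
    simp only [hx, hy]
    exact lt_next _
  have hy' : y = next x := by
    refine le_antisymm (not_lt.mp fun hlt => ?_) (next_le hxy)
    have h1 := π.smul_emb_strictMono a (lt_next x)
    have h2 := π.smul_emb_strictMono a hlt
    simp only [hx, hy] at h1 h2
    exact (next_le h1).not_gt h2
  -- In a block with a single position the two preimages would share it, whereas their images lie in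
  -- different positions.
  have h2 : 2 ≤ μ.1 a := by
    by_contra hc
    have e : x.pos = y.pos := Fin.ext (by have := x.pos.2; have := y.pos.2; omega)
    have e1 := congrArg pos hx
    have e2 := congrArg pos hy
    rw [pos_ofPerm_smul, pos_emb] at e1 e2
    rw [← e, e1, pos_next] at e2
    exact nxt_ne i.2 e2.symm
  refine ⟨⟨x.pos, h2⟩, fun z hz => ?_⟩
  have e : z = shift (z.lev - x.lev) x := by
    apply Pt.ext
    · rw [lev_shift]; ring
    · rw [pos_shift]; exact hz
  rw [e, next_shift, emb_shift, emb_shift, smul_shift, smul_shift, next_shift, pos_shift, hx,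
    ← hy', hy]
  exact ⟨rfl, rfl⟩

/-- The reflection $s_i$ exchanges neighbours of colour $a$ and fixes all points of other colours.
Since the pair at $i'$ is carried to a pair at $i$, descents on the two sides test the same
inequality. -/
lemma conj_s_of_eq {π : MinRep μ} {i : Node n} {a : Fin r} (h : Chi.act π.1 (chi1 μ) i.1 = a)
    (h' : Chi.act π.1 (chi1 μ) (nxt i.1) = a)
    (hs : Chi.act (s i).right (Chi.act π.1 (chi1 μ)) = Chi.act π.1 (chi1 μ)) :
    ∃ i' : Node (μ.1 a), affYoungPart (conj hs) a = s i' ∧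
      (∀ b, b ≠ a → affYoungPart (conj hs) b = 1) ∧
      ∀ {πk : MinRep μ} {w : EW n}
        (hw : Chi.act w.right (Chi.act π.1 (chi1 μ)) = Chi.act πk.1 (chi1 μ)),
        Desc (affYoungPart (conj hw) a) i' ↔ Desc w i := by
  obtain ⟨i', hi'⟩ := exists_node h h'
  refine ⟨i', ?_, ?_, ?_⟩
  · rw [smul_eq_iff]
    intro x
    apply (π.smul_emb_strictMono a).injective
    simp only
    rw [ofPerm_smul_emb_conj hs]
    by_cases hx : x.pos = i'.1
    · rw [s_smul_of_pos_eq _ hx, s_smul_of_pos_eq _ (hi' x hx).1, (hi' x hx).2]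
    by_cases hx' : x.pos = nxt i'.1
    · obtain ⟨y, hy, rfl⟩ := exists_next_eq hx'
      rw [s_smul_next _ hy, (hi' y hy).2, s_smul_next _ (hi' y hy).1]
    · have hz := hi' (Pt.mk 0 i'.1) rfl
      have hz1 := hz.1
      have hz2 := congrArg pos hz.2
      rw [pos_next, hz1] at hz2
      rw [pos_ofPerm_smul, pos_emb] at hz1 hz2
      rw [s_smul_of_ne _ hx hx', s_smul_of_ne]
      · rw [pos_ofPerm_smul, pos_emb, ← hz1]
        exact fun e => hx (blk_injective μ a (π.1.injective e))
      · rw [pos_ofPerm_smul, pos_emb, ← hz2, pos_next]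
        exact fun e => hx' (blk_injective μ a (π.1.injective e))
  · intro b hb
    rw [smul_eq_iff]
    intro x
    apply (π.smul_emb_strictMono b).injective
    simp only
    have hx := act_ofPerm_smul_emb π b x
    rw [ofPerm_smul_emb_conj hs, one_smul, s_smul_of_ne]
    · intro e
      rw [e, h] at hx
      exact hb hx.symm
    · intro e
      rw [e, h'] at hx
      exact hb hx.symm
  · intro πk w hw
    have hz := hi' (Pt.mk 0 i'.1) rfl
    rw [Desc, conj_smul_lt hw, hz.2, desc_iff hz.1]

end MinReps

/-! ### The standard basis of `Ĥ^μ` and its multiplication rules -/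

section HMuBasis

variable {K : Type*} [Field K] (q : K) {r n : ℕ} {μ : RComp r n}

/-- `ℤ ^ n ⋊ 𝔖^μ` is the product of the extended affine Weyl groups of the blocks. -/
noncomputable def affYoungEquiv (μ : RComp r n) : affYoung μ ≃ ∀ a, EW (μ.1 a) :=
  Equiv.ofBijective (fun v a => affYoungPart v a)
    ⟨fun _ _ h => affYoung_ext fun a => congrFun h a, fun f => by
      obtain ⟨v, hv⟩ := exists_affYoung f
      exact ⟨v, funext hv⟩⟩

/-- The basis `S_w` of `Ĥ^μ`. -/
noncomputable def HMu.basis (μ : RComp r n) : Module.Basis (affYoung μ) K (HMu K q μ) :=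
  (Basis.piTensorProduct fun a => AffHecke.basis q (n := μ.1 a)).reindex (affYoungEquiv μ).symm

lemma HMu.basis_apply (v : affYoung μ) : HMu.basis q μ v = HMu.std q v := by
  rw [HMu.basis, Module.Basis.reindex_apply, Basis.piTensorProduct_apply, HMu.std]
  simp only [AffHecke.basis_apply]
  rfl

lemma HMu.std_mul_std (u v : affYoung μ) : HMu.std q u * HMu.std q v =
    PiTensorProduct.tprod K fun a =>
      AffHecke.std q (affYoungPart u a) * AffHecke.std q (affYoungPart v a) := by
  rw [HMu.std, HMu.std, PiTensorProduct.tprod_mul_tprod]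
  rfl

lemma HMu.std_mul_of_len_eq_zero (u v : affYoung μ) (h : ∀ a, len (affYoungPart v a) = 0) :
    HMu.std q u * HMu.std q v = HMu.std q (u * v) := by
  rw [HMu.std_mul_std, HMu.std]
  congr 1
  funext a
  rw [AffHecke.std_mul_of_len_eq_zero q _ (h a), affYoungPart_mul]

lemma HMu.std_mul_of_not_desc (u v : affYoung μ) {a : Fin r} {i : Node (μ.1 a)}
    (h : affYoungPart v a = s i) (h' : ∀ b, b ≠ a → affYoungPart v b = 1)
    (hd : ¬ Desc (affYoungPart u a) i) : HMu.std q u * HMu.std q v = HMu.std q (u * v) := by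
  rw [HMu.std_mul_std, HMu.std]
  congr 1
  funext b
  rw [affYoungPart_mul]
  by_cases hb : b = a
  · subst hb
    rw [h, AffHecke.std_s, AffHecke.std_mul_S_of_not_desc q hd]
  · rw [h' b hb, AffHecke.std_one, mul_one, mul_one]

/-- Only the tensor factor $a$ changes; the quadratic relation there is expanded by multilinearity.
-/
lemma HMu.std_mul_of_desc (u v : affYoung μ) {a : Fin r} {i : Node (μ.1 a)}
    (h : affYoungPart v a = s i) (h' : ∀ b, b ≠ a → affYoungPart v b = 1)
    (hd : Desc (affYoungPart u a) i) :
    HMu.std q u * HMu.std q v = HMu.std q (u * v) + (q - q⁻¹) • HMu.std q u := by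
  have e1 : (fun b => AffHecke.std q (affYoungPart u b) * AffHecke.std q (affYoungPart v b)) =
      Function.update (fun b => AffHecke.std q (affYoungPart u b)) a
        (AffHecke.std q (affYoungPart (u * v) a) +
          (q - q⁻¹) • AffHecke.std q (affYoungPart u a)) := by
    funext b
    by_cases hb : b = a
    · subst hb
      rw [Function.update_self, affYoungPart_mul, h, AffHecke.std_s,
        AffHecke.std_mul_S_of_desc q hd]
    · rw [Function.update_of_ne hb, h' b hb, AffHecke.std_one, mul_one]
  have e2 : Function.update (fun b => AffHecke.std q (affYoungPart u b)) a
      (AffHecke.std q (affYoungPart (u * v) a)) =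
      fun b => AffHecke.std q (affYoungPart (u * v) b) := by
    funext b
    by_cases hb : b = a
    · subst hb
      rw [Function.update_self]
    · rw [Function.update_of_ne hb, affYoungPart_mul, h' b hb, mul_one]
  rw [HMu.std_mul_std, e1, MultilinearMap.map_update_add, MultilinearMap.map_update_smul, e2,
    Function.update_eq_self]
  rfl

end HMuBasis

instance {r n : ℕ} : Finite (RComp r n) := by
  refine Finite.of_injective (β := Fin r → Fin (n + 1)) (fun μ a => ⟨μ.1 a, ?_⟩) fun μ ν h => ?_
  · have := Finset.single_le_sum (f := μ.1) (fun _ _ => Nat.zero_le _) (Finset.mem_univ a)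
    rw [μ.2] at this
    omega
  · apply Subtype.ext
    funext a
    exact congrArg Fin.val (congrFun h a)

/-! ### The isomorphism with the matrix algebras -/

section MatrixIso

variable {K : Type*} [Field K] (q : K) {r n : ℕ} (ζ : Fin r ≃ rootsOfUnity r K)
  (π : ∀ μ : RComp r n, Fin (numMinRep μ) ≃ MinRep μ)

/-- The character `χ_k^μ`. -/
def chiRep (μ : RComp r n) (k : Fin (numMinRep μ)) : Chi r n := Chi.act (π μ k).1 (chi1 μ)

/-- The algebra `⨁_μ Mat(Ĥ^μ)`. -/
abbrev MatSum (K : Type*) [Field K] (q : K) (r n : ℕ) :=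
  ∀ μ : RComp r n, Matrix (Fin (numMinRep μ)) (Fin (numMinRep μ)) (HMu K q μ)

/-- Labels of the basis of `⨁_μ Mat(Ĥ^μ)`. -/
abbrev MatIdx (r n : ℕ) :=
  Σ μ : RComp r n, Fin (numMinRep μ) × Fin (numMinRep μ) × affYoung μ

/-- The basis `S_v M_{k,j}` of `⨁_μ Mat(Ĥ^μ)`. -/
noncomputable def matBasis : Module.Basis (MatIdx r n) K (MatSum K q r n) :=
  letI := Fintype.ofFinite (RComp r n)
  Pi.basis fun μ => (HMu.basis q μ).matrix _ _

lemma matBasis_apply (μ : RComp r n) (k j : Fin (numMinRep μ)) (v : affYoung μ) :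
    matBasis q ⟨μ, k, j, v⟩ = Pi.single μ (Matrix.single k j (HMu.std q v)) := by
  let _ := Fintype.ofFinite (RComp r n)
  rw [matBasis, Pi.basis_apply, Module.Basis.matrix_apply, HMu.basis_apply]

lemma comp_chiRep (μ : RComp r n) (k : Fin (numMinRep μ)) : (chiRep π μ k).comp = μ.1 := by
  rw [chiRep, Chi.comp_act, comp_chi1]

lemma chiRep_injective (μ : RComp r n) : Function.Injective (chiRep π μ) :=
  fun _ _ h => (π μ).injective (minRep_injective h)

lemma exists_chiRep {c : Chi r n} {μ : RComp r n} (h : c.comp = μ.1) : ∃ k, chiRep π μ k = c := by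
  obtain ⟨σ, hσ⟩ := exists_minRep h
  obtain ⟨k, rfl⟩ := (π μ).surjective σ
  exact ⟨k, hσ⟩

/-- The composition of a character. -/
def Chi.rcomp (c : Chi r n) : RComp r n := ⟨c.comp, by
  have := Finset.card_eq_sum_card_fiberwise (f := c) (s := Finset.univ) (t := Finset.univ)
    (fun _ _ => by simp)
  simpa [Chi.comp] using this.symm⟩

/-- `(μ, k, j, v) ↦ (χ_k^μ, π_k v π_j⁻¹)`. -/
def idxMap (p : MatIdx r n) : Chi r n × EW n :=
  (chiRep π p.1 p.2.1,
    ofPerm (π p.1 p.2.1).1 * p.2.2.2.1 * (ofPerm (π p.1 p.2.2.1).1)⁻¹)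

lemma act_idxMap (μ : RComp r n) (k j : Fin (numMinRep μ)) (v : affYoung μ) :
    Chi.act (ofPerm (π μ k).1 * v.1 * (ofPerm (π μ j).1)⁻¹).right (chiRep π μ j) =
      chiRep π μ k := by
  have hv : Chi.act v.1.right (chi1 μ) = chi1 μ := v.2
  simp only [SemidirectProduct.mul_right, SemidirectProduct.inv_right,
    SemidirectProduct.right_inr, Chi.act_mul, chiRep]
  rw [Chi.act_inv (rfl : Chi.act (π μ j).1 (chi1 μ) = _), hv]

lemma idxMap_conj {μ : RComp r n} {k j : Fin (numMinRep μ)} {w : EW n}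
    (h : Chi.act w.right (chiRep π μ j) = chiRep π μ k) :
    idxMap π ⟨μ, k, j, conj h⟩ = (chiRep π μ k, w) := by
  simp only [idxMap, conj]
  congr 1
  group

/-- From $(\chi,w)$ one recovers $\mu$ as the composition of $\chi$, then $k$ and $j$ from
$\chi=\chi_k^\mu$ and $w^{-1}\chi=\chi_j^\mu$, and finally $v=\pi_k^{-1}w\pi_j$. -/
lemma idxMap_bijective : Function.Bijective (idxMap π) := by
  constructor
  · rintro ⟨μ, k, j, v⟩ ⟨μ', k', j', v'⟩ h
    have h1 : chiRep π μ k = chiRep π μ' k' := congrArg Prod.fst h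
    obtain rfl : μ = μ' := by
      apply Subtype.ext
      rw [← comp_chiRep π μ k, h1, comp_chiRep]
    obtain rfl : k = k' := chiRep_injective π μ h1
    have h2 : ofPerm (π μ k).1 * v.1 * (ofPerm (π μ j).1)⁻¹ =
      ofPerm (π μ k).1 * v'.1 * (ofPerm (π μ j').1)⁻¹ := congrArg Prod.snd h
    have h3 := act_idxMap π μ k j v
    have h4 := act_idxMap π μ k j' v'
    rw [← h2] at h4
    obtain rfl : j = j' := chiRep_injective π μ <| by
      rw [← Chi.act_inv h3, ← Chi.act_inv h4]
    rw [mul_left_inj, mul_right_inj] at h2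
    rw [Subtype.ext h2]
  · rintro ⟨c, w⟩
    obtain ⟨k, hk⟩ := exists_chiRep π (c := c) (μ := c.rcomp) rfl
    obtain ⟨j, hj⟩ := exists_chiRep π (c := Chi.act w.right⁻¹ c) (μ := c.rcomp) (Chi.comp_act _ _)
    have h : Chi.act w.right (chiRep π c.rcomp j) = chiRep π c.rcomp k := by
      rw [hj, hk, ← Chi.act_mul, mul_inv_cancel, Chi.act_one]
    exact ⟨⟨c.rcomp, k, j, conj h⟩, by rw [idxMap_conj π h, hk]⟩

variable (hn : n ≠ 0) (hr : (r : K) ≠ 0)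

/-- The linear isomorphism matching the standard bases. -/
noncomputable def linIso : IM K q r n ≃ₗ[K] MatSum K q r n :=
  (IM.basis q ζ hn hr).equiv (matBasis q) (Equiv.ofBijective _ (idxMap_bijective π)).symm

lemma linIso_idxMap (p : MatIdx r n) :
    linIso q ζ π hn hr (IM.bas q ζ (idxMap π p)) = matBasis q p := by
  rw [linIso, ← IM.basis_apply q ζ hn hr, Module.Basis.equiv_apply]
  congr 1
  exact Equiv.ofBijective_symm_apply_apply _ _ p

lemma linIso_bas {μ : RComp r n} {k j : Fin (numMinRep μ)} {w : EW n}
    (h : Chi.act w.right (chiRep π μ j) = chiRep π μ k) :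
    linIso q ζ π hn hr (IM.bas q ζ (chiRep π μ k, w)) =
      Pi.single μ (Matrix.single k j (HMu.std q (conj h))) := by
  rw [← idxMap_conj π h, linIso_idxMap, matBasis_apply]

/-- Every label is of the form `(χ_k^μ, w)`, with `w χ_j^μ = χ_k^μ`. -/
lemma exists_label (c : Chi r n) (w : EW n) : ∃ (μ : RComp r n) (k j : Fin (numMinRep μ)),
    chiRep π μ k = c ∧ Chi.act w.right (chiRep π μ j) = chiRep π μ k := by
  obtain ⟨k, hk⟩ := exists_chiRep π (c := c) (μ := c.rcomp) rfl
  obtain ⟨j, hj⟩ := exists_chiRep π (c := Chi.act w.right⁻¹ c) (μ := c.rcomp) (Chi.comp_act _ _)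
  refine ⟨c.rcomp, k, j, hk, ?_⟩
  rw [hj, hk, ← Chi.act_mul, mul_inv_cancel, Chi.act_one]

lemma bas_mul_bas (hn : n ≠ 0) (hr : (r : K) ≠ 0) {μ : RComp r n} {k j : Fin (numMinRep μ)}
    {w : EW n}
    (h : Chi.act w.right (chiRep π μ j) = chiRep π μ k) (c : Chi r n) (g : EW n) :
    IM.bas q ζ (chiRep π μ k, w) * IM.bas q ζ (c, g) =
      if c = chiRep π μ j then IM.bas q ζ (chiRep π μ k, w) * IM.std q r g else 0 := by
  rw [IM.bas.eq_1 q ζ (c, g), ← mul_assoc, IM.bas_mul_idemE q ζ hn hr, Chi.act_inv h]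
  split_ifs <;> simp

/-- Elements by which the linear isomorphism is right multiplicative. -/
noncomputable def multSubmodule : Submodule K (IM K q r n) where
  carrier := {y | ∀ x, linIso q ζ π hn hr (x * y) = linIso q ζ π hn hr x * linIso q ζ π hn hr y}
  add_mem' := fun {a b} ha hb x => by rw [mul_add, map_add, ha, hb, map_add, mul_add]
  zero_mem' := fun x => by simp
  smul_mem' := fun a y hy x => by
    rw [mul_smul_comm, map_smul, hy, map_smul]
    exact (Algebra.mul_smul_comm _ _ _).symm

/-- On basis vectors both products vanish unless the column index of the left factor is the row
index of the right one, by orthogonality of the $E_\chi$ and of the matrix units. Only composable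
pairs remain to be checked. -/
lemma bas_mem_multSubmodule {g : EW n}
    (hg : ∀ {μ : RComp r n} {k j i : Fin (numMinRep μ)} {w : EW n}
      (h : Chi.act w.right (chiRep π μ j) = chiRep π μ k)
      (h' : Chi.act g.right (chiRep π μ i) = chiRep π μ j),
      linIso q ζ π hn hr (IM.bas q ζ (chiRep π μ k, w) * IM.std q r g) =
        Pi.single μ (Matrix.single k i (HMu.std q (conj h) * HMu.std q (conj h')))) (c : Chi r n) :
    IM.bas q ζ (c, g) ∈ multSubmodule q ζ π hn hr := by
  intro x
  have hx : x ∈ Submodule.span K (Set.range (IM.bas q ζ : Chi r n × EW n → IM K q r n)) := by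
    rw [IM.span_bas q ζ hn hr]; trivial
  induction hx using Submodule.span_induction with
  | zero => simp
  | add x y _ _ hx hy => rw [add_mul, map_add, hx, hy, map_add, add_mul]
  | smul a x _ hx =>
    rw [smul_mul_assoc, map_smul, hx, map_smul]
    exact (Algebra.smul_mul_assoc _ _ _).symm
  | mem x hx =>
    obtain ⟨⟨d, w⟩, rfl⟩ := hx
    obtain ⟨μ, k, j, rfl, h⟩ := exists_label π d w
    obtain ⟨ν, j', i, rfl, h'⟩ := exists_label π c g
    rw [bas_mul_bas q ζ π hn hr h, linIso_bas q ζ π hn hr h, linIso_bas q ζ π hn hr h']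
    by_cases hμ : ν = μ
    · subst hμ
      rw [← Pi.single_mul]
      by_cases hj : j' = j
      · subst hj
        rw [if_pos rfl, hg h h', Matrix.single_mul_single_same]
      · rw [if_neg fun e => hj (chiRep_injective π ν e), map_zero,
          Matrix.single_mul_single_of_ne _ _ _ _ (Ne.symm hj), Pi.single_zero]
    · rw [if_neg fun e => hμ (Subtype.ext ?_), map_zero]
      · symm
        funext κ
        rw [Pi.mul_apply, Pi.zero_apply]
        by_cases h1 : κ = μ
        · rw [Pi.single_eq_of_ne (i := ν) (by rw [h1]; exact Ne.symm hμ), mul_zero]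
        · rw [Pi.single_eq_of_ne (i := μ) h1, zero_mul]
      · rw [← comp_chiRep π ν j', e, comp_chiRep]

lemma conj_mul_conj {μ : RComp r n} {k j i : Fin (numMinRep μ)} {w g : EW n}
    (h : Chi.act w.right (chiRep π μ j) = chiRep π μ k)
    (h' : Chi.act g.right (chiRep π μ i) = chiRep π μ j)
    (h'' : Chi.act (w * g).right (chiRep π μ i) = chiRep π μ k) :
    conj h * conj h' = conj h'' := by
  apply Subtype.ext
  simp only [conj, Subgroup.coe_mul]
  group

lemma act_mul_right {μ : RComp r n} {k j i : Fin (numMinRep μ)} {w g : EW n}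
    (h : Chi.act w.right (chiRep π μ j) = chiRep π μ k)
    (h' : Chi.act g.right (chiRep π μ i) = chiRep π μ j) :
    Chi.act (w * g).right (chiRep π μ i) = chiRep π μ k := by
  rw [SemidirectProduct.mul_right, Chi.act_mul, h', h]

lemma bas_rho_mem (m : ℤ) (c : Chi r n) :
    IM.bas q ζ (c, rho n ^ m) ∈ multSubmodule q ζ π hn hr := by
  refine bas_mem_multSubmodule q ζ π hn hr (fun {μ k j i w} h h' => ?_) c
  rw [IM.bas_mul_of_len_eq_zero q ζ hn _ _ (IM.len_rho_zpow m),
    linIso_bas q ζ π hn hr (act_mul_right π h h'),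
    HMu.std_mul_of_len_eq_zero q _ _ (len_conj_of_strictMono h' (rho_zpow_strictMono m)),
    conj_mul_conj π h h' (act_mul_right π h h')]

/-- Two cases, according to the colours of the exchanged points: equal colours give a simple
reflection in one tensor factor, different colours an element of length $0$ in every factor. -/
lemma bas_s_mem (m : Node n) (c : Chi r n) :
    IM.bas q ζ (c, s m) ∈ multSubmodule q ζ π hn hr := by
  refine bas_mem_multSubmodule q ζ π hn hr (fun {μ k j i w} h h' => ?_) c
  have h'' := act_mul_right π h h'
  have hk : ∀ x, chiRep π μ k (w.right x) = chiRep π μ j x := fun x => by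
    rw [← h, Chi.act, Equiv.Perm.inv_def, Equiv.symm_apply_apply]
  have hj : ∀ x, chiRep π μ j x = chiRep π μ i (adjSwap m.1 x) := fun x => by
    rw [← h', Chi.act, s_right, adjSwap, Equiv.swap_inv]
  have hj1 : chiRep π μ j m.1 = chiRep π μ i (nxt m.1) := by
    rw [hj, adjSwap, Equiv.swap_apply_left]
  have hj2 : chiRep π μ j (nxt m.1) = chiRep π μ i m.1 := by
    rw [hj, adjSwap, Equiv.swap_apply_right]
  rw [IM.std_s q hn]
  by_cases hne : chiRep π μ i m.1 = chiRep π μ i (nxt m.1)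
  -- With equal colours the reflection fixes the character, so the matrix unit is diagonal.
  · obtain rfl : j = i := chiRep_injective π μ <| by
      funext x
      rw [hj, adjSwap, Equiv.swap_apply_def]
      split_ifs with h1 h2
      · rw [h1, hne]
      · rw [h2, hne]
      · rfl
    obtain ⟨i', e1, e2, hd⟩ := conj_s_of_eq rfl hne.symm h'
    by_cases hw : Desc w m
    · rw [IM.bas_mul_S_of_desc q ζ hn hr hw, hk, hk, if_pos hne, map_add, map_smul,
        linIso_bas q ζ π hn hr h, linIso_bas q ζ π hn hr h'',
        HMu.std_mul_of_desc q _ _ e1 e2 ((hd h).mpr hw), conj_mul_conj π h h' h'',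
        Matrix.single_add, Pi.single_add, ← Matrix.smul_single, ← Pi.single_smul]
    · rw [IM.bas_mul_S_of_not_desc q ζ hn hw, linIso_bas q ζ π hn hr h'',
        HMu.std_mul_of_not_desc q _ _ e1 e2 ((hd h).not.mpr hw), conj_mul_conj π h h' h'']
  -- With different colours $e_i$ kills the correction term, so descents and ascents of $w$ obey the
  -- same rule.
  · rw [HMu.std_mul_of_len_eq_zero q _ _ (len_conj_s_of_ne h' hne), conj_mul_conj π h h' h'',
      ← linIso_bas q ζ π hn hr h'']
    by_cases hw : Desc w m
    · rw [IM.bas_mul_S_of_desc q ζ hn hr hw, hk, hk, hj1, hj2, if_neg (Ne.symm hne), zero_smul,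
        add_zero]
    · rw [IM.bas_mul_S_of_not_desc q ζ hn hw]

end MatrixIso

/-! ### Multiplicativity, and the values of the isomorphism and its inverse -/

section MatrixIso

variable {K : Type*} [Field K] (q : K) {r n : ℕ} (ζ : Fin r ≃ rootsOfUnity r K)
  (π : ∀ μ : RComp r n, Fin (numMinRep μ) ≃ MinRep μ)
  (hn : n ≠ 0) (hr : (r : K) ≠ 0)

lemma mem_multSubmodule_of_sum {y : IM K q r n}
    (h : ∀ c, idemE q ζ c * y ∈ multSubmodule q ζ π hn hr) :
    y ∈ multSubmodule q ζ π hn hr := by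
  rw [← one_mul y, ← IM.sum_idemE q ζ hr, Finset.sum_mul]
  exact Submodule.sum_mem _ fun c _ => h c

lemma rho_zpow_mem (m : ℤ) :
    ((IM.R q r n ^ m : (IM K q r n)ˣ) : IM K q r n) ∈ multSubmodule q ζ π hn hr := by
  refine mem_multSubmodule_of_sum q ζ π hn hr fun c => ?_
  have := bas_rho_mem q ζ π hn hr m c
  rwa [IM.bas, IM.std_rho_zpow q hn] at this

lemma one_mem_multSubmodule : (1 : IM K q r n) ∈ multSubmodule q ζ π hn hr := by
  simpa using rho_zpow_mem q ζ π hn hr 0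

lemma gen_mem_multSubmodule (g : IMGen n) :
    RingQuot.mkAlgHom K (IMRel K q r n) (FreeAlgebra.ι K g) ∈ multSubmodule q ζ π hn hr := by
  match g with
  | .t j =>
    refine mem_multSubmodule_of_sum q ζ π hn hr (y := IM.t q r j) fun c => ?_
    rw [IM.idemE_mul_t q ζ hr]
    refine Submodule.smul_mem _ _ ?_
    have := bas_rho_mem q ζ π hn hr 0 c
    rwa [zpow_zero, IM.bas, IM.std_one q hn, mul_one] at this
  | .s i =>
    refine mem_multSubmodule_of_sum q ζ π hn hr (y := IM.S q r i) fun c => ?_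
    have := bas_s_mem q ζ π hn hr i c
    rwa [IM.bas, IM.std_s q hn] at this
  | .rho =>
    have := rho_zpow_mem q ζ π hn hr 1
    rw [zpow_one] at this
    exact this
  | .rhoInv =>
    have := rho_zpow_mem q ζ π hn hr (-1)
    rw [zpow_neg_one] at this
    exact this

lemma linIso_mul (x y : IM K q r n) :
    linIso q ζ π hn hr (x * y) = linIso q ζ π hn hr x * linIso q ζ π hn hr y := by
  have := RingQuot.mul_mem_of_gen (multSubmodule q ζ π hn hr) (fun x hx g z => ?_) 1
    (one_mem_multSubmodule q ζ π hn hr) y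
  · rw [one_mul] at this
    exact this x
  · have hg := gen_mem_multSubmodule q ζ π hn hr g
    rw [← mul_assoc, hg, hx, hg, mul_assoc]

/-- A multiplicative surjection preserves the identity: apply it to $x\cdot1$ for a preimage $x$ of
$1$. -/
lemma linIso_one : linIso q ζ π hn hr 1 = 1 := by
  obtain ⟨x, hx⟩ := (linIso q ζ π hn hr).surjective 1
  rw [← one_mul (linIso q ζ π hn hr 1), ← hx, ← linIso_mul, mul_one]

/-- The isomorphism of `Ĥ_{r,n}^aff` with `⨁_μ Mat(Ĥ^μ)`. -/
noncomputable def matIso : IM K q r n ≃ₐ[K] MatSum K q r n :=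
  AlgEquiv.ofLinearEquiv (linIso q ζ π hn hr) (linIso_one q ζ π hn hr) (linIso_mul q ζ π hn hr)

lemma matIso_idemE_mul_std {μ : RComp r n} {k j : Fin (numMinRep μ)} {w : EW n}
    (h : Chi.act w.right (chiRep π μ j) = chiRep π μ k) :
    matIso q ζ π hn hr (idemE q ζ (chiRep π μ k) * IM.std q r w) =
      Pi.single μ (Matrix.single k j (HMu.std q (conj h))) :=
  linIso_bas q ζ π hn hr h

lemma HMu.std_one (μ : RComp r n) : HMu.std q (1 : affYoung μ) = 1 := by
  rw [HMu.std, PiTensorProduct.one_def]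
  congr 1
  funext a
  have : affYoungPart (1 : affYoung μ) a = 1 := by
    have := affYoungPart_mul (1 : affYoung μ) 1 a
    rw [mul_one] at this
    simpa using this.symm
  rw [this, AffHecke.std_one]
  rfl

lemma matIso_idemE (μ : RComp r n) (k : Fin (numMinRep μ)) :
    matIso q ζ π hn hr (idemE q ζ (chiRep π μ k)) = Pi.single μ (Matrix.single k k 1) := by
  have h : Chi.act (1 : EW n).right (chiRep π μ k) = chiRep π μ k := rfl
  have := matIso_idemE_mul_std q ζ π hn hr h
  rw [IM.std_one q hn, mul_one] at this
  rw [this, show conj h = 1 from Subtype.ext (by simp [conj]), HMu.std_one]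

lemma matIso_idemMu (μ : RComp r n) :
    matIso q ζ π hn hr (idemMu q ζ μ) = Pi.single μ 1 := by
  have e : idemMu q ζ μ = ∑ k, idemE q ζ (chiRep π μ k) := by
    rw [idemMu]
    symm
    refine Finset.sum_bij (fun k _ => chiRep π μ k) (fun k _ => ?_)
      (fun k _ j _ h => chiRep_injective π μ h) (fun c hc => ?_) (fun _ _ => rfl)
    · simp [comp_chiRep]
    · obtain ⟨k, hk⟩ := exists_chiRep π (Finset.mem_filter.mp hc).2
      exact ⟨k, Finset.mem_univ _, hk⟩
  rw [e, map_sum]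
  simp only [matIso_idemE]
  have : ∀ s : Finset (Fin (numMinRep μ)),
      ∑ k ∈ s, (Pi.single μ (Matrix.single k k 1) : MatSum K q r n) =
        Pi.single μ (∑ k ∈ s, Matrix.single k k 1) := fun s =>
    (map_sum (AddMonoidHom.single (fun μ : RComp r n =>
      Matrix (Fin (numMinRep μ)) (Fin (numMinRep μ)) (HMu K q μ)) μ) _ s).symm
  rw [this, Matrix.sum_single_one]

lemma matIso_symm_single (μ : RComp r n)
    (w : Fin (numMinRep μ) → Fin (numMinRep μ) → affYoung μ) :
    (matIso q ζ π hn hr).symm (Pi.single μ (Matrix.of fun i j => HMu.std q (w i j))) =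
      ∑ i, ∑ j, idemE q ζ (chiRep π μ i) *
        IM.std q r (ofPerm (π μ i).1 * (w i j).1 * (ofPerm (π μ j).1)⁻¹) *
          idemE q ζ (chiRep π μ j) := by
  rw [AlgEquiv.symm_apply_eq, map_sum, Matrix.matrix_eq_sum_single
    (Matrix.of fun i j => HMu.std q (w i j))]
  have hs : ∀ (s : Finset (Fin (numMinRep μ)))
      (f : Fin (numMinRep μ) → Matrix (Fin (numMinRep μ)) (Fin (numMinRep μ)) (HMu K q μ)),
      (Pi.single μ (∑ k ∈ s, f k) : MatSum K q r n) = ∑ k ∈ s, Pi.single μ (f k) := fun s f =>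
    map_sum (AddMonoidHom.single (fun μ : RComp r n =>
      Matrix (Fin (numMinRep μ)) (Fin (numMinRep μ)) (HMu K q μ)) μ) _ s
  rw [hs]
  refine Finset.sum_congr rfl fun i _ => ?_
  rw [hs, map_sum]
  refine Finset.sum_congr rfl fun j _ => ?_
  have h := act_idxMap π μ i j (w i j)
  -- The right factor $E_{\chi_j}$ is redundant, since $E_{\chi_i}T_w$ already has right weight
  -- $w^{-1}\chi_i=\chi_j$.
  have e := IM.bas_mul_idemE q ζ hn hr (chiRep π μ i)
    (ofPerm (π μ i).1 * (w i j).1 * (ofPerm (π μ j).1)⁻¹) (chiRep π μ j)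
  rw [Chi.act_inv h, if_pos rfl, IM.bas] at e
  rw [e, matIso_idemE_mul_std q ζ π hn hr h, Matrix.of_apply]
  congr 3
  apply Subtype.ext
  simp only [conj]
  group

end MatrixIso

/-! ### Descending products of braid generators -/

section DownProd

/-- `f_{m-1} ⋯ f_1 f_0`. -/
def downProd {Γ : Type*} [Monoid Γ] (f : ℕ → Γ) (m : ℕ) : Γ := ((List.range m).map f).reverse.prod

/-- The braid relations for `f_0, …, f_{m-1}`. -/
structure IsBraidSeq {Γ : Type*} [Monoid Γ] (f : ℕ → Γ) (m : ℕ) : Prop where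
  comm : ∀ i j, i + 2 ≤ j → j < m → Commute (f i) (f j)
  braid : ∀ i, i + 1 < m → f i * f (i + 1) * f i = f (i + 1) * f i * f (i + 1)

section Monoid

variable {Γ : Type*} [Monoid Γ] {f : ℕ → Γ} {m : ℕ}

lemma downProd_zero : downProd f 0 = 1 := rfl

lemma downProd_succ : downProd f (m + 1) = f m * downProd f m := by
  simp [downProd, List.range_succ]

lemma downProd_succ' : downProd f (m + 1) = downProd (fun i => f (i + 1)) m * f 0 := by
  simp [downProd, List.range_succ_eq_map, Function.comp_def]

lemma commute_downProd {x : Γ} (h : ∀ i, i < m → Commute x (f i)) : Commute x (downProd f m) := by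
  induction m with
  | zero => exact Commute.one_right x
  | succ m ih =>
    rw [downProd_succ]
    exact (h m (Nat.lt_succ_self m)).mul_right (ih fun i hi => h i (by omega))

/-- The factor $f_{i+1}$ commutes past the lower generators until the braid relation with
$f_{i+1}f_i$ turns it into $f_i$, which commutes with the higher ones. -/
lemma IsBraidSeq.downProd_mul (h : IsBraidSeq f m) {i : ℕ} (hi : i + 1 < m) :
    downProd f m * f (i + 1) = f i * downProd f m := by
  induction m with
  | zero => omega
  | succ m ih =>
    obtain hm | rfl := Nat.lt_succ_iff_lt_or_eq.mp hi
    · rw [downProd_succ, mul_assoc,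
        ih ⟨fun i j h1 h2 => h.comm i j h1 (by omega), fun i h1 => h.braid i (by omega)⟩ hm,
        ← mul_assoc, ← (h.comm i m hm (by omega)).eq, mul_assoc]
    · have hc : Commute (f (i + 1)) (downProd f i) :=
        commute_downProd fun j hj => (h.comm j (i + 1) (by omega) (by omega)).symm
      simp only [downProd_succ, mul_assoc]
      rw [← hc.eq, ← mul_assoc, ← mul_assoc, ← h.braid i hi]
      simp only [mul_assoc]

lemma IsBraidSeq.downProd_mul_downProd (h : IsBraidSeq f m) {k : ℕ} (hk : k < m) :
    downProd f m * downProd (fun i => f (i + 1)) k = downProd f k * downProd f m := by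
  induction k with
  | zero => simp [downProd_zero]
  | succ k ih =>
    rw [downProd_succ, downProd_succ, ← mul_assoc, h.downProd_mul hk, mul_assoc, mul_assoc,
      ih (by omega)]

end Monoid

variable {Γ : Type*} [Group Γ] {f : ℕ → Γ} {m : ℕ} {X : Γ}

/-- With $D=f_m\cdots f_0$ and $A=f_m\cdots f_1$ one has $(DX)^2=DA\,(Xf_0X)$ and $f_mDA=DAf_0$.
Cancelling $DA$ leaves exactly the relation between $f_0$ and $X$. -/
lemma IsBraidSeq.sq_mul_iff (h : IsBraidSeq f (m + 1)) (hX : ∀ i, i < m → Commute X (f (i + 1))) :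
    downProd f (m + 1) * X * (downProd f (m + 1) * X) * f 0 =
      f m * (downProd f (m + 1) * X * (downProd f (m + 1) * X)) ↔
      f 0 * X * f 0 * X = X * f 0 * X * f 0 := by
  have hA : Commute X (downProd (fun i => f (i + 1)) m) := commute_downProd hX
  have hD := h.downProd_mul_downProd (Nat.lt_succ_self m)
  have e0 : downProd f (m + 1) * X * (downProd f (m + 1) * X) =
      downProd f (m + 1) * downProd (fun i => f (i + 1)) m * (X * f 0 * X) := by
    rw [mul_assoc, ← mul_assoc X, mul_assoc _ _ (X * f 0 * X)]
    congr 1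
    conv_lhs => rw [downProd_succ', ← mul_assoc, hA.eq]
    simp only [mul_assoc]
  have e1 : f m * (downProd f (m + 1) * downProd (fun i => f (i + 1)) m * (X * f 0 * X)) =
      downProd f (m + 1) * downProd (fun i => f (i + 1)) m * (f 0 * X * f 0 * X) := by
    rw [hD, mul_assoc (downProd f m), ← mul_assoc (f m), ← downProd_succ, ← hD,
      mul_assoc (downProd f (m + 1)) (downProd _ m)]
    congr 1
    rw [downProd_succ']
    simp only [mul_assoc]
  rw [e0, e1, mul_assoc _ _ (f 0), mul_right_inj, eq_comm]

/-- The relation gives $f_0Xf_0X^{-1}=X^{-1}f_0Xf_0$, and $X^{-1}$ commutes with the remaining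
generators. For $\rho=DX$ this expresses $\rho f_0\rho^{-1}$, the future $T_{s_0}$. -/
lemma conj_downProd_mul (hX : ∀ i, i < m → Commute X (f (i + 1)))
    (h0 : f 0 * X * f 0 * X = X * f 0 * X * f 0) :
    downProd f (m + 1) * X * f 0 * (downProd f (m + 1) * X)⁻¹ =
      X⁻¹ * (downProd f (m + 1) * X) * (downProd (fun i => f (i + 1)) m)⁻¹ := by
  have hA : Commute X⁻¹ (downProd (fun i => f (i + 1)) m) := (commute_downProd hX).inv_left
  have h1 : f 0 * X * f 0 * X⁻¹ = X⁻¹ * f 0 * X * f 0 := by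
    rw [mul_inv_eq_iff_eq_mul]
    simp only [mul_assoc] at h0 ⊢
    rw [h0, inv_mul_cancel_left]
  rw [downProd_succ']
  generalize downProd (fun i => f (i + 1)) m = A at hA
  calc A * f 0 * X * f 0 * (A * f 0 * X)⁻¹ = A * (f 0 * X * f 0 * X⁻¹) * (f 0)⁻¹ * A⁻¹ := by group
    _ = A * X⁻¹ * (f 0 * X) * A⁻¹ := by rw [h1]; group
    _ = X⁻¹ * (A * f 0 * X) * A⁻¹ := by rw [← hA.eq]; simp only [mul_assoc]

lemma downProd_inv (f : ℕ → Γ) (m : ℕ) :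
    (downProd f m)⁻¹ = ((List.range m).map fun i => (f i)⁻¹).prod := by
  simp [downProd, List.prod_inv_reverse, Function.comp_def]

end DownProd

/-! ### Descending products over the finite labels -/

section Seq

variable {n : ℕ}

/-- A family indexed by `1, …, n - 1` as a sequence. -/
def fseq {Γ : Type*} [One Γ] (g : FNode n → Γ) (k : ℕ) : Γ :=
  if h : k + 1 < n then g ⟨⟨k, by omega⟩, h⟩ else 1

lemma fseq_val {Γ : Type*} [One Γ] (g : FNode n → Γ) (i : FNode n) : fseq g i.1 = g i :=
  dif_pos i.2

lemma fnodes_map {Γ : Type*} [One Γ] (g : FNode n → Γ) :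
    (fnodes n).map g = (List.range (n - 1)).map (fseq g) := by
  apply List.ext_getElem
  · simp [fnodes]
  · intro k h1 h2
    have hk : k + 1 < n := by simp [fnodes] at h1; omega
    simp [fnodes, fseq, hk]

lemma isBraidSeq_fseq {Γ : Type*} [Monoid Γ] {g : FNode n → Γ}
    (hc : ∀ i j : FNode n, (i.1 : ℕ) + 2 ≤ j.1 → g i * g j = g j * g i)
    (hb : ∀ i j : FNode n, (j.1 : ℕ) = i.1 + 1 → g i * g j * g i = g j * g i * g j) :
    IsBraidSeq (fseq g) (n - 1) where
  comm i j hij hj := by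
    rw [fseq, fseq, dif_pos (by omega), dif_pos (by omega)]
    exact hc _ _ hij
  braid i hi := by
    rw [fseq, fseq, dif_pos (by omega), dif_pos (by omega)]
    exact hb _ _ rfl

/-- `g_{n-1} ⋯ g_1`. -/
def fdown {Γ : Type*} [Monoid Γ] (g : FNode n → Γ) : Γ := downProd (fseq g) (n - 1)

lemma fdown_eq {Γ : Type*} [Monoid Γ] (g : FNode n → Γ) :
    fdown g = ((fnodes n).reverse.map g).prod := by
  rw [fdown, downProd, ← fnodes_map, List.map_reverse]

lemma map_fdown {Γ Δ : Type*} [Monoid Γ] [Monoid Δ] (φ : Γ →* Δ) (g : FNode n → Γ) :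
    φ (fdown g) = fdown fun i => φ (g i) := by
  rw [fdown_eq, fdown_eq, map_list_prod, List.map_map]
  rfl

lemma fdown_mul_t {A : Type*} [Monoid A] {g : FNode n → A} {t : Fin n → A}
    (h : ∀ i j, g i * t j = t (adjSwap i.1 j) * g i) (j : Fin n) :
    fdown g * t j = t (prv j) * fdown g := by
  -- The product of the first $k$ generators moves the $t_j$ along the partial cycle sending $0$ to
  -- $k$ and lowering $1,\dots,k$ by one; $k=n-1$ gives `prv`.
  have key : ∀ k, k < n → ∀ (j j' : Fin n),
      (j' : ℕ) = (if (j : ℕ) = 0 then k else if (j : ℕ) ≤ k then (j : ℕ) - 1 else j) →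
      downProd (fseq g) k * t j = t j' * downProd (fseq g) k := by
    intro k
    induction k with
    | zero =>
      intro _ j j' hj
      obtain rfl : j' = j := Fin.ext (by split_ifs at hj <;> omega)
      simp [downProd_zero]
    | succ k ih =>
      intro hk j j' hj
      have hjn := j.2
      obtain ⟨j'', hj''⟩ : ∃ j'' : Fin n, (j'' : ℕ) =
          (if (j : ℕ) = 0 then k else if (j : ℕ) ≤ k then (j : ℕ) - 1 else j) :=
        ⟨⟨if (j : ℕ) = 0 then k else if (j : ℕ) ≤ k then (j : ℕ) - 1 else j,
          by split_ifs <;> omega⟩, rfl⟩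
      have hnx : nxt (⟨k, by omega⟩ : Fin n) = ⟨k + 1, hk⟩ := Fin.ext (by rw [nxt_val, if_pos hk])
      rw [downProd_succ, mul_assoc, ih (by omega) j j'' hj'', ← mul_assoc, fseq, dif_pos hk, h,
        mul_assoc]
      congr 2
      rw [adjSwap]
      dsimp only
      rw [hnx]
      apply Fin.ext
      rw [Equiv.swap_apply_def]
      simp only [Fin.ext_iff]
      split_ifs at * <;> (try dsimp only) <;> omega
  refine key _ (by have := j.2; omega) j _ ?_
  have h1 : nxt (prv j) = j := Equiv.apply_symm_apply nxt j
  have h2 := nxt_val (prv j)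
  rw [h1] at h2
  have := (prv j).2
  have := j.2
  split_ifs at * <;> omega

end Seq

/-! ### Inverses of the braid generators -/

section TIdem

variable {K : Type*} [Field K] {A : Type*} [Ring A] [Algebra K A] {r : ℕ} {x y g : A}

/-- Adding the term $a=r$, which equals $1$, makes the range of summation symmetric under $a\mapsto
r-a$. -/
lemma tIdem_swap (hx : x ^ r = 1) (hy : y ^ r = 1) (hxy : Commute x y) :
    tIdem K r x y = tIdem K r y x := by
  have key : ∀ {x y : A}, x ^ r = 1 → y ^ r = 1 → ∑ a ∈ Finset.range (r + 1), x ^ a * y ^ (r - a) =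
      1 + ∑ a ∈ Finset.range r, x ^ a * y ^ (r - a) := fun {x y} hx hy => by
    rw [Finset.sum_range_succ, hx, Nat.sub_self, pow_zero, mul_one, add_comm]
  rw [tIdem, tIdem]
  congr 1
  rw [← add_right_inj (1 : A), ← key hx hy, ← key hy hx, ← Finset.sum_flip]
  refine Finset.sum_congr rfl fun a ha => ?_
  rw [Nat.sub_sub_self (Nat.lt_succ_iff.mp (Finset.mem_range.mp ha)), (hxy.pow_pow _ _).eq]

lemma SemiconjBy.tIdem {x' y' : A} (hx : SemiconjBy g x x') (hy : SemiconjBy g y y') :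
    SemiconjBy g (tIdem K r x y) (tIdem K r x' y') := by
  rw [AYH.tIdem, AYH.tIdem, SemiconjBy, mul_smul_comm, smul_mul_assoc, Finset.mul_sum,
    Finset.sum_mul]
  congr 1
  exact Finset.sum_congr rfl fun a _ => (hx.pow_right _).mul_right (hy.pow_right _)

/-- The unit `g` with `g ^ 2 = 1 + c e g`. -/
def quadUnit (c : K) (hx : x ^ r = 1) (hy : y ^ r = 1) (hxy : Commute x y)
    (h1 : SemiconjBy g x y) (h2 : SemiconjBy g y x) (hq : g ^ 2 = 1 + c • (tIdem K r x y * g)) :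
    Aˣ :=
  have he : g * tIdem K r x y = tIdem K r x y * g := by
    conv_rhs => rw [tIdem_swap hx hy hxy]
    exact SemiconjBy.tIdem h1 h2
  { val := g
    inv := g - c • tIdem K r x y
    val_inv := by rw [mul_sub, ← pow_two, hq, mul_smul_comm, he, add_sub_cancel_right]
    inv_val := by rw [sub_mul, ← pow_two, hq, smul_mul_assoc, add_sub_cancel_right] }

end TIdem

/-! ### The Iwahori–Matsumoto generators of the affine Yokonuma–Hecke algebra -/

lemma Node.prev_val {n : ℕ} (i : Node n) :
    ((i.prev.1 : Fin n) : ℕ) = if (i.1 : ℕ) = 0 then n - 1 else (i.1 : ℕ) - 1 := by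
  have h := nxt_val i.prev.1
  have h1 : nxt i.prev.1 = i.1 := Equiv.apply_symm_apply nxt i.1
  rw [h1] at h
  have := i.prev.1.2
  split_ifs at * <;> omega

lemma Node.prev_next {n : ℕ} (i : Node n) : i.next.prev = i :=
  Subtype.ext (Equiv.symm_apply_apply nxt i.1)

lemma Node.next_val {n : ℕ} (i : Node n) :
    ((i.next.1 : Fin n) : ℕ) = if (i.1 : ℕ) + 1 < n then (i.1 : ℕ) + 1 else 0 := nxt_val i.1

/-! ### From relations at finite labels to all cyclic labels -/

section AffineNodes

variable {Γ : Type*} [Group Γ] {n : ℕ} {S : Node n → Γ} {R : Γ}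

/-- If one label is the affine one, non-adjacency keeps the other away from the first label, so
conjugation by $\rho$ moves both to finite labels. -/
lemma comm_of_finite (hR : ∀ i, R * S i = S i.prev * R)
    (hc : ∀ i j : FNode n, (i.1 : ℕ) + 2 ≤ j.1 → S i.toNode * S j.toNode = S j.toNode * S i.toNode)
    (i j : Node n) (h : i ≠ j.next) (h' : j ≠ i.next) : S i * S j = S j * S i := by
  have hfin : ∀ i j : Node n, (i.1 : ℕ) + 1 < n → (j.1 : ℕ) + 1 < n → i ≠ j.next → j ≠ i.next →
      S i * S j = S j * S i := by
    intro i j hi hj h h'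
    have e1 : (i.1 : ℕ) ≠ (j.1 : ℕ) + 1 := fun e =>
      h (Subtype.ext (Fin.ext (by rw [Node.next_val, if_pos hj, e])))
    have e2 : (j.1 : ℕ) ≠ (i.1 : ℕ) + 1 := fun e =>
      h' (Subtype.ext (Fin.ext (by rw [Node.next_val, if_pos hi, e])))
    obtain h1 | h1 | h1 := lt_trichotomy (i.1 : ℕ) j.1
    · exact hc ⟨i.1, hi⟩ ⟨j.1, hj⟩ (by dsimp only; omega)
    · rw [show i = j from Subtype.ext (Fin.ext h1)]
    · exact (hc ⟨j.1, hj⟩ ⟨i.1, hi⟩ (by dsimp only; omega)).symm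
  by_cases hij : i = j
  · rw [hij]
  by_cases hi : (i.1 : ℕ) + 1 < n ∧ (j.1 : ℕ) + 1 < n
  · exact hfin i j hi.1 hi.2 h h'
  have hne : (i.1 : ℕ) ≠ j.1 := fun e => hij (Subtype.ext (Fin.ext e))
  have hn := i.2
  have hin := i.1.2
  have hjn := j.1.2
  have e1 : (i.1 : ℕ) ≠ 0 := fun e =>
    h (Subtype.ext (Fin.ext (by rw [Node.next_val, if_neg (by omega), e])))
  have e2 : (j.1 : ℕ) ≠ 0 := fun e =>
    h' (Subtype.ext (Fin.ext (by rw [Node.next_val, if_neg (by omega), e])))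
  have key := hfin i.prev j.prev (by rw [Node.prev_val, if_neg e1]; omega)
    (by rw [Node.prev_val, if_neg e2]; omega)
    (fun e => h (by rw [← Node.next_prev i, e, Node.next_prev]))
    (fun e => h' (by rw [← Node.next_prev j, e, Node.next_prev]))
  apply mul_left_cancel (a := R)
  rw [← mul_assoc, hR, mul_assoc, hR, ← mul_assoc, key, mul_assoc, ← hR, ← mul_assoc, ← hR,
    mul_assoc]

/-- Conjugation by $\rho$ lowers labels by one; at most two such steps take a pair of adjacent
labels away from the affine one. -/
lemma braid_of_finite (hR : ∀ i, R * S i = S i.prev * R)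
    (hb : ∀ i j : FNode n, (j.1 : ℕ) = i.1 + 1 → S i.toNode * S j.toNode * S i.toNode =
      S j.toNode * S i.toNode * S j.toNode)
    (i : Node n) (hn : 3 ≤ n) : S i * S i.next * S i = S i.next * S i * S i.next := by
  have hprev : ∀ i : Node n, S i.prev * S i.prev.next * S i.prev =
      S i.prev.next * S i.prev * S i.prev.next →
      S i * S i.next * S i = S i.next * S i * S i.next := by
    intro i h
    have h1 := hR i
    have h2 := hR i.next
    rw [Node.prev_next] at h2
    rw [Node.next_prev] at h
    apply mul_left_cancel (a := R)
    simp only [← mul_assoc]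
    rw [h1, h2, mul_assoc _ R, mul_assoc _ R, h1, h2, ← mul_assoc, ← mul_assoc, mul_assoc _ R,
      mul_assoc _ R, h1, h2, ← mul_assoc, ← mul_assoc, h]
  have hfin : ∀ i : Node n, (i.1 : ℕ) + 2 < n →
      S i * S i.next * S i = S i.next * S i * S i.next := fun i hi =>
    hb ⟨i.1, by omega⟩ ⟨i.next.1, by rw [Node.next_val, if_pos (by omega)]; omega⟩
      (by dsimp only; rw [Node.next_val, if_pos (by omega)])
  have hi := i.1.2
  by_cases h2 : (i.1 : ℕ) + 2 < n
  · exact hfin i h2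
  by_cases h1 : (i.1 : ℕ) + 1 < n
  · exact hprev i (hfin _ (by rw [Node.prev_val, if_neg (by omega)]; omega))
  · have e : (i.prev.1 : ℕ) = n - 2 := by rw [Node.prev_val, if_neg (by omega)]; omega
    exact hprev i (hprev _ (hfin _ (by rw [Node.prev_val, if_neg (by omega)]; omega)))

end AffineNodes

namespace YH

variable {K : Type*} [Field K] (q : K) {r n : ℕ}

lemma t_pow (j : Fin n) : t q r j ^ r = 1 := by
  have h := RingQuot.mkAlgHom_rel K (YRel.t_pow (K := K) (q := q) (r := r) j)
  simp only [map_pow, map_one] at h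
  exact h

lemma t_comm (i j : Fin n) : t q r i * t q r j = t q r j * t q r i := by
  have h := RingQuot.mkAlgHom_rel K (YRel.t_comm (K := K) (q := q) (r := r) i j)
  simp only [map_mul] at h
  exact h

lemma g_mul_t (i : FNode n) (j : Fin n) : g q r i * t q r j = t q r (adjSwap i.1 j) * g q r i := by
  have h := RingQuot.mkAlgHom_rel K (YRel.g_t (K := K) (q := q) (r := r) i j)
  simp only [map_mul] at h
  exact h

lemma g_sq (i : FNode n) : g q r i ^ 2 =
    1 + (q - q⁻¹) • (tIdem K r (t q r i.1) (t q r (nxt i.1)) * g q r i) := by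
  have h := RingQuot.mkAlgHom_rel K (YRel.quad (K := K) (q := q) (r := r) i)
  simp only [map_mul, map_add, map_one, map_smul, tIdem, map_sum, map_pow] at h
  exact h

/-- The unit `g_i`. -/
noncomputable def gUnit (r : ℕ) (i : FNode n) : (YH K q r n)ˣ :=
  quadUnit (g := g q r i) (q - q⁻¹) (t_pow q i.1) (t_pow q (nxt i.1)) (t_comm q _ _)
    ((g_mul_t q i i.1).trans (by rw [adjSwap, Equiv.swap_apply_left]))
    ((g_mul_t q i (nxt i.1)).trans (by rw [adjSwap, Equiv.swap_apply_right])) (g_sq q i)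

/-- The unit `X_1`. -/
noncomputable def XUnit (r n : ℕ) : (YH K q r n)ˣ where
  val := X q r n
  inv := Xinv q r n
  val_inv := by
    have h := RingQuot.mkAlgHom_rel K (YRel.X_inv (K := K) (q := q) (r := r) (n := n))
    simp only [map_mul, map_one] at h
    exact h
  inv_val := by
    have h := RingQuot.mkAlgHom_rel K (YRel.inv_X (K := K) (q := q) (r := r) (n := n))
    simp only [map_mul, map_one] at h
    exact h

lemma gUnit_comm (i j : FNode n) (h : (i.1 : ℕ) + 2 ≤ j.1) :
    gUnit q r i * gUnit q r j = gUnit q r j * gUnit q r i := by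
  have h := RingQuot.mkAlgHom_rel K (YRel.g_comm (K := K) (q := q) (r := r) i j (Or.inl h))
  simp only [map_mul] at h
  exact Units.ext h

lemma gUnit_braid (i j : FNode n) (h : (j.1 : ℕ) = i.1 + 1) :
    gUnit q r i * gUnit q r j * gUnit q r i = gUnit q r j * gUnit q r i * gUnit q r j := by
  have h := RingQuot.mkAlgHom_rel K (YRel.g_braid (K := K) (q := q) (r := r) i j h)
  simp only [map_mul] at h
  exact Units.ext h

lemma XUnit_comm (i : FNode n) (h : (i.1 : ℕ) ≠ 0) : Commute (XUnit q r n) (gUnit q r i) := by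
  have h := RingQuot.mkAlgHom_rel K (YRel.g_X (K := K) (q := q) (r := r) i h)
  simp only [map_mul] at h
  exact Units.ext h.symm

lemma XUnit_first (i : FNode n) (h : (i.1 : ℕ) = 0) :
    gUnit q r i * XUnit q r n * gUnit q r i * XUnit q r n =
      XUnit q r n * gUnit q r i * XUnit q r n * gUnit q r i := by
  have h := RingQuot.mkAlgHom_rel K (YRel.g_X_first (K := K) (q := q) (r := r) i h)
  simp only [map_mul] at h
  exact Units.ext h

lemma t_mul_X (j : Fin n) : t q r j * X q r n = X q r n * t q r j := by
  have h := RingQuot.mkAlgHom_rel K (YRel.t_X (K := K) (q := q) (r := r) j)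
  simp only [map_mul] at h
  exact h

lemma isBraidSeq (r n : ℕ) : IsBraidSeq (fseq (gUnit (n := n) q r)) (n - 1) :=
  isBraidSeq_fseq (gUnit_comm q) (gUnit_braid q)

lemma coe_fdown (r n : ℕ) :
    ((fdown (gUnit (n := n) q r) : (YH K q r n)ˣ) : YH K q r n) = gDown q r n :=
  (map_fdown (Units.coeHom (YH K q r n)) (gUnit q r)).trans (fdown_eq _)

/-- The image of `T_ρ`. -/
noncomputable def rho (r n : ℕ) : (YH K q r n)ˣ := fdown (gUnit q r) * XUnit q r n

lemma coe_rho (r n : ℕ) : (rho q r n : YH K q r n) = gDown q r n * X q r n := by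
  rw [rho, Units.val_mul, coe_fdown]
  rfl

lemma rho_mul_t (j : Fin n) : rho q r n * t q r j = t q r (prv j) * rho q r n := by
  have h := fdown_mul_t (g_mul_t (n := n) q (r := r)) j
  rw [fdown_eq] at h
  rw [coe_rho, mul_assoc, ← t_mul_X, ← mul_assoc, gDown, h, mul_assoc]

/-- The image of `T_{s_i}`. -/
noncomputable def S (r : ℕ) (i : Node n) : (YH K q r n)ˣ :=
  if h : (i.1 : ℕ) + 1 < n then gUnit q r ⟨i.1, h⟩
  else rho q r n * fseq (gUnit q r) 0 * (rho q r n)⁻¹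

lemma S_toNode (i : FNode n) : S q r i.toNode = gUnit q r i := dif_pos i.2

lemma S_eq_fseq (i : Node n) (h : (i.1 : ℕ) + 1 < n) : S q r i = fseq (gUnit q r) i.1 := by
  rw [S, dif_pos h, fseq, dif_pos h]

lemma XUnit_comm_fseq (i : ℕ) : Commute (XUnit q r n) (fseq (gUnit q r) (i + 1)) := by
  rw [fseq]
  split_ifs with h
  · exact XUnit_comm q _ (Nat.succ_ne_zero i)
  · exact Commute.one_right _

lemma XUnit_fseq_first (hn : 2 ≤ n) :
    fseq (gUnit q r) 0 * XUnit q r n * fseq (gUnit q r) 0 * XUnit q r n =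
      XUnit q r n * fseq (gUnit q r) 0 * XUnit q r n * fseq (gUnit q r) 0 := by
  rw [fseq, dif_pos (by omega)]
  exact XUnit_first q _ rfl

/-- At the first label this is the definition of the affine generator, at the other finite labels it
is `IsBraidSeq.downProd_mul`, and at the affine label it is the relation on $\rho^2$ from
`IsBraidSeq.sq_mul_iff`. -/
lemma rho_mul_S (i : Node n) : rho q r n * S q r i = S q r i.prev * rho q r n := by
  obtain ⟨m, rfl⟩ : ∃ m, n = m + 2 := ⟨n - 2, by have := i.2; omega⟩
  have hi := i.1.2
  have hp := i.prev_val
  by_cases h0 : (i.1 : ℕ) = 0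
  · rw [if_pos h0] at hp
    rw [S_eq_fseq q i (by omega), h0, S, dif_neg (by omega), inv_mul_cancel_right]
  · rw [if_neg h0] at hp
    rw [S_eq_fseq q i.prev (by omega), hp]
    by_cases h1 : (i.1 : ℕ) + 1 < m + 2
    · obtain ⟨k, hk⟩ : ∃ k, (i.1 : ℕ) = k + 1 := ⟨(i.1 : ℕ) - 1, by omega⟩
      rw [S_eq_fseq q i h1, hk, rho, mul_assoc, (XUnit_comm_fseq q k).eq, ← mul_assoc, fdown,
        (isBraidSeq q r (m + 2)).downProd_mul (by omega), mul_assoc]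
      rfl
    · have h := ((isBraidSeq q r (m + 2)).sq_mul_iff (fun i _ => XUnit_comm_fseq q i)).mpr
        (XUnit_fseq_first q (by omega))
      have e : (i.1 : ℕ) - 1 = m := by omega
      rw [S, dif_neg h1, ← mul_assoc, mul_inv_eq_iff_eq_mul, ← mul_assoc, e,
        mul_assoc (fseq _ m)]
      exact h

lemma S_comm (i j : Node n) (h : i ≠ j.next) (h' : j ≠ i.next) :
    S q r i * S q r j = S q r j * S q r i :=
  comm_of_finite (rho_mul_S q)
    (fun i j h => by rw [S_toNode, S_toNode, gUnit_comm q i j h]) i j h h'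

lemma S_braid (i : Node n) (hn : 3 ≤ n) :
    S q r i * S q r i.next * S q r i = S q r i.next * S q r i * S q r i.next :=
  braid_of_finite (rho_mul_S q)
    (fun i j h => by rw [S_toNode, S_toNode, gUnit_braid q i j h]) i hn

lemma S_sq (i : Node n) : (S q r i : YH K q r n) ^ 2 =
    1 + (q - q⁻¹) • (tIdem K r (t q r i.1) (t q r (nxt i.1)) * S q r i) := by
  by_cases h : (i.1 : ℕ) + 1 < n
  · rw [S, dif_pos h]
    exact g_sq q ⟨i.1, h⟩
  · obtain ⟨j, rfl⟩ := i.exists_finite_prev h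
    have h1 : SemiconjBy (rho q r n : YH K q r n) (S q r j.toNode) (S q r j.toNode.prev) :=
      congrArg Units.val (rho_mul_S q j.toNode)
    have h2 := SemiconjBy.tIdem (K := K) (r := r) (rho_mul_t q (r := r) j.1) (rho_mul_t q (nxt j.1))
    have h3 : (S q r j.toNode : YH K q r n) ^ 2 =
        1 + (q - q⁻¹) • (tIdem K r (t q r j.1) (t q r (nxt j.1)) * S q r j.toNode) := by
      rw [S_toNode]
      exact g_sq q j
    have e1 : (nxt (prv j.1) : Fin n) = j.1 := Equiv.apply_symm_apply nxt _
    have e2 : (prv (nxt j.1) : Fin n) = j.1 := Equiv.symm_apply_apply nxt _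
    rw [e2] at h2
    have h4 := (SemiconjBy.one_right _).add_right ((h2.mul_right h1).smul_right (q - q⁻¹))
    rw [← h3] at h4
    rw [← Units.mul_left_inj (rho q r n), ← (h1.pow_right 2).eq, h4.eq]
    change _ = (1 + (q - q⁻¹) • (tIdem K r (t q r (prv j.1)) (t q r (nxt (prv j.1))) * _)) * _
    rw [e1]

/-- `Φ(T_{s_0}) = X_1⁻¹ X_n (g_{n-1} ⋯ g_1 ⋯ g_{n-1})⁻¹`. -/
lemma S_zero (hn : 2 ≤ n) :
    (S q r (Node.zero hn) : YH K q r n) = Xinv q r n * Xn q r n * palInv q r n := by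
  obtain ⟨m, rfl⟩ : ∃ m, n = m + 2 := ⟨n - 2, by omega⟩
  have h := conj_downProd_mul (m := m) (fun i _ => XUnit_comm_fseq q i)
    (XUnit_fseq_first q (r := r) hn)
  -- Inserting $g_1\cdots g_{n-1}$ and its inverse completes $\rho$ to $X_n$ and $(g_{n-1}\cdots
  -- g_2)^{-1}$ to the inverse of the palindrome.
  have e1 : (downProd (fun i => fseq (gUnit (n := m + 2) q r) (i + 1)) m)⁻¹ =
      ((fnodes (m + 2)).map (gUnit q r)).prod *
        (((fnodes (m + 2)).reverse ++ (fnodes (m + 2)).tail).map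
          fun i => (gUnit q r i)⁻¹).prod := by
    rw [List.map_append, List.prod_append, ← mul_assoc]
    have h1 : ((fnodes (m + 2)).reverse.map fun i => (gUnit q r i)⁻¹).prod =
        ((fnodes (m + 2)).map (gUnit q r)).prod⁻¹ := by
      rw [List.prod_inv_reverse, List.map_map, List.map_reverse]
      rfl
    have h2 : ((fnodes (m + 2)).tail.map fun i => (gUnit q r i)⁻¹) =
        (List.range m).map fun i => (fseq (gUnit (n := m + 2) q r) (i + 1))⁻¹ := by
      have h3 := fnodes_map (gUnit (n := m + 2) q r)
      rw [show m + 2 - 1 = m + 1 from rfl, List.range_succ_eq_map, List.map_cons,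
        List.map_map] at h3
      have h4 := congrArg (fun l => l.tail.map fun u => u⁻¹) h3
      simpa [← List.map_tail, Function.comp_def] using h4
    rw [h1, mul_inv_cancel, one_mul, h2, downProd_inv]
  rw [S, dif_neg (by simp [Node.zero]), rho]
  refine (congrArg Units.val (h.trans (congrArg _ e1))).trans ?_
  have e2 : (((fnodes (m + 2)).map (gUnit q r)).prod : (YH K q r (m + 2))ˣ).val =
      ((fnodes (m + 2)).map (g q r)).prod :=
    (map_list_prod (Units.coeHom (YH K q r (m + 2))) _).trans (by rw [List.map_map]; rfl)
  have e3 : ((((fnodes (m + 2)).reverse ++ (fnodes (m + 2)).tail).map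
      fun i => (gUnit q r i)⁻¹).prod : (YH K q r (m + 2))ˣ).val = palInv q r (m + 2) :=
    (map_list_prod (Units.coeHom (YH K q r (m + 2))) _).trans (by rw [List.map_map]; rfl)
  have e4 := coe_fdown q r (m + 2) (K := K)
  rw [fdown] at e4
  simp only [Units.val_mul, e2, e3]
  rw [Xn, ← e4]
  simp only [← mul_assoc]
  rfl

end YH

/-! ### The Yokonuma generators inside the Iwahori–Matsumoto form -/

namespace IM

variable {K : Type*} [Field K] (q : K) {r n : ℕ}

/-- The unit `T_{s_i}`. -/
noncomputable def SUnit (r : ℕ) (i : Node n) : (IM K q r n)ˣ :=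
  quadUnit (g := S q r i) (q - q⁻¹) (t_pow q i.1) (t_pow q (nxt i.1)) (t_comm q _ _)
    ((S_mul_t q i i.1).trans (by rw [adjSwap, Equiv.swap_apply_left]))
    ((S_mul_t q i (nxt i.1)).trans (by rw [adjSwap, Equiv.swap_apply_right]))
    ((pow_two _).trans (S_mul_S q i))

/-- The preimage of `g_i`. -/
noncomputable def gUnit (r : ℕ) (i : FNode n) : (IM K q r n)ˣ := SUnit q r i.toNode

/-- The preimage of `X_1`. -/
noncomputable def XUnit (r n : ℕ) : (IM K q r n)ˣ := (fdown (gUnit q r))⁻¹ * R q r n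

lemma R_mul_SUnit (i : Node n) : R q r n * SUnit q r i = SUnit q r i.prev * R q r n :=
  Units.ext (R_mul_S q i)

lemma gUnit_comm (i j : FNode n) (h : (i.1 : ℕ) + 2 ≤ j.1) :
    gUnit q r i * gUnit q r j = gUnit q r j * gUnit q r i := by
  have hi := i.2
  have hj := j.2
  refine Units.ext ((isBraid q (by omega)).comm i.toNode j.toNode (fun e => ?_) fun e => ?_)
  · have := congrArg (fun i : Node n => (i.1 : ℕ)) e
    simp only [Node.next_val, FNode.toNode, hj, if_true] at this
    omega
  · have := congrArg (fun i : Node n => (i.1 : ℕ)) e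
    simp only [Node.next_val, FNode.toNode, hi, if_true] at this
    omega

lemma gUnit_braid (i j : FNode n) (h : (j.1 : ℕ) = i.1 + 1) :
    gUnit q r i * gUnit q r j * gUnit q r i = gUnit q r j * gUnit q r i * gUnit q r j := by
  have hi := i.2
  have hj := j.2
  have e : j.toNode = i.toNode.next :=
    Subtype.ext (Fin.ext (by rw [Node.next_val]; simp only [FNode.toNode, hi, if_true, h]))
  rw [gUnit, gUnit, e]
  exact Units.ext ((isBraid q (by omega)).braid i.toNode (by omega))

lemma isBraidSeq (r n : ℕ) : IsBraidSeq (fseq (gUnit (n := n) q r)) (n - 1) :=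
  isBraidSeq_fseq (gUnit_comm q) (gUnit_braid q)

lemma fdown_mul_XUnit (r n : ℕ) : fdown (gUnit q r) * XUnit q r n = R q r n := by
  rw [XUnit, mul_inv_cancel_left]

lemma R_mul_fseq {i : ℕ} (hi : i + 2 < n) :
    R q r n * fseq (gUnit q r) (i + 1) = fseq (gUnit q r) i * R q r n := by
  have e : (FNode.toNode ⟨⟨i + 1, by omega⟩, by dsimp only; omega⟩ : Node n).prev =
      FNode.toNode ⟨⟨i, by omega⟩, by dsimp only; omega⟩ :=
    Subtype.ext (Fin.ext (by rw [Node.prev_val]; simp [FNode.toNode]))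
  rw [fseq, fseq, dif_pos (by omega), dif_pos (by omega), gUnit, R_mul_SUnit, e]
  rfl

/-- Both $\rho$ and $g_{n-1}\cdots g_1$ carry $g_{i+1}$ to $g_i$, so their quotient $X_1$ commutes
with it. -/
lemma XUnit_comm_fseq {i : ℕ} (hi : i + 2 < n) :
    Commute (XUnit q r n) (fseq (gUnit q r) (i + 1)) := by
  rw [commute_iff_eq, ← mul_right_inj (fdown (gUnit q r)), ← mul_assoc, fdown_mul_XUnit,
    R_mul_fseq q hi, ← mul_assoc, fdown, (isBraidSeq q r n).downProd_mul (by omega), mul_assoc]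
  congr 1
  exact (fdown_mul_XUnit q r n).symm

lemma XUnit_comm (i : FNode n) (h : (i.1 : ℕ) ≠ 0) : Commute (XUnit q r n) (gUnit q r i) := by
  obtain ⟨k, hk⟩ := Nat.exists_eq_succ_of_ne_zero h
  have hi := i.2
  rw [← fseq_val (gUnit q r) i, hk]
  exact XUnit_comm_fseq q (by omega)

lemma XUnit_first (i : FNode n) (h : (i.1 : ℕ) = 0) :
    gUnit q r i * XUnit q r n * gUnit q r i * XUnit q r n =
      XUnit q r n * gUnit q r i * XUnit q r n * gUnit q r i := by
  obtain ⟨m, rfl⟩ : ∃ m, n = m + 2 := ⟨n - 2, by have := i.2; omega⟩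
  rw [← fseq_val (gUnit q r) i, h]
  refine ((isBraidSeq q r (m + 2)).sq_mul_iff (fun i _ => XUnit_comm_fseq q (by omega))).mp ?_
  have e : downProd (fseq (gUnit q r)) (m + 1) * XUnit q r (m + 2) = R q r (m + 2) :=
    fdown_mul_XUnit q r (m + 2)
  -- Two predecessor steps from the first label pass through the affine label to the last finite
  -- one; this supplies the relation on $\rho^2$.
  have e0 : i.toNode.prev.prev = FNode.toNode ⟨⟨m, by omega⟩, by dsimp only; omega⟩ := by
    refine Subtype.ext (Fin.ext ?_)
    rw [Node.prev_val, Node.prev_val]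
    simp [FNode.toNode, h]
  rw [e, ← h, fseq_val, gUnit, mul_assoc, R_mul_SUnit, ← mul_assoc, R_mul_SUnit, e0, mul_assoc,
    fseq, dif_pos (by omega)]
  rfl

lemma t_mul_XUnit (j : Fin n) : t q r j * XUnit q r n = XUnit q r n * t q r j := by
  have h := fdown_mul_t (g := fun i : FNode n => S q r i.toNode) (S_mul_t_of_finite q) j
  have h' : ((fdown (gUnit q r) : (IM K q r n)ˣ) : IM K q r n) =
      fdown fun i : FNode n => S q r i.toNode :=
    map_fdown (Units.coeHom (IM K q r n)) (gUnit q r)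
  rw [← h'] at h
  have h2 := R_mul_t q (r := r) j
  rw [← fdown_mul_XUnit, Units.val_mul, mul_assoc, ← mul_assoc (t q r _), ← h, mul_assoc] at h2
  exact ((Units.mul_right_inj _).mp h2).symm

end IM

/-! ### The two mutually inverse homomorphisms -/

section YokonumaIso

variable {K : Type*} [Field K] (q : K) {r n : ℕ}

/-- The images of the generators under the homomorphism to the affine Yokonuma–Hecke algebra. -/
noncomputable def toYHGen (r : ℕ) : IMGen n → YH K q r n
  | .t j => YH.t q r j
  | .s i => YH.S q r i
  | .rho => YH.rho q r n
  | .rhoInv => ↑(YH.rho q r n)⁻¹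

/-- The homomorphism `Φ`. -/
noncomputable def toYH (r n : ℕ) : IM K q r n →ₐ[K] YH K q r n :=
  RingQuot.liftAlgHom K ⟨FreeAlgebra.lift K (toYHGen q r), by
    intro x y h
    cases h with
    | t_pow j =>
      simp only [map_pow, map_one, FreeAlgebra.lift_ι_apply]
      exact YH.t_pow q j
    | t_comm i j =>
      simp only [map_mul, FreeAlgebra.lift_ι_apply]
      exact YH.t_comm q i j
    | s_t i j =>
      simp only [map_mul, FreeAlgebra.lift_ι_apply, toYHGen, YH.S_toNode]
      exact YH.g_mul_t q i j
    | rho_t j =>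
      simp only [map_mul, FreeAlgebra.lift_ι_apply]
      exact YH.rho_mul_t q j
    | rho_s i =>
      simp only [map_mul, FreeAlgebra.lift_ι_apply]
      exact congrArg Units.val (YH.rho_mul_S q i)
    | comm i j h h' =>
      simp only [map_mul, FreeAlgebra.lift_ι_apply]
      exact congrArg Units.val (YH.S_comm q i j h h')
    | braid i h =>
      simp only [map_mul, FreeAlgebra.lift_ι_apply]
      exact congrArg Units.val (YH.S_braid q i h)
    | quad i =>
      simp only [map_mul, map_add, map_one, map_smul, tIdem, map_sum, map_pow,
        FreeAlgebra.lift_ι_apply]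
      exact YH.S_sq q i
    | rho_inv =>
      simp only [map_mul, map_one, FreeAlgebra.lift_ι_apply]
      exact Units.mul_inv _
    | inv_rho =>
      simp only [map_mul, map_one, FreeAlgebra.lift_ι_apply]
      exact Units.inv_mul _⟩

lemma toYH_gen (g : IMGen n) :
    toYH q r n (RingQuot.mkAlgHom K (IMRel K q r n) (FreeAlgebra.ι K g)) = toYHGen q r g := by
  rw [toYH, RingQuot.liftAlgHom_mkAlgHom_apply, FreeAlgebra.lift_ι_apply]

/-- The images of the generators under the inverse of `Φ`. -/
noncomputable def ofYHGen (r : ℕ) : YGen n → IM K q r n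
  | .t j => IM.t q r j
  | .g i => IM.gUnit q r i
  | .X => IM.XUnit q r n
  | .Xinv => ↑(IM.XUnit q r n)⁻¹

/-- The inverse of `Φ`. -/
noncomputable def ofYH (r n : ℕ) : YH K q r n →ₐ[K] IM K q r n :=
  RingQuot.liftAlgHom K ⟨FreeAlgebra.lift K (ofYHGen q r), by
    intro x y h
    cases h with
    | g_comm i j h =>
      simp only [map_mul, FreeAlgebra.lift_ι_apply]
      obtain h | h := h
      · exact congrArg Units.val (IM.gUnit_comm q i j h)
      · exact congrArg Units.val (IM.gUnit_comm q j i h).symm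
    | g_braid i j h =>
      simp only [map_mul, FreeAlgebra.lift_ι_apply]
      exact congrArg Units.val (IM.gUnit_braid q i j h)
    | t_comm i j =>
      simp only [map_mul, FreeAlgebra.lift_ι_apply]
      exact IM.t_comm q i j
    | g_t i j =>
      simp only [map_mul, FreeAlgebra.lift_ι_apply]
      exact IM.S_mul_t_of_finite q i j
    | t_pow j =>
      simp only [map_pow, map_one, FreeAlgebra.lift_ι_apply]
      exact IM.t_pow q j
    | quad i =>
      simp only [map_mul, map_add, map_one, map_smul, tIdem, map_sum, map_pow,
        FreeAlgebra.lift_ι_apply]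
      exact (pow_two _).trans (IM.S_mul_S q i.toNode)
    | X_inv =>
      simp only [map_mul, map_one, FreeAlgebra.lift_ι_apply]
      exact Units.mul_inv _
    | inv_X =>
      simp only [map_mul, map_one, FreeAlgebra.lift_ι_apply]
      exact Units.inv_mul _
    | g_X_first i h =>
      simp only [map_mul, FreeAlgebra.lift_ι_apply]
      exact congrArg Units.val (IM.XUnit_first q i h)
    | g_X i h =>
      simp only [map_mul, FreeAlgebra.lift_ι_apply]
      exact congrArg Units.val (IM.XUnit_comm q i h).symm
    | t_X j =>
      simp only [map_mul, FreeAlgebra.lift_ι_apply]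
      exact IM.t_mul_XUnit q j⟩

lemma ofYH_gen (g : YGen n) :
    ofYH q r n (RingQuot.mkAlgHom K (YRel K q r n) (FreeAlgebra.ι K g)) = ofYHGen q r g := by
  rw [ofYH, RingQuot.liftAlgHom_mkAlgHom_apply, FreeAlgebra.lift_ι_apply]

lemma RingQuot.algHom_ext_gen {G B : Type*} [Ring B] [Algebra K B]
    {rel : FreeAlgebra K G → FreeAlgebra K G → Prop} {φ ψ : RingQuot rel →ₐ[K] B}
    (h : ∀ g, φ (RingQuot.mkAlgHom K rel (FreeAlgebra.ι K g)) =
      ψ (RingQuot.mkAlgHom K rel (FreeAlgebra.ι K g))) : φ = ψ := by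
  apply RingQuot.ringQuot_ext'
  apply FreeAlgebra.hom_ext
  funext g
  exact h g

lemma map_toYH_SUnit (i : Node n) :
    Units.map (toYH q r n : IM K q r n →* YH K q r n) (IM.SUnit q r i) = YH.S q r i :=
  Units.ext (toYH_gen q (.s i))

lemma map_toYH_R : Units.map (toYH q r n : IM K q r n →* YH K q r n) (IM.R q r n) = YH.rho q r n :=
  Units.ext (toYH_gen q .rho)

lemma map_toYH_XUnit :
    Units.map (toYH q r n : IM K q r n →* YH K q r n) (IM.XUnit q r n) = YH.XUnit q r n := by
  rw [IM.XUnit, map_mul, map_inv, map_fdown, map_toYH_R, YH.rho, inv_mul_eq_iff_eq_mul]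
  simp only [IM.gUnit, map_toYH_SUnit, YH.S_toNode]

lemma map_ofYH_gUnit (i : FNode n) :
    Units.map (ofYH q r n : YH K q r n →* IM K q r n) (YH.gUnit q r i) = IM.gUnit q r i :=
  Units.ext (ofYH_gen q (.g i))

lemma map_ofYH_XUnit :
    Units.map (ofYH q r n : YH K q r n →* IM K q r n) (YH.XUnit q r n) = IM.XUnit q r n :=
  Units.ext (ofYH_gen q .X)

lemma map_ofYH_rho :
    Units.map (ofYH q r n : YH K q r n →* IM K q r n) (YH.rho q r n) = IM.R q r n := by
  rw [YH.rho, map_mul, map_fdown, map_ofYH_XUnit]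
  simp only [map_ofYH_gUnit]
  exact IM.fdown_mul_XUnit q r n

/-- For the affine label, $T_{s_0}$ is on both sides the conjugate by $\rho$ of the first finite
generator. -/
lemma map_ofYH_S (i : Node n) :
    Units.map (ofYH q r n : YH K q r n →* IM K q r n) (YH.S q r i) = IM.SUnit q r i := by
  have hfin : ∀ j : FNode n, Units.map (ofYH q r n : YH K q r n →* IM K q r n)
      (YH.S q r j.toNode) = IM.SUnit q r j.toNode := fun j => by
    rw [YH.S_toNode, map_ofYH_gUnit, IM.gUnit]
  by_cases h : (i.1 : ℕ) + 1 < n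
  · exact hfin ⟨i.1, h⟩
  · obtain ⟨j, rfl⟩ := i.exists_finite_prev h
    rw [← mul_left_inj (IM.R q r n), ← IM.R_mul_SUnit, ← map_ofYH_rho, ← map_mul, ← YH.rho_mul_S,
      map_mul, hfin]

lemma toYH_comp_ofYH : (toYH q r n).comp (ofYH q r n) = AlgHom.id K _ := by
  refine RingQuot.algHom_ext_gen fun g => ?_
  rw [AlgHom.comp_apply, ofYH_gen]
  match g with
  | .t j => exact toYH_gen q (.t j)
  | .g i =>
    refine (toYH_gen q (.s i.toNode)).trans ?_
    rw [toYHGen, YH.S_toNode]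
    rfl
  | .X => exact congrArg Units.val (map_toYH_XUnit q)
  | .Xinv => exact congrArg Units.inv (map_toYH_XUnit q)

lemma ofYH_comp_toYH : (ofYH q r n).comp (toYH q r n) = AlgHom.id K _ := by
  refine RingQuot.algHom_ext_gen fun g => ?_
  rw [AlgHom.comp_apply, toYH_gen]
  match g with
  | .t j => exact ofYH_gen q (.t j)
  | .s i => exact congrArg Units.val (map_ofYH_S q i)
  | .rho => exact congrArg Units.val (map_ofYH_rho q)
  | .rhoInv => exact congrArg Units.inv (map_ofYH_rho q)

/-- The isomorphism `Φ` of `Ĥ_{r,n}^aff` with the affine Yokonuma–Hecke algebra. -/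
noncomputable def yokonumaIso (r n : ℕ) : IM K q r n ≃ₐ[K] YH K q r n :=
  AlgEquiv.ofAlgHom (toYH q r n) (ofYH q r n) (toYH_comp_ofYH q) (ofYH_comp_toYH q)

end YokonumaIso

end AYH

theorem theorem2p12 {K : Type*} [Field K] [IsAlgClosed K] (p : ℕ) [CharP K p]
    (r n : ℕ) (hp : ¬ p ∣ r) (hn : 1 ≤ n) (q : K) (hq : q ≠ 0)
    (ζ : Fin r ≃ rootsOfUnity r K)
    (π : ∀ μ : AYH.RComp r n, Fin (AYH.numMinRep μ) ≃ AYH.MinRep μ) :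
    ∃ (Φ : AYH.IM K q r n ≃ₐ[K] AYH.YH K q r n)
      (F : AYH.IM K q r n ≃ₐ[K] ∀ μ : AYH.RComp r n,
        Matrix (Fin (AYH.numMinRep μ)) (Fin (AYH.numMinRep μ)) (AYH.HMu K q μ))
      (G : AYH.YH K q r n ≃ₐ[K] ∀ μ : AYH.RComp r n,
        Matrix (Fin (AYH.numMinRep μ)) (Fin (AYH.numMinRep μ)) (AYH.HMu K q μ)),
      -- the isomorphism `Φ` of `Ĥ_{r,n}^aff` with `Ŷ_{r,n}`, on generators
      (∀ j, Φ (AYH.IM.t q r j) = AYH.YH.t q r j) ∧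
      (∀ i : AYH.FNode n, Φ (AYH.IM.S q r i.toNode) = AYH.YH.g q r i) ∧
      (∀ h : 2 ≤ n, Φ (AYH.IM.S q r (AYH.Node.zero h)) =
        AYH.YH.Xinv q r n * AYH.YH.Xn q r n * AYH.YH.palInv q r n) ∧
      (Φ (AYH.IM.R q r n : (AYH.IM K q r n)ˣ) = AYH.YH.gDown q r n * AYH.YH.X q r n) ∧
      -- `F` maps the ideal generated by `E_μ` onto the factor with index `μ`
      (∀ μ, F (AYH.idemMu q ζ μ) = Pi.single μ 1) ∧
      -- `Φ_μ (E_{χ_k^μ} T_w) = S_{π_k⁻¹ w π_j} M_{k,j}` whenever `w χ_j^μ = χ_k^μ`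
      (∀ (μ : AYH.RComp r n) (k j : Fin (AYH.numMinRep μ)) (w : AYH.EW n)
        (h : AYH.Chi.act w.right (AYH.Chi.act (π μ j).1 (AYH.chi1 μ)) =
          AYH.Chi.act (π μ k).1 (AYH.chi1 μ)),
        F (AYH.idemE q ζ (AYH.Chi.act (π μ k).1 (AYH.chi1 μ)) * AYH.IM.std q r w) =
          Pi.single μ (Matrix.single k j (AYH.HMu.std q ⟨_, AYH.conj_mem h⟩))) ∧
      -- `Ψ_μ ((S_{w_{ij}})) = ∑_{i,j} E_{χ_i^μ} T_{π_i w_{ij} π_j⁻¹} E_{χ_j^μ}`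
      (∀ (μ : AYH.RComp r n)
        (w : Fin (AYH.numMinRep μ) → Fin (AYH.numMinRep μ) → AYH.affYoung μ),
        F.symm (Pi.single μ (Matrix.of fun i j => AYH.HMu.std q (w i j))) =
          ∑ i, ∑ j, AYH.idemE q ζ (AYH.Chi.act (π μ i).1 (AYH.chi1 μ)) *
            AYH.IM.std q r (SemidirectProduct.inr (π μ i).1 * (w i j).1 *
              (SemidirectProduct.inr (π μ j).1)⁻¹) *
            AYH.idemE q ζ (AYH.Chi.act (π μ j).1 (AYH.chi1 μ))) ∧
      -- `G` is the isomorphism for `Ŷ_{r,n}` obtained by transport along `Φ`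
      (∀ x, G (Φ x) = F x) := by

  have hn' : n ≠ 0 := by omega
  have hr : (r : K) ≠ 0 := fun h => hp ((CharP.cast_eq_zero_iff K p r).mp h)
  refine ⟨AYH.yokonumaIso q r n, AYH.matIso q ζ π hn' hr,
    (AYH.yokonumaIso q r n).symm.trans (AYH.matIso q ζ π hn' hr), fun j => ?_, fun i => ?_,
    fun h => ?_, ?_, fun μ => ?_, fun μ k j w h => ?_, fun μ w => ?_, fun x => ?_⟩
  · exact AYH.toYH_gen q (.t j)
  · refine (AYH.toYH_gen q (.s i.toNode)).trans ?_
    rw [AYH.toYHGen, AYH.YH.S_toNode]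
    rfl
  · exact (AYH.toYH_gen q (.s (AYH.Node.zero h))).trans (AYH.YH.S_zero q h)
  · exact (AYH.toYH_gen q .rho).trans (AYH.YH.coe_rho q r n)
  · exact AYH.matIso_idemMu q ζ π hn' hr μ
  · exact AYH.matIso_idemE_mul_std q ζ π hn' hr h
  · exact AYH.matIso_symm_single q ζ π hn' hr μ w
  · rw [AlgEquiv.trans_apply, AlgEquiv.symm_apply_apply]
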